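/- Let $k$ be a finite field and let $\mathcal{A}$ be an essentially small hereditary abelian $k$-linear category (so $\operatorname{Ext}^n_{\mathcal A}(X,Y)=0$ for $n\ge 2$) such that $\operatorname{Hom}_{\mathcal A}(X,Y)$ and $\operatorname{Ext}^1_{\mathcal A}(X,Y)$ are finite-dimensional over $k$ for all objects $X,Y$. Write $\operatorname{Iso}(\mathcal A)$ for the set of isomorphism classes of objects, $\widehat X\in K_0(\mathcal A)$ for the class of $X$ in the Grothendieck group, and $\langle\widehat X,\widehat Y\rangle=|\operatorname{Hom}_{\mathcal A}(X,Y)|/|\operatorname{Ext}^1_{\mathcal A}(X,Y)|$ for the multiplicative Euler form, extended bilinearly to $K_0(\mathcal A)\times K_0(\mathcal A)\to\mathbb Q^\times$. Let $t\ge 1$ and let $\mathcal C=\mathcal C_{\mathbb Z/t}(\mathcal A)$ be the abelian category of $\mathbb Z/t$-graded complexes $M=(M^i,d^i\colon M^i\to M^{i+1})_{i\in\mathbb Z/t}$, $d^{i+1}d^i=0$. Its Ringel–Hall algebra $\mathcal H(\mathcal C)$ is the $\mathbb Q$-vector space with basis the isomorphism classes $[M]$ of objects of $\mathcal C$ and with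 the product $$[M]\diamond[N]=\sum_{[L]}\frac{|\operatorname{Ext}^1_{\mathcal C}(M,N)_L|}{|\operatorname{Hom}_{\mathcal C}(M,N)|}\,[L],$$ where $\operatorname{Ext}^1_{\mathcal C}(M,N)_L$ is the set of classes of extensions $0\to N\to L'\to M\to 0$ with $L'\cong L$. Let $J$ be the two-sided ideal generated by all differences $[M_1]-[M_2]$ such that $H^i(M_1)\cong H^i(M_2)$ and $\widehat{\operatorname{Im} d^i_{M_1}}=\widehat{\operatorname{Im} d^i_{M_2}}$ for all $i\in\mathbb Z/t$. The semi-derived Ringel–Hall algebra $\mathcal{SDH}_{\mathbb Z/t}(\mathcal A)$ is the localization of $\mathcal H(\mathcal C)/J$ at the set of all $r[K]$ with $r\in\mathbb Q^\times$ and $K$ an acyclic complex. For an object $X$ and $i\in\mathbb Z/t$ let $U_{X,i}$ be the complex with $X$ in degree $i$ and $0$ elsewhere, and let $K_{X,i}$ be the acyclic complex with $X$ in the degrees $i-1$ and $i$ and differential $1_X$ from degree $i-1$ to degree $i$ if $t>1$, and $K_{X,0}=\left(X\oplus X,\begin{pmatrix}0&1\\0&0\end{pmatrix}\right)$ if $t=1$.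 For $\alpha\in K_0(\mathcal A)$ put $$K_{\alpha,i}=\frac{1}{\langle\alpha,\widehat N\rangle^{m}}\,[K_{P,i}]\diamond[K_{N,i}]^{-1}\in\mathcal{SDH}_{\mathbb Z/t}(\mathcal A),\qquad \alpha=\widehat P-\widehat N,$$ with $m=1$ if $t>1$ and $m=2$ if $t=1$. Then $K_{\alpha,i}$ does not depend on the choice of $P,N$ with $\alpha=\widehat P-\widehat N$, and the elements $$K_{\alpha^0,0}\diamond K_{\alpha^1,1}\diamond\cdots\diamond K_{\alpha^{t-1},t-1}\diamond[U_{A^{t-1},t-1}]\diamond\cdots\diamond[U_{A^0,0}],$$ indexed by all $(\alpha^0,\dots,\alpha^{t-1})\in K_0(\mathcal A)^t$ and $([A^0],\dots,[A^{t-1}])\in\operatorname{Iso}(\mathcal A)^t$, form a basis of the $\mathbb Q$-vector space $\mathcal{SDH}_{\mathbb Z/t}(\mathcal A)$. -/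

import Mathlib

open CategoryTheory

universe v u

noncomputable section

namespace SemiDerived

open CategoryTheory.Limits CategoryTheory.Abelian
open scoped ZeroObject

section Iso

variable {E : Type u} [Category.{v} E]

variable (E) in
/-- `Iso(E)`: the type of isomorphism classes of objects of `E`. -/
def IsoClass : Type u := Quotient (isIsomorphicSetoid E)

/-- The isomorphism class `[X]` of an object. -/
def IsoClass.mk (X : E) : IsoClass E := Quotient.mk (isIsomorphicSetoid E) X

/-- A chosen representative of an isomorphism class. -/
def IsoClass.rep (x : IsoClass E) : E := Quotient.out (s := isIsomorphicSetoid E) x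

lemma IsoClass.mk_rep (x : IsoClass E) : IsoClass.mk x.rep = x :=
  Quotient.out_eq (s := isIsomorphicSetoid E) x

lemma IsoClass.mk_eq_iff {X Y : E} : IsoClass.mk X = IsoClass.mk Y ↔ Nonempty (X ≅ Y) :=
  Quotient.eq (r := isIsomorphicSetoid E)

lemma IsoClass.nonempty_iso (X : E) : Nonempty ((IsoClass.mk X).rep ≅ X) :=
  IsoClass.mk_eq_iff.1 (IsoClass.mk_rep _)

end Iso

section Ext

variable {E : Type u} [Category.{v} E] [Abelian E]

attribute [local instance] HasExt.standard

/-- `Ext¹(A, C)_B`: the set of classes in `Ext¹(A, C)` of short exact sequences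
`0 ⟶ C ⟶ B ⟶ A ⟶ 0` with middle term (isomorphic to) `B`. -/
def extMid (A C B : E) : Set (Abelian.Ext.{max u v} A C 1) :=
  {e | ∃ (i : C ⟶ B) (p : B ⟶ A) (w : i ≫ p = 0)
    (h : (ShortComplex.mk i p w).ShortExact), h.extClass = e}

/-- The structure constant `|Ext¹(A, C)_B| / |Hom(A, C)|`. -/
def hallNumber (A C B : E) : ℚ :=
  (Nat.card (extMid A C B) : ℚ) / (Nat.card (A ⟶ C) : ℚ)

variable (E) in
/-- `E` has finite morphism sets, and any two objects admit, up to isomorphism, only finitely many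
middle terms of extensions (as is the case if the groups `Ext¹` are finite). -/
class HallFinite : Prop where
  finite_hom : ∀ X Y : E, Finite (X ⟶ Y)
  finite_mid : ∀ A C : E, {b : IsoClass E | (extMid A C b.rep).Nonempty}.Finite

variable (E) in
/-- All `Hom(X, Y)` and all `Ext¹(X, Y)` are finite. -/
class FiniteHomExt : Prop where
  finite_hom : ∀ X Y : E, Finite (X ⟶ Y)
  finite_ext : ∀ X Y : E, Finite (Abelian.Ext.{max u v} X Y 1)

variable (E) in
/-- `E` is hereditary: `Extⁿ(X, Y) = 0` for all `n ≥ 2`. -/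
class Hereditary : Prop where
  ext_eq_zero : ∀ (X Y : E) (n : ℕ), 2 ≤ n → ∀ e : Abelian.Ext.{max u v} X Y n, e = 0

/-! ### Counting short exact sequences -/

/-- Pairs of morphisms forming a short exact sequence `0 ⟶ C ⟶ B ⟶ A ⟶ 0`. -/
def Ses (A C B : E) : Type v :=
  {x : (C ⟶ B) × (B ⟶ A) // ∃ w : x.1 ≫ x.2 = 0, (ShortComplex.mk x.1 x.2 w).ShortExact}

instance (A C B : E) [HallFinite E] : Finite (Ses A C B) := by
  have := HallFinite.finite_hom C B
  have := HallFinite.finite_hom B A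
  unfold Ses; infer_instance

section

variable {A C B : E}

def Ses.i (s : Ses A C B) : C ⟶ B := s.1.1
def Ses.p (s : Ses A C B) : B ⟶ A := s.1.2
lemma Ses.w (s : Ses A C B) : s.i ≫ s.p = 0 := s.2.1
lemma Ses.exact (s : Ses A C B) : (ShortComplex.mk s.i s.p s.w).ShortExact := s.2.2
instance (s : Ses A C B) : Mono s.i := s.exact.mono_f
instance (s : Ses A C B) : Epi s.p := s.exact.epi_g

@[ext] lemma Ses.ext {s s' : Ses A C B} (h : s.i = s'.i) (h' : s.p = s'.p) : s = s' :=
  Subtype.ext (Prod.ext h h')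

def Ses.mk (i : C ⟶ B) (p : B ⟶ A) (w : i ≫ p = 0)
    (h : (ShortComplex.mk i p w).ShortExact) : Ses A C B := ⟨(i, p), w, h⟩

@[simp] lemma Ses.mk_i (i : C ⟶ B) (p : B ⟶ A) (w h) : (Ses.mk i p w h).i = i := rfl
@[simp] lemma Ses.mk_p (i : C ⟶ B) (p : B ⟶ A) (w h) : (Ses.mk i p w h).p = p := rfl

/-- Lift along the kernel. -/
lemma Ses.exists_lift (s : Ses A C B) {T : E} (x : T ⟶ B) (hx : x ≫ s.p = 0) :
    ∃ y : T ⟶ C, y ≫ s.i = x :=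
  ⟨s.exact.exact.lift x hx, s.exact.exact.lift_f x hx⟩

lemma Ses.exists_desc (s : Ses A C B) {T : E} (x : B ⟶ T) (hx : s.i ≫ x = 0) :
    ∃ y : A ⟶ T, s.p ≫ y = x :=
  ⟨s.exact.exact.desc x hx, s.exact.exact.g_desc x hx⟩

/-- Transport of a short exact sequence along isomorphisms. -/
def Ses.map {A' C' B' : E} (s : Ses A C B) (a : A ≅ A') (c : C ≅ C') (b : B ≅ B') :
    Ses A' C' B' :=
  Ses.mk (c.inv ≫ s.i ≫ b.hom) (b.inv ≫ s.p ≫ a.hom) (by simp [reassoc_of% s.w])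
    (ShortComplex.shortExact_of_iso
      (ShortComplex.isoMk c b a (by simp) (by simp)) s.exact)

@[simp] lemma Ses.map_i {A' C' B' : E} (s : Ses A C B) (a : A ≅ A') (c : C ≅ C') (b : B ≅ B') :
    (s.map a c b).i = c.inv ≫ s.i ≫ b.hom := rfl
@[simp] lemma Ses.map_p {A' C' B' : E} (s : Ses A C B) (a : A ≅ A') (c : C ≅ C') (b : B ≅ B') :
    (s.map a c b).p = b.inv ≫ s.p ≫ a.hom := rfl

def Ses.congr {A' C' B' : E} (a : A ≅ A') (c : C ≅ C') (b : B ≅ B') :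
    Ses A C B ≃ Ses A' C' B' where
  toFun s := s.map a c b
  invFun s := s.map a.symm c.symm b.symm
  left_inv s := by ext <;> simp
  right_inv s := by ext <;> simp

/-- The class of a short exact sequence. -/
def Ses.cls (s : Ses A C B) : Abelian.Ext.{max u v} A C 1 := s.exact.extClass

lemma mem_extMid_iff {e : Abelian.Ext.{max u v} A C 1} : e ∈ extMid A C B ↔ ∃ s : Ses A C B, s.cls = e :=
  ⟨fun ⟨i, p, w, h, he⟩ => ⟨Ses.mk i p w h, he⟩, fun ⟨s, hs⟩ => ⟨s.i, s.p, s.w, s.exact, hs⟩⟩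

lemma extMid_nonempty_iff : (extMid A C B).Nonempty ↔ Nonempty (Ses A C B) :=
  ⟨fun ⟨_, h⟩ => ⟨(mem_extMid_iff.1 h).choose⟩, fun ⟨s⟩ => ⟨_, mem_extMid_iff.2 ⟨s, rfl⟩⟩⟩

/-- Two short exact sequences with the same class are isomorphic. -/
lemma Ses.exists_hom_of_cls_eq {B' : E} (s : Ses A C B) (s' : Ses A C B') (h : s.cls = s'.cls) :
    ∃ φ : B ⟶ B', s.i ≫ φ = s'.i ∧ φ ≫ s'.p = s.p := by
  have h1 : (Ext.mk₀ s.p).comp s'.cls (zero_add 1) = 0 := by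
    rw [← h]; exact s.exact.comp_extClass
  obtain ⟨x, hx⟩ := Ext.covariant_sequence_exact₃ B s'.exact (Ext.mk₀ s.p) (zero_add 1) h1
  obtain ⟨φ, rfl⟩ := Ext.mk₀_bijective _ _ |>.2 x
  have hφ : φ ≫ s'.p = s.p := by
    apply (Ext.mk₀_bijective _ _).1
    simpa using hx
  obtain ⟨c, hc⟩ := s'.exists_lift (s.i ≫ φ) (by simp [hφ, s.w])
  have h2 := ShortComplex.ShortExact.extClass_naturality s.exact s'.exact
    (ShortComplex.homMk c φ (𝟙 _) hc (by simp [hφ]))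
  have h3 : s.cls.comp (Ext.mk₀ (c - 𝟙 C)) (add_zero 1) = 0 := by
    have e1 : s.cls.comp (Ext.mk₀ c) (add_zero 1) = s.cls := by
      refine h2.trans ?_
      simp only [ShortComplex.homMk_τ₃, Ext.mk₀_id_comp]
      exact h.symm
    rw [sub_eq_add_neg, Ext.mk₀_add, Ext.comp_add, e1, ← neg_one_zsmul]
    have : Ext.mk₀ ((-1 : ℤ) • 𝟙 C) = - Ext.mk₀ (𝟙 C) := by
      rw [neg_one_zsmul, Ext.mk₀_neg]
    rw [this, Ext.comp_neg, Ext.comp_mk₀_id, add_neg_cancel]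
  obtain ⟨y, hy⟩ := Ext.contravariant_sequence_exact₁ s.exact C (Ext.mk₀ (c - 𝟙 C)) (add_zero 1) h3
  obtain ⟨g, rfl⟩ := Ext.mk₀_bijective _ _ |>.2 y
  have hg : s.i ≫ g = c - 𝟙 C := by
    apply (Ext.mk₀_bijective _ _).1
    simpa using hy
  refine ⟨φ - g ≫ s'.i, ?_, ?_⟩
  · rw [Preadditive.comp_sub, ← Category.assoc, hg, Preadditive.sub_comp, hc]
    simp
  · simp [hφ, s'.w]

lemma Ses.isIso_of_hom {B' : E} (s : Ses A C B) (s' : Ses A C B') (φ : B ⟶ B')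
    (h1 : s.i ≫ φ = s'.i) (h2 : φ ≫ s'.p = s.p) : IsIso φ :=
  let f := ShortComplex.homMk (S₁ := ShortComplex.mk s.i s.p s.w)
    (S₂ := ShortComplex.mk s'.i s'.p s'.w) (𝟙 C) φ (𝟙 A) (by simp [h1]) (by simp [h2])
  have : IsIso f.τ₁ := inferInstanceAs (IsIso (𝟙 C))
  have : IsIso f.τ₃ := inferInstanceAs (IsIso (𝟙 A))
  ShortComplex.isIso₂_of_shortExact_of_isIso₁₃ f s.exact s'.exact

lemma Ses.exists_iso_of_cls_eq {B' : E} (s : Ses A C B) (s' : Ses A C B') (h : s.cls = s'.cls) :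
    ∃ φ : B ≅ B', s.i ≫ φ.hom = s'.i ∧ φ.hom ≫ s'.p = s.p := by
  obtain ⟨φ, h1, h2⟩ := s.exists_hom_of_cls_eq s' h
  have := s.isIso_of_hom s' φ h1 h2
  exact ⟨asIso φ, h1, h2⟩

lemma Ses.cls_eq_of_hom {B' : E} (s : Ses A C B) (s' : Ses A C B') (φ : B ⟶ B')
    (h1 : s.i ≫ φ = s'.i) (h2 : φ ≫ s'.p = s.p) : s.cls = s'.cls := by
  have := ShortComplex.ShortExact.extClass_naturality s.exact s'.exact
    (ShortComplex.homMk (𝟙 C) φ (𝟙 A) (by simp [h1]) (by simp [h2]))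
  simp only [ShortComplex.homMk_τ₁, ShortComplex.homMk_τ₃, Ext.mk₀_id_comp,
    Ext.comp_mk₀_id] at this
  exact this

/-- The automorphism `1 + p h i`. -/
def Ses.shear (s : Ses A C B) (h : A ⟶ C) : B ≅ B where
  hom := 𝟙 B + s.p ≫ h ≫ s.i
  inv := 𝟙 B - s.p ≫ h ≫ s.i
  hom_inv_id := by simp [Preadditive.add_comp, Preadditive.comp_sub, reassoc_of% s.w]
  inv_hom_id := by simp [Preadditive.sub_comp, Preadditive.comp_add, reassoc_of% s.w]

lemma Ses.exists_shear (s : Ses A C B) (θ : B ⟶ B) (h1 : s.i ≫ θ = s.i) (h2 : θ ≫ s.p = s.p) :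
    ∃ h : A ⟶ C, (s.shear h).hom = θ := by
  obtain ⟨y, hy⟩ := s.exists_desc (θ - 𝟙 B) (by simp [h1])
  obtain ⟨h, hh⟩ := s.exists_lift y (by
    rw [← cancel_epi s.p, ← Category.assoc, hy]; simp [h2])
  exact ⟨h, by simp [Ses.shear, hh, hy]⟩

/-- The fibres of the class map are, up to `Hom(A, C)`, torsors under `Aut B`. -/
lemma Ses.card_fiber (s : Ses A C B) :
    Nat.card {s' : Ses A C B // s'.cls = s.cls} * Nat.card (A ⟶ C) = Nat.card (B ≅ B) := by
  rw [← Nat.card_prod]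
  have hσ : ∀ s' : {s' : Ses A C B // s'.cls = s.cls}, ∃ φ : B ≅ B,
      s.i ≫ φ.hom = s'.1.i ∧ φ.hom ≫ s'.1.p = s.p := fun s' =>
    s.exists_iso_of_cls_eq s'.1 s'.2.symm
  choose σ hσ1 hσ2 using hσ
  refine Nat.card_congr (Equiv.ofBijective
    (fun x => (s.shear x.2) ≪≫ σ x.1) ⟨?_, ?_⟩)
  · rintro ⟨s1, h1⟩ ⟨s2, h2⟩ heq
    have e : (s.shear h1).hom ≫ (σ s1).hom = (s.shear h2).hom ≫ (σ s2).hom :=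
      congrArg Iso.hom heq
    have ei : ∀ h, s.i ≫ (s.shear h).hom = s.i := fun h => by
      simp [Ses.shear, reassoc_of% s.w]
    have ep : ∀ h, (s.shear h).hom ≫ s.p = s.p := fun h => by
      simp [Ses.shear, s.w]
    have hi : s1.1.i = s2.1.i := by
      rw [← hσ1 s1, ← hσ1 s2, ← ei h1, Category.assoc, e, ← Category.assoc, ei h2, ei h1]
    have hp : s1.1.p = s2.1.p := by
      rw [← cancel_epi ((s.shear h1).hom ≫ (σ s1).hom)]
      conv_rhs => rw [e]
      simp [hσ2, ep]
    have : s1 = s2 := Subtype.ext (Ses.ext hi hp)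
    subst this
    have e2 : (s.shear h1).hom = (s.shear h2).hom := (cancel_mono _).1 e
    simp only [Ses.shear, add_right_inj, cancel_epi, cancel_mono] at e2
    rw [e2]
  · intro φ
    let s' : Ses A C B := s.map (Iso.refl _) (Iso.refl _) φ
    have hs' : s.cls = s'.cls := s.cls_eq_of_hom s' φ.hom (by simp [s']) (by simp [s'])
    let s'' : {s' : Ses A C B // s'.cls = s.cls} := ⟨s', hs'.symm⟩
    obtain ⟨h, hh⟩ := s.exists_shear (φ.hom ≫ (σ s'').inv)
      (by rw [← Category.assoc, Iso.comp_inv_eq, hσ1]; simp [s'', s'])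
      (by
        rw [Category.assoc, ← cancel_epi φ.inv, Iso.inv_hom_id_assoc, Iso.inv_comp_eq]
        have := hσ2 s''
        simp only [s'', s', Ses.map_p, Iso.refl_hom, Category.comp_id] at this ⊢
        exact this.symm)
    refine ⟨(s'', h), ?_⟩
    ext
    simp [hh]

/-- The formula of Riedtmann. -/
lemma hallNumber_eq [HallFinite E] (A C B : E) :
    hallNumber A C B = (Nat.card (Ses A C B) : ℚ) / (Nat.card (B ≅ B) : ℚ) := by
  have := HallFinite.finite_hom A C
  have := HallFinite.finite_hom B B
  have : Finite (B ≅ B) := Finite.of_injective (fun φ => φ.hom) (fun _ _ h => Iso.ext h)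
  have hAut : (Nat.card (B ≅ B) : ℚ) ≠ 0 := by
    have : Nonempty (B ≅ B) := ⟨Iso.refl _⟩
    exact_mod_cast Nat.card_pos.ne'
  have hHom : (Nat.card (A ⟶ C) : ℚ) ≠ 0 := by
    have : Nonempty (A ⟶ C) := ⟨0⟩
    exact_mod_cast Nat.card_pos.ne'
  unfold hallNumber
  rw [div_eq_div_iff hHom hAut]
  let f : Ses A C B → extMid A C B := fun s => ⟨s.cls, mem_extMid_iff.2 ⟨s, rfl⟩⟩
  have hf : Function.Surjective f := fun ⟨e, he⟩ => by
    obtain ⟨s, hs⟩ := mem_extMid_iff.1 he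
    exact ⟨s, Subtype.ext hs⟩
  have : Finite (extMid A C B) := Finite.of_surjective f hf
  have key : Nat.card (extMid A C B) * Nat.card (B ≅ B) =
      Nat.card (Ses A C B) * Nat.card (A ⟶ C) := by
    have := Fintype.ofFinite (extMid A C B)
    rw [← Nat.card_congr (Equiv.sigmaFiberEquiv f), Nat.card_sigma, Finset.sum_mul,
      Finset.sum_congr rfl (g := fun _ => Nat.card (B ≅ B))]
    · simp
    · intro e _
      obtain ⟨s, rfl⟩ := hf e
      rw [← s.card_fiber]
      congr 1
      exact Nat.card_congr (Equiv.subtypeEquivRight fun s' => by simp [f])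
  exact_mod_cast key

end

lemma hallNumber_congr [HallFinite E] {A C B A' C' B' : E} (a : A ≅ A') (c : C ≅ C')
    (b : B ≅ B') : hallNumber A C B = hallNumber A' C' B' := by
  rw [hallNumber_eq, hallNumber_eq, Nat.card_congr (Ses.congr a c b),
    Nat.card_congr (Iso.isoCongr b b)]


/-! ### Associativity: counting two-step filtrations -/

/-- A monomorphism `D ⟶ M` together with a short exact sequence
`0 ⟶ C ⟶ M / D ⟶ A ⟶ 0`. -/
def LeftFilt (A C D M : E) : Type v :=
  Σ j : {j : D ⟶ M // Mono j}, Ses A C (cokernel j.1)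

/-- An epimorphism `q : M ⟶ A` together with a short exact sequence
`0 ⟶ D ⟶ ker q ⟶ C ⟶ 0`. -/
def RightFilt (A C D M : E) : Type v :=
  Σ q : {q : M ⟶ A // Epi q}, Ses C D (kernel q.1)

instance [HallFinite E] (A C D M : E) : Finite (LeftFilt A C D M) := by
  have := HallFinite.finite_hom D M
  unfold LeftFilt; infer_instance

instance [HallFinite E] (A C D M : E) : Finite (RightFilt A C D M) := by
  have := HallFinite.finite_hom M A
  unfold RightFilt; infer_instance

/-- The short exact sequence of a monomorphism. -/
def Ses.ofMono {D M B : E} (j : D ⟶ M) [Mono j] (e : cokernel j ≅ B) : Ses B D M :=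
  Ses.mk j (cokernel.π j ≫ e.hom) (by simp)
    { exact := ShortComplex.exact_of_g_is_cokernel _
        (CokernelCofork.IsColimit.ofπ' _ (by simp) (fun k hk =>
          ⟨e.inv ≫ cokernel.desc j k hk, by simp⟩))
      mono_f := ‹_›
      epi_g := epi_comp _ _ }

/-- The short exact sequence of an epimorphism. -/
def Ses.ofEpi {A M N : E} (q : M ⟶ A) [Epi q] (e : N ≅ kernel q) : Ses A N M :=
  Ses.mk (e.hom ≫ kernel.ι q) q (by simp)
    { exact := ShortComplex.exact_of_f_is_kernel _
        (KernelFork.IsLimit.ofι' _ (by simp) (fun k hk =>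
          ⟨kernel.lift q k hk ≫ e.inv, by simp⟩))
      mono_f := mono_comp _ _
      epi_g := ‹_› }

def Ses.cokerIso {A C B : E} (s : Ses A C B) : cokernel s.i ≅ A :=
  (colimit.isColimit _).coconePointUniqueUpToIso s.exact.gIsCokernel

@[simp] lemma Ses.π_cokerIso {A C B : E} (s : Ses A C B) :
    cokernel.π s.i ≫ s.cokerIso.hom = s.p :=
  IsColimit.comp_coconePointUniqueUpToIso_hom (colimit.isColimit _) s.exact.gIsCokernel
    WalkingParallelPair.one

def Ses.kerIso {A C B : E} (s : Ses A C B) : C ≅ kernel s.p :=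
  s.exact.fIsKernel.conePointUniqueUpToIso (limit.isLimit _)

@[simp] lemma Ses.kerIso_ι {A C B : E} (s : Ses A C B) :
    s.kerIso.hom ≫ kernel.ι s.p = s.i :=
  IsLimit.conePointUniqueUpToIso_hom_comp s.exact.fIsKernel (limit.isLimit _)
    WalkingParallelPair.zero

lemma card_leftFilt_fiber (A C D M B : E) :
    Nat.card (Ses A C B) * Nat.card (Ses B D M) =
      Nat.card (B ≅ B) *
        Nat.card {y : LeftFilt A C D M // IsoClass.mk (cokernel y.1.1) = IsoClass.mk B} := by
  have hτ : ∀ j : {j : D ⟶ M // IsoClass.mk (cokernel j) = IsoClass.mk B},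
      Nonempty (cokernel j.1 ≅ B) := fun j => IsoClass.mk_eq_iff.1 j.2
  let τ := fun j => (hτ j).some
  rw [← Nat.card_prod, ← Nat.card_prod]
  symm
  refine Nat.card_congr (Equiv.ofBijective
    (fun x => (x.2.1.2.map (Iso.refl _) (Iso.refl _) (τ ⟨x.2.1.1.1, x.2.2⟩ ≪≫ x.1),
      haveI := x.2.1.1.2
      Ses.ofMono x.2.1.1.1 (τ ⟨x.2.1.1.1, x.2.2⟩ ≪≫ x.1))) ⟨?_, ?_⟩)
  · rintro ⟨φ, ⟨⟨⟨j, hj⟩, t⟩, hy⟩⟩ ⟨φ', ⟨⟨⟨j', hj'⟩, t'⟩, hy'⟩⟩ heq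
    have e1 := congrArg Prod.fst heq
    have e2 := congrArg Prod.snd heq
    have hjj : j = j' := congrArg Ses.i e2
    subst hjj
    have hp := congrArg Ses.p e2
    simp only [Ses.ofMono, Ses.mk_p, cancel_epi, Iso.trans_hom] at hp
    have hφ : φ = φ' := Iso.ext hp
    subst hφ
    have ht : t = t' := (Ses.congr (Iso.refl _) (Iso.refl _) _).injective e1
    subst ht
    rfl
  · rintro ⟨x, s⟩
    have hy : IsoClass.mk (cokernel s.i) = IsoClass.mk B := IsoClass.mk_eq_iff.2 ⟨s.cokerIso⟩
    refine ⟨((τ ⟨s.i, hy⟩).symm ≪≫ s.cokerIso, ⟨⟨⟨s.i, inferInstance⟩,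
      x.map (Iso.refl _) (Iso.refl _) s.cokerIso.symm⟩, hy⟩), ?_⟩
    refine Prod.ext ?_ ?_
    · ext <;> simp
    · ext <;> simp [Ses.ofMono]

lemma card_rightFilt_fiber (A C D M N : E) :
    Nat.card (Ses C D N) * Nat.card (Ses A N M) =
      Nat.card (N ≅ N) *
        Nat.card {y : RightFilt A C D M // IsoClass.mk (kernel y.1.1) = IsoClass.mk N} := by
  have hτ : ∀ q : {q : M ⟶ A // IsoClass.mk (kernel q) = IsoClass.mk N},
      Nonempty (kernel q.1 ≅ N) := fun q => IsoClass.mk_eq_iff.1 q.2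
  let τ := fun q => (hτ q).some
  rw [← Nat.card_prod, ← Nat.card_prod]
  symm
  refine Nat.card_congr (Equiv.ofBijective
    (fun x => (x.2.1.2.map (Iso.refl _) (Iso.refl _) (τ ⟨x.2.1.1.1, x.2.2⟩ ≪≫ x.1),
      haveI := x.2.1.1.2
      Ses.ofEpi x.2.1.1.1 (τ ⟨x.2.1.1.1, x.2.2⟩ ≪≫ x.1).symm)) ⟨?_, ?_⟩)
  · rintro ⟨φ, ⟨⟨⟨q, hq⟩, t⟩, hy⟩⟩ ⟨φ', ⟨⟨⟨q', hq'⟩, t'⟩, hy'⟩⟩ heq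
    have e1 := congrArg Prod.fst heq
    have e2 := congrArg Prod.snd heq
    have hqq : q = q' := congrArg Ses.p e2
    subst hqq
    have hp := congrArg Ses.i e2
    simp only [Ses.ofEpi, Ses.mk_i, cancel_mono, Iso.symm_hom, Iso.trans_inv] at hp
    have hφ : φ = φ' := by rw [← Iso.symm_eq_iff]; exact Iso.ext hp
    subst hφ
    have ht : t = t' := (Ses.congr (Iso.refl _) (Iso.refl _) _).injective e1
    subst ht
    rfl
  · rintro ⟨x, s⟩
    have hy : IsoClass.mk (kernel s.p) = IsoClass.mk N := IsoClass.mk_eq_iff.2 ⟨s.kerIso.symm⟩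
    refine ⟨((τ ⟨s.p, hy⟩).symm ≪≫ s.kerIso.symm, ⟨⟨⟨s.p, inferInstance⟩,
      x.map (Iso.refl _) (Iso.refl _) s.kerIso⟩, hy⟩), ?_⟩
    refine Prod.ext ?_ ?_
    · ext <;> simp
    · ext <;> simp [Ses.ofEpi]

/-- The correspondence between the two kinds of filtrations. -/
def FiltRel {A C D M : E} (y : LeftFilt A C D M) (z : RightFilt A C D M) : Prop :=
  y.1.1 = z.2.i ≫ kernel.ι z.1.1 ∧ z.1.1 = cokernel.π y.1.1 ≫ y.2.p ∧
    z.2.p ≫ y.2.i = kernel.ι z.1.1 ≫ cokernel.π y.1.1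

lemma filtRel_exists_right {A C D M : E} (y : LeftFilt A C D M) : ∃ z, FiltRel y z := by
  obtain ⟨⟨j, hj⟩, t⟩ := y
  let q : M ⟶ A := cokernel.π j ≫ t.p
  have hq : Epi q := epi_comp _ _
  let k : D ⟶ kernel q := kernel.lift q j (by simp [q])
  have hk : k ≫ kernel.ι q = j := kernel.lift_ι _ _ _
  obtain ⟨s, hs⟩ := t.exists_lift (kernel.ι q ≫ cokernel.π j) (by
    rw [Category.assoc]; exact kernel.condition q)
  have hks : k ≫ s = 0 := by
    rw [← cancel_mono t.i, Category.assoc, hs, ← Category.assoc, hk]; simp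
  have hkm : Mono k := by
    have : Mono (k ≫ kernel.ι q) := by rw [hk]; exact hj
    exact mono_of_mono k (kernel.ι q)
  have hse : Epi s := by
    rw [epi_iff_surjective_up_to_refinements]
    intro T c
    obtain ⟨T', π, hπ, m, hm⟩ := surjective_up_to_refinements_of_epi (cokernel.π j) (c ≫ t.i)
    refine ⟨T', π, hπ, kernel.lift q m ?_, ?_⟩
    · simp only [q]
      rw [← Category.assoc, ← hm]; simp [t.w]
    · rw [← cancel_mono t.i, Category.assoc, Category.assoc, hs, kernel.lift_ι_assoc, hm]
  have hex : (ShortComplex.mk k s hks).Exact := by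
    rw [ShortComplex.exact_iff_exact_up_to_refinements]
    intro T x hx
    dsimp at x hx
    have hx' : (x ≫ kernel.ι q) ≫ cokernel.π j = 0 := by
      rw [Category.assoc, ← hs, ← Category.assoc, hx, zero_comp]
    obtain ⟨d, hd⟩ := (Ses.ofMono j (Iso.refl _)).exists_lift (x ≫ kernel.ι q) (by
      simpa [Ses.ofMono] using hx')
    refine ⟨T, 𝟙 T, inferInstance, d, ?_⟩
    rw [← cancel_mono (kernel.ι q)]
    simp only [Category.id_comp, Category.assoc, hk]
    exact hd.symm
  exact ⟨⟨⟨q, hq⟩, Ses.mk k s hks { exact := hex, mono_f := hkm, epi_g := hse }⟩,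
    hk.symm, rfl, hs⟩

lemma filtRel_exists_left {A C D M : E} (z : RightFilt A C D M) : ∃ y, FiltRel y z := by
  obtain ⟨⟨q, hq⟩, t⟩ := z
  let j : D ⟶ M := t.i ≫ kernel.ι q
  have hj : Mono j := mono_comp _ _
  let p : cokernel j ⟶ A := cokernel.desc j q (by simp [j])
  have hp : cokernel.π j ≫ p = q := cokernel.π_desc _ _ _
  obtain ⟨i, hi⟩ := t.exists_desc (kernel.ι q ≫ cokernel.π j) (by
    rw [← Category.assoc]; exact cokernel.condition j)
  have hip : i ≫ p = 0 := by
    rw [← cancel_epi t.p, ← Category.assoc, hi, Category.assoc, hp]; simp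
  have hpe : Epi p := by
    have : Epi (cokernel.π j ≫ p) := by rw [hp]; exact hq
    exact epi_of_epi (cokernel.π j) p
  have him : Mono i := by
    refine Preadditive.mono_of_cancel_zero _ fun {T} c hc => ?_
    obtain ⟨T', π, hπ, x, hx⟩ := surjective_up_to_refinements_of_epi t.p c
    have h0 : (x ≫ kernel.ι q) ≫ cokernel.π j = 0 := by
      rw [Category.assoc, ← hi, ← Category.assoc, ← hx, Category.assoc, hc, comp_zero]
    obtain ⟨d, hd⟩ := (Ses.ofMono j (Iso.refl _)).exists_lift (x ≫ kernel.ι q) (by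
      simpa [Ses.ofMono] using h0)
    have hd' : d ≫ t.i = x := by
      rw [← cancel_mono (kernel.ι q), Category.assoc]; exact hd
    rw [← cancel_epi π, hx, ← hd', Category.assoc, t.w, comp_zero, comp_zero]
  have hex : (ShortComplex.mk i p hip).Exact := by
    rw [ShortComplex.exact_iff_exact_up_to_refinements]
    intro T x hx
    dsimp at x hx
    obtain ⟨T', π, hπ, m, hm⟩ := surjective_up_to_refinements_of_epi (cokernel.π j) x
    refine ⟨T', π, hπ, kernel.lift q m ?_ ≫ t.p, ?_⟩
    · rw [← hp, ← Category.assoc, ← hm, Category.assoc, hx, comp_zero]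
    · dsimp
      rw [Category.assoc, hi, kernel.lift_ι_assoc, hm]
  exact ⟨⟨⟨j, hj⟩, Ses.mk i p hip { exact := hex, mono_f := him, epi_g := hpe }⟩,
    rfl, hp.symm, hi.symm ▸ rfl⟩

lemma filtRel_unique_right {A C D M : E} {y : LeftFilt A C D M} {z z' : RightFilt A C D M}
    (h : FiltRel y z) (h' : FiltRel y z') : z = z' := by
  obtain ⟨⟨j, hj⟩, t⟩ := y
  obtain ⟨⟨q, hq⟩, s⟩ := z
  obtain ⟨⟨q', hq'⟩, s'⟩ := z'
  obtain ⟨h1, h2, h3⟩ := h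
  obtain ⟨h1', h2', h3'⟩ := h'
  dsimp only at *
  have : q = q' := h2.trans h2'.symm
  subst this
  have : s = s' := by
    refine Ses.ext ?_ ?_
    · exact (cancel_mono (kernel.ι q)).1 (h1.symm.trans h1')
    · rw [← cancel_mono t.i]; exact h3.trans h3'.symm
  subst this
  rfl

lemma filtRel_unique_left {A C D M : E} {y y' : LeftFilt A C D M} {z : RightFilt A C D M}
    (h : FiltRel y z) (h' : FiltRel y' z) : y = y' := by
  obtain ⟨⟨j, hj⟩, t⟩ := y
  obtain ⟨⟨j', hj'⟩, t'⟩ := y'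
  obtain ⟨⟨q, hq⟩, s⟩ := z
  obtain ⟨h1, h2, h3⟩ := h
  obtain ⟨h1', h2', h3'⟩ := h'
  dsimp only at *
  have : j = j' := h1.trans h1'.symm
  subst this
  have : t = t' := by
    refine Ses.ext ?_ ?_
    · rw [← cancel_epi s.p]; exact h3.trans h3'.symm
    · exact (cancel_epi (cokernel.π j)).1 (h2.symm.trans h2')
  subst this
  rfl

lemma card_leftFilt_eq (A C D M : E) :
    Nat.card (LeftFilt A C D M) = Nat.card (RightFilt A C D M) := by
  choose f hf using filtRel_exists_right (A := A) (C := C) (D := D) (M := M)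
  refine Nat.card_congr (Equiv.ofBijective f ⟨?_, ?_⟩)
  · intro y y' h
    exact filtRel_unique_left (hf y) (h ▸ hf y')
  · intro z
    obtain ⟨y, hy⟩ := filtRel_exists_left z
    exact ⟨y, filtRel_unique_right (hf y) hy⟩

/-! ### The Ringel-Hall algebra -/

/-- The structure constants, on isomorphism classes. -/
def hallCoeff (a c b : IsoClass E) : ℚ := hallNumber a.rep c.rep b.rep

lemma hallCoeff_eq [HallFinite E] (a c b : IsoClass E) : hallCoeff a c b =
    (Nat.card (Ses a.rep c.rep b.rep) : ℚ) / (Nat.card (b.rep ≅ b.rep) : ℚ) :=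
  hallNumber_eq _ _ _

lemma card_aut_ne_zero [HallFinite E] (B : E) : (Nat.card (B ≅ B) : ℚ) ≠ 0 := by
  have := HallFinite.finite_hom B B
  have : Finite (B ≅ B) := Finite.of_injective (fun φ => φ.hom) (fun _ _ h => Iso.ext h)
  have : Nonempty (B ≅ B) := ⟨Iso.refl _⟩
  exact_mod_cast Nat.card_pos.ne'

lemma hallCoeff_ne_zero_iff [HallFinite E] (a c b : IsoClass E) :
    hallCoeff a c b ≠ 0 ↔ Nonempty (Ses a.rep c.rep b.rep) := by
  rw [hallCoeff_eq, div_ne_zero_iff, Nat.cast_ne_zero, ← Nat.pos_iff_ne_zero, Nat.card_pos_iff]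
  exact ⟨fun h => h.1.1, fun h => ⟨⟨h, inferInstance⟩, card_aut_ne_zero _⟩⟩

lemma hallCoeff_mk [HallFinite E] (A C B : E) :
    hallCoeff (IsoClass.mk A) (IsoClass.mk C) (IsoClass.mk B) = hallNumber A C B :=
  hallNumber_congr (IsoClass.nonempty_iso A).some (IsoClass.nonempty_iso C).some
    (IsoClass.nonempty_iso B).some

/-- `[A] ⋄ [C] = ∑_[B] (|Ext¹(A, C)_B| / |Hom(A, C)|) [B]`. -/
def hallProd [HallFinite E] (a c : IsoClass E) : IsoClass E →₀ ℚ :=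
  Finsupp.ofSupportFinite (hallCoeff a c)
    ((HallFinite.finite_mid a.rep c.rep).subset fun b hb =>
      extMid_nonempty_iff.2 ((hallCoeff_ne_zero_iff a c b).1 hb))

@[simp] lemma hallProd_apply [HallFinite E] (a c b : IsoClass E) :
    hallProd a c b = hallCoeff a c b := rfl

variable (E) in
/-- The bilinear extension of `hallProd`. -/
def hallMul [HallFinite E] :
    (IsoClass E →₀ ℚ) →ₗ[ℚ] (IsoClass E →₀ ℚ) →ₗ[ℚ] (IsoClass E →₀ ℚ) :=
  Finsupp.linearCombination ℚ (fun a : IsoClass E =>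
    Finsupp.linearCombination ℚ (fun c : IsoClass E => hallProd a c))

lemma hallMul_single_left [HallFinite E] (a : IsoClass E) :
    hallMul E (Finsupp.single a 1) =
      Finsupp.linearCombination ℚ (fun c : IsoClass E => hallProd a c) := by
  simp [hallMul]

lemma hallMul_single [HallFinite E] (a c : IsoClass E) :
    hallMul E (Finsupp.single a 1) (Finsupp.single c 1) = hallProd a c := by
  simp [hallMul]

lemma hallMul_apply_of [HallFinite E] (x : IsoClass E →₀ ℚ) (d m : IsoClass E) :
    hallMul E x (Finsupp.single d 1) m = x.sum fun b r => r * hallCoeff b d m := by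
  simp [hallMul, Finsupp.linearCombination_apply, LinearMap.finsupp_sum_apply]

lemma hallMul_of_apply [HallFinite E] (x : IsoClass E →₀ ℚ) (a m : IsoClass E) :
    hallMul E (Finsupp.single a 1) x m = x.sum fun n r => r * hallCoeff a n m := by
  rw [hallMul_single_left]
  simp [Finsupp.linearCombination_apply]

lemma sum_left [HallFinite E] (a c d m : IsoClass E) :
    ((hallProd a c).sum fun b r => r * hallCoeff b d m) =
      (Nat.card (LeftFilt a.rep c.rep d.rep m.rep) : ℚ) / (Nat.card (m.rep ≅ m.rep) : ℚ) := by
  classical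
  have := Fintype.ofFinite (LeftFilt a.rep c.rep d.rep m.rep)
  let f : LeftFilt a.rep c.rep d.rep m.rep → IsoClass E := fun y => IsoClass.mk (cokernel y.1.1)
  have hmaps : ∀ y ∈ (Finset.univ : Finset (LeftFilt a.rep c.rep d.rep m.rep)),
      f y ∈ (hallProd a c).support := by
    intro y _
    rw [Finsupp.mem_support_iff, hallProd_apply, hallCoeff_ne_zero_iff]
    exact ⟨y.2.map (Iso.refl _) (Iso.refl _) (IsoClass.nonempty_iso _).some.symm⟩
  rw [Nat.card_eq_fintype_card, ← Finset.card_univ, Finset.card_eq_sum_card_fiberwise hmaps,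
    Nat.cast_sum, Finset.sum_div, Finsupp.sum]
  refine Finset.sum_congr rfl fun b _ => ?_
  have hcard := card_leftFilt_fiber a.rep c.rep d.rep m.rep b.rep
  rw [IsoClass.mk_rep] at hcard
  have h2 : Nat.card {y : LeftFilt a.rep c.rep d.rep m.rep // IsoClass.mk (cokernel y.1.1) = b} =
      (Finset.univ.filter (fun y => f y = b)).card := by
    rw [Nat.card_eq_fintype_card, Fintype.card_subtype]
  rw [h2] at hcard
  have hcard' := congrArg (Nat.cast (R := ℚ)) hcard
  push_cast at hcard'
  have hb := card_aut_ne_zero b.rep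
  rw [hallProd_apply, hallCoeff_eq, hallCoeff_eq, div_mul_div_comm, hcard', mul_div_mul_left _ _ hb]

lemma sum_right [HallFinite E] (a c d m : IsoClass E) :
    ((hallProd c d).sum fun n r => r * hallCoeff a n m) =
      (Nat.card (RightFilt a.rep c.rep d.rep m.rep) : ℚ) / (Nat.card (m.rep ≅ m.rep) : ℚ) := by
  classical
  have := Fintype.ofFinite (RightFilt a.rep c.rep d.rep m.rep)
  let f : RightFilt a.rep c.rep d.rep m.rep → IsoClass E := fun y => IsoClass.mk (kernel y.1.1)
  have hmaps : ∀ y ∈ (Finset.univ : Finset (RightFilt a.rep c.rep d.rep m.rep)),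
      f y ∈ (hallProd c d).support := by
    intro y _
    rw [Finsupp.mem_support_iff, hallProd_apply, hallCoeff_ne_zero_iff]
    exact ⟨y.2.map (Iso.refl _) (Iso.refl _) (IsoClass.nonempty_iso _).some.symm⟩
  rw [Nat.card_eq_fintype_card, ← Finset.card_univ, Finset.card_eq_sum_card_fiberwise hmaps,
    Nat.cast_sum, Finset.sum_div, Finsupp.sum]
  refine Finset.sum_congr rfl fun b _ => ?_
  have hcard := card_rightFilt_fiber a.rep c.rep d.rep m.rep b.rep
  rw [IsoClass.mk_rep] at hcard
  have h2 : Nat.card {y : RightFilt a.rep c.rep d.rep m.rep // IsoClass.mk (kernel y.1.1) = b} =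
      (Finset.univ.filter (fun y => f y = b)).card := by
    rw [Nat.card_eq_fintype_card, Fintype.card_subtype]
  rw [h2] at hcard
  have hcard' := congrArg (Nat.cast (R := ℚ)) hcard
  push_cast at hcard'
  have hb := card_aut_ne_zero b.rep
  rw [hallProd_apply, hallCoeff_eq, hallCoeff_eq, div_mul_div_comm, hcard', mul_div_mul_left _ _ hb]

lemma hallMul_assoc_single [HallFinite E] (a c d : IsoClass E) :
    hallMul E (hallMul E (Finsupp.single a 1) (Finsupp.single c 1)) (Finsupp.single d 1) =
      hallMul E (Finsupp.single a 1) (hallMul E (Finsupp.single c 1) (Finsupp.single d 1)) := by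
  ext m
  rw [hallMul_single, hallMul_single, hallMul_apply_of, hallMul_of_apply, sum_left, sum_right,
    card_leftFilt_eq]

lemma hallMul_assoc [HallFinite E] (x y z : IsoClass E →₀ ℚ) :
    hallMul E (hallMul E x y) z = hallMul E x (hallMul E y z) := by
  induction x using Finsupp.induction_linear with
  | zero => simp
  | add x x' h h' => simp [h, h']
  | single a r =>
    induction y using Finsupp.induction_linear with
    | zero => simp
    | add x x' h h' => simp only [map_add, LinearMap.add_apply, h, h']
    | single c s =>
      induction z using Finsupp.induction_linear with
      | zero => simp
      | add x x' h h' => simp only [map_add, h, h']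
      | single d t =>
        rw [← mul_one r, ← mul_one s, ← mul_one t, ← smul_eq_mul r, ← smul_eq_mul s,
          ← smul_eq_mul t, ← Finsupp.smul_single, ← Finsupp.smul_single, ← Finsupp.smul_single]
        simp only [map_smul, LinearMap.smul_apply, hallMul_assoc_single]

/-- The class of a zero object. -/
lemma isZero_rep_zero : IsZero (IsoClass.mk (0 : E)).rep :=
  (isZero_zero E).of_iso (IsoClass.nonempty_iso (0 : E)).some

lemma Ses.isIso_i {Z C B : E} (hZ : IsZero Z) (s : Ses Z C B) : IsIso s.i := by
  have := s.exact.exact.epi_f (hZ.eq_of_tgt _ _)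
  exact isIso_of_mono_of_epi s.i

lemma Ses.isIso_p {Z A B : E} (hZ : IsZero Z) (s : Ses A Z B) : IsIso s.p := by
  have := s.exact.exact.mono_g (hZ.eq_of_src _ _)
  exact isIso_of_mono_of_epi s.p

lemma card_ses_zero_left {Z C B : E} (hZ : IsZero Z) : Nat.card (Ses Z C B) = Nat.card (C ≅ B) :=
  Nat.card_congr
    { toFun := fun s => haveI := s.isIso_i hZ; asIso s.i
      invFun := fun e => Ses.mk e.hom 0 comp_zero
        { exact := (ShortComplex.exact_iff_epi _ rfl).2 (inferInstanceAs (Epi e.hom))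
          mono_f := inferInstanceAs (Mono e.hom)
          epi_g := hZ.epi _ }
      left_inv := fun _ => Ses.ext rfl (hZ.eq_of_tgt _ _)
      right_inv := fun _ => Iso.ext rfl }

lemma card_ses_zero_right {Z A B : E} (hZ : IsZero Z) : Nat.card (Ses A Z B) = Nat.card (B ≅ A) :=
  Nat.card_congr
    { toFun := fun s => haveI := s.isIso_p hZ; asIso s.p
      invFun := fun e => Ses.mk 0 e.hom zero_comp
        { exact := (ShortComplex.exact_iff_mono _ rfl).2 (inferInstanceAs (Mono e.hom))
          mono_f := hZ.mono _
          epi_g := inferInstanceAs (Epi e.hom) }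
      left_inv := fun _ => Ses.ext (hZ.eq_of_src _ _) rfl
      right_inv := fun _ => Iso.ext rfl }

lemma card_iso_rep [HallFinite E] (b c : IsoClass E) [Decidable (b = c)] :
    (Nat.card (c.rep ≅ b.rep) : ℚ) / (Nat.card (b.rep ≅ b.rep) : ℚ) = if b = c then 1 else 0 := by
  split_ifs with h
  · subst h
    exact div_self (card_aut_ne_zero _)
  · have : IsEmpty (c.rep ≅ b.rep) := ⟨fun e => h (by
      rw [← IsoClass.mk_rep b, ← IsoClass.mk_rep c, IsoClass.mk_eq_iff]; exact ⟨e.symm⟩)⟩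
    simp

lemma hallProd_zero_left [HallFinite E] (c : IsoClass E) :
    hallProd (IsoClass.mk (0 : E)) c = Finsupp.single c 1 := by
  classical
  ext b
  rw [hallProd_apply, hallCoeff_eq, card_ses_zero_left isZero_rep_zero, card_iso_rep,
    Finsupp.single_apply]
  simp [eq_comm]

lemma hallProd_zero_right [HallFinite E] (c : IsoClass E) :
    hallProd c (IsoClass.mk (0 : E)) = Finsupp.single c 1 := by
  classical
  ext b
  rw [hallProd_apply, hallCoeff_eq, card_ses_zero_right isZero_rep_zero,
    Nat.card_congr (Equiv.mk Iso.symm Iso.symm (fun _ => rfl) (fun _ => rfl) :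
      (b.rep ≅ c.rep) ≃ (c.rep ≅ b.rep)), card_iso_rep,
    Finsupp.single_apply]
  simp [eq_comm]

lemma hallMul_one_left [HallFinite E] (x : IsoClass E →₀ ℚ) :
    hallMul E (Finsupp.single (IsoClass.mk (0 : E)) 1) x = x := by
  rw [hallMul_single_left]
  simp [hallProd_zero_left, Finsupp.linearCombination_apply]

lemma hallMul_one_right [HallFinite E] (x : IsoClass E →₀ ℚ) :
    hallMul E x (Finsupp.single (IsoClass.mk (0 : E)) 1) = x := by
  simp [hallMul, hallProd_zero_right, Finsupp.linearCombination_apply,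
    LinearMap.finsupp_sum_apply]

variable (E) in
/-- The Ringel-Hall algebra: the rational vector space with basis `Iso(E)`, with the product
`[A] ⋄ [C] = ∑_[B] (|Ext¹(A, C)_B| / |Hom(A, C)|) [B]`. -/
def HallAlgebra : Type u := IsoClass E →₀ ℚ

instance : AddCommGroup (HallAlgebra E) := inferInstanceAs (AddCommGroup (IsoClass E →₀ ℚ))
instance : Module ℚ (HallAlgebra E) := inferInstanceAs (Module ℚ (IsoClass E →₀ ℚ))

instance [HallFinite E] : Ring (HallAlgebra E) :=
  { (inferInstance : AddCommGroup (HallAlgebra E)) with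
    mul := fun x y => hallMul E x y
    one := Finsupp.single (IsoClass.mk (0 : E)) (1 : ℚ)
    left_distrib := fun x y z => map_add (hallMul E x) y z
    right_distrib := fun x y z => LinearMap.map_add₂ (hallMul E) x y z
    zero_mul := fun x => LinearMap.map_zero₂ (hallMul E) x
    mul_zero := fun x => map_zero (hallMul E x)
    mul_assoc := hallMul_assoc
    one_mul := hallMul_one_left
    mul_one := hallMul_one_right }

instance [HallFinite E] : Algebra ℚ (HallAlgebra E) :=
  Algebra.ofModule (fun r x y => LinearMap.map_smul₂ (hallMul E) r x y)
    (fun r x y => map_smul (hallMul E x) r y)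

/-- The basis element `[M]`. -/
def HallAlgebra.of (a : IsoClass E) : HallAlgebra E := Finsupp.single a (1 : ℚ)

lemma HallAlgebra.of_mul_of [HallFinite E] (a c : IsoClass E) :
    HallAlgebra.of a * HallAlgebra.of c = (hallProd a c : IsoClass E →₀ ℚ) :=
  hallMul_single a c


/-! ### Finiteness for graded complexes -/

instance [FiniteHomExt E] : HallFinite E where
  finite_hom := FiniteHomExt.finite_hom
  finite_mid A C := by
    have := FiniteHomExt.finite_ext A C
    rw [← Set.finite_coe_iff]
    refine Finite.of_injective
      (fun b : {b : IsoClass E | (extMid A C b.rep).Nonempty} => b.2.some) ?_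
    intro b b' h
    obtain ⟨s, hs⟩ := mem_extMid_iff.1 b.2.some_mem
    obtain ⟨s', hs'⟩ := mem_extMid_iff.1 b'.2.some_mem
    obtain ⟨φ, -⟩ := s.exists_iso_of_cls_eq s' (hs.trans (h.trans hs'.symm))
    refine Subtype.ext ?_
    rw [← IsoClass.mk_rep b.1, ← IsoClass.mk_rep b'.1, IsoClass.mk_eq_iff]
    exact ⟨φ⟩

end Ext

section Localization

/-! ### Universal localization -/

variable {R : Type u} [Ring R] [Algebra ℚ R] (S : Set R)

/-- The relations for the localization: the generators `inl a` for `a` in `R` multiply and add as in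
`R`, and for `s` in `S` the generator `inr s` is a two-sided inverse of `inl s`. -/
inductive LocRel : FreeAlgebra ℚ (R ⊕ S) → FreeAlgebra ℚ (R ⊕ S) → Prop
  | add (a b : R) : LocRel (FreeAlgebra.ι ℚ (Sum.inl (a + b)))
      (FreeAlgebra.ι ℚ (Sum.inl a) + FreeAlgebra.ι ℚ (Sum.inl b))
  | mul (a b : R) : LocRel (FreeAlgebra.ι ℚ (Sum.inl (a * b)))
      (FreeAlgebra.ι ℚ (Sum.inl a) * FreeAlgebra.ι ℚ (Sum.inl b))
  | scalar (r : ℚ) : LocRel (FreeAlgebra.ι ℚ (Sum.inl (algebraMap ℚ R r))) (algebraMap ℚ _ r)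
  | mul_inv (s : S) : LocRel
      (FreeAlgebra.ι ℚ (Sum.inl (s : R)) * FreeAlgebra.ι ℚ (Sum.inr s)) 1
  | inv_mul (s : S) : LocRel
      (FreeAlgebra.ι ℚ (Sum.inr s) * FreeAlgebra.ι ℚ (Sum.inl (s : R))) 1

/-- The localization `R[S⁻¹]`: the universal `ℚ`-algebra under `R` in which the elements of `S` are
invertible. If `S` is an Ore set this is the ring of fractions. -/
def Loc : Type u := RingQuot (LocRel S)

instance : Ring (Loc S) := inferInstanceAs (Ring (RingQuot (LocRel S)))
instance : Algebra ℚ (Loc S) := inferInstanceAs (Algebra ℚ (RingQuot (LocRel S)))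

namespace Loc

def proj : FreeAlgebra ℚ (R ⊕ S) →ₐ[ℚ] Loc S := RingQuot.mkAlgHom ℚ (LocRel S)

lemma proj_eq {x y : FreeAlgebra ℚ (R ⊕ S)} (h : LocRel S x y) : proj S x = proj S y :=
  RingQuot.mkAlgHom_rel ℚ h

/-- The canonical homomorphism `R ⟶ R[S⁻¹]`. -/
def incl : R →ₐ[ℚ] Loc S :=
  { toFun := fun a => proj S (FreeAlgebra.ι ℚ (Sum.inl a))
    map_one' := by simpa using proj_eq S (LocRel.scalar 1)
    map_mul' := fun a b => by simpa using proj_eq S (LocRel.mul a b)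
    map_zero' := by simpa using proj_eq S (LocRel.scalar 0)
    map_add' := fun a b => by simpa using proj_eq S (LocRel.add a b)
    commutes' := fun r => by simpa using proj_eq S (LocRel.scalar r) }

/-- The invertible element of `R[S⁻¹]` given by an element of `S`. -/
def unit (s : S) : (Loc S)ˣ where
  val := incl S s
  inv := proj S (FreeAlgebra.ι ℚ (Sum.inr s))
  val_inv := by simpa [incl] using proj_eq S (LocRel.mul_inv s)
  inv_val := by simpa [incl] using proj_eq S (LocRel.inv_mul s)

/-- The universal property of the localization. -/
theorem existsUnique_lift {B : Type*} [Ring B] [Algebra ℚ B] (f : R →ₐ[ℚ] B)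
    (hf : ∀ s : S, IsUnit (f s)) : ∃! g : Loc S →ₐ[ℚ] B, g.comp (incl S) = f := by
  choose u hu using hf
  let F : FreeAlgebra ℚ (R ⊕ S) →ₐ[ℚ] B :=
    FreeAlgebra.lift ℚ (Sum.elim f fun s => ((u s)⁻¹ : Bˣ))
  have hF : ∀ ⦃x y⦄, LocRel S x y → F x = F y := by
    intro x y h
    cases h <;> simp [F, ← hu]
  refine ⟨RingQuot.liftAlgHom ℚ ⟨F, hF⟩, ?_, ?_⟩
  · ext a
    exact (RingQuot.liftAlgHom_mkAlgHom_apply ℚ F hF _).trans (by simp [F])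
  · intro g hg
    refine RingQuot.ringQuot_ext' _ _ _ ?_
    refine FreeAlgebra.hom_ext (funext fun x => ?_)
    have h1 : ∀ a, g (incl S a) = f a := fun a => congrArg (fun h : R →ₐ[ℚ] B => h a) hg
    cases x with
    | inl a =>
      refine (h1 a).trans ?_
      exact ((RingQuot.liftAlgHom_mkAlgHom_apply ℚ F hF _).trans (by simp [F])).symm
    | inr s =>
      have h2 : (Units.map (g : Loc S →* B) (unit S s)) = u s :=
        Units.ext ((h1 s).trans (hu s).symm)
      have h3 : g ((unit S s)⁻¹ : (Loc S)ˣ) = ((u s)⁻¹ : Bˣ) := by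
        rw [← h2, ← map_inv]; rfl
      refine Eq.trans h3 ?_
      exact ((RingQuot.liftAlgHom_mkAlgHom_apply ℚ F hF
        (FreeAlgebra.ι ℚ (Sum.inr s))).trans (by simp [F])).symm

end Loc

end Localization

section Complexes

attribute [local instance] HasExt.standard

variable (A : Type u) [Category.{v} A] [Abelian A] (t : ℕ)

/-- The category of `ℤ/t`-graded complexes: objects `Mⁱ` and differentials
`dⁱ : Mⁱ ⟶ Mⁱ⁺¹` with `dⁱ ≫ dⁱ⁺¹ = 0`, for `i` in `ℤ/t`. -/
abbrev Cplx : Type (max u v) := HomologicalComplex A (ComplexShape.up (ZMod t))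

variable {A t}

instance [FiniteHomExt A] [NeZero t] : HallFinite (Cplx A t) where
  finite_hom M N := by
    have := fun i => FiniteHomExt.finite_hom (M.X i) (N.X i)
    exact Finite.of_injective (fun f : M ⟶ N => f.f) fun f g h =>
      HomologicalComplex.hom_ext _ _ (congrFun h)
  finite_mid M N := by
    have hfin := fun i => HallFinite.finite_mid (M.X i) (N.X i)
    let F : ZMod t → Set (IsoClass A) := fun i => {b | Nonempty (Ses (M.X i) (N.X i) b.rep)}
    have hF : ∀ i, Finite (F i) := fun i => by
      refine Set.finite_coe_iff.2 ((hfin i).subset fun b hb => ?_)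
      exact extMid_nonempty_iff.2 hb
    have hH : ∀ X Y : A, Finite (X ⟶ Y) := FiniteHomExt.finite_hom
    rw [← Set.finite_coe_iff]
    have hX : ∀ (b : {b : IsoClass (Cplx A t) | (extMid M N b.rep).Nonempty}) (i : ZMod t),
        Nonempty (Ses (M.X i) (N.X i) (IsoClass.mk (b.1.rep.X i)).rep) := fun b i => by
      obtain ⟨s⟩ := extMid_nonempty_iff.1 b.2
      have h := s.exact.map (HomologicalComplex.eval A (ComplexShape.up (ZMod t)) i)
      exact ⟨(Ses.mk (s.i.f i) (s.p.f i)
        (by rw [← HomologicalComplex.comp_f, s.w, HomologicalComplex.zero_f]) h).map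
          (Iso.refl _) (Iso.refl _) (IsoClass.nonempty_iso _).some.symm⟩
    let e : ∀ (L : Cplx A t) (i : ZMod t), (IsoClass.mk (L.X i)).rep ≅ L.X i :=
      fun L i => (IsoClass.nonempty_iso (L.X i)).some
    let D := Σ b : (∀ i, F i), ∀ i j : ZMod t, ((b i).1.rep ⟶ (b j).1.rep)
    let g : {b : IsoClass (Cplx A t) | (extMid M N b.rep).Nonempty} → D := fun b =>
      ⟨fun i => ⟨IsoClass.mk (b.1.rep.X i), hX b i⟩,
        fun i j => (e b.1.rep i).hom ≫ b.1.rep.d i j ≫ (e b.1.rep j).inv⟩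
    have hg : ∀ b, ∃ φ : ∀ i, ((g b).1 i).1.rep ≅ b.1.rep.X i,
        ∀ i j, (g b).2 i j = (φ i).hom ≫ b.1.rep.d i j ≫ (φ j).inv :=
      fun b => ⟨e b.1.rep, fun _ _ => rfl⟩
    refine Finite.of_injective g fun b b' h => ?_
    obtain ⟨φ, h1⟩ := hg b
    have h2 := hg b'
    rw [← h] at h2
    obtain ⟨φ', h2⟩ := h2
    refine Subtype.ext ?_
    rw [← IsoClass.mk_rep b.1, ← IsoClass.mk_rep b'.1, IsoClass.mk_eq_iff]
    refine ⟨HomologicalComplex.Hom.isoOfComponents (fun i => (φ i).symm ≪≫ φ' i) ?_⟩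
    intro i j _
    have := (h1 i j).symm.trans (h2 i j)
    simp only [Iso.trans_hom, Iso.symm_hom, Category.assoc]
    rw [Iso.inv_comp_eq, ← cancel_mono (φ' j).inv]
    simp only [Category.assoc, Iso.hom_inv_id, Category.comp_id]
    exact this.symm

/-! ### The stalk complexes and the elementary acyclic complexes -/

/-- The stalk complex `U_{X,i}` with `X` concentrated in degree `i`. -/
def stalk (t : ℕ) (X : A) (i : ZMod t) : Cplx A t :=
  (HomologicalComplex.single A (ComplexShape.up (ZMod t)) i).obj X

/-- The graded object with `X` in degree `i` and zero elsewhere. -/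
def gr (t : ℕ) (X : A) (i j : ZMod t) : A := if j = i then X else 0

lemma gr_succ (t : ℕ) (X : A) (i j k : ZMod t) (h : j + 1 = k) :
    gr t X (i - 1) j = gr t X i k := by
  have : j = i - 1 ↔ k = i := by rw [← h, eq_sub_iff_add_eq]
  simp [gr, this]

/-- The complex `K_{X,i}`: the sum of a copy of `X` in degree `i - 1` and a copy of `X` in degree
`i`, the differential mapping the first copy identically to the second one. If `t = 1` this is
`X ⊞ X` with the endomorphism mapping one summand identically to the other one and the latter to
zero. -/
def elemAcyclic (t : ℕ) (X : A) (i : ZMod t) : Cplx A t where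
  X j := gr t X (i - 1) j ⊞ gr t X i j
  d j k := if h : j + 1 = k then biprod.fst ≫ eqToHom (gr_succ t X i j k h) ≫ biprod.inr else 0
  shape j k h := dif_neg h
  d_comp_d' j k l h h' := by
    have h : j + 1 = k := h
    have h' : k + 1 = l := h'
    simp [h, h']

lemma elemAcyclic_acyclic (X : A) (i : ZMod t) : (elemAcyclic t X i).Acyclic := by
  intro j
  rw [HomologicalComplex.exactAt_iff' _ (j - 1) j (j + 1)
    ((ComplexShape.up (ZMod t)).prev_eq' (sub_add_cancel j 1))
    ((ComplexShape.up (ZMod t)).next_eq' rfl),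
    ShortComplex.exact_iff_exact_up_to_refinements]
  intro T x hx
  have h1 : (j - 1) + 1 = j := sub_add_cancel j 1
  change T ⟶ gr t X (i - 1) j ⊞ gr t X i j at x
  have hx : x ≫ (elemAcyclic t X i).d j (j + 1) = 0 := hx
  have hx' : x ≫ biprod.fst = 0 := by
    simp only [elemAcyclic, dif_pos] at hx
    rw [← cancel_mono (eqToHom (gr_succ t X i j (j + 1) rfl)),
      ← cancel_mono (biprod.inr : gr t X i (j + 1) ⟶ gr t X (i - 1) (j + 1) ⊞ gr t X i (j + 1))]
    simp only [Category.assoc, zero_comp]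
    exact hx
  refine ⟨T, 𝟙 T, inferInstance,
    x ≫ biprod.snd ≫ eqToHom (gr_succ t X i (j - 1) j h1).symm ≫ biprod.inl, ?_⟩
  change 𝟙 T ≫ x = (x ≫ biprod.snd ≫ eqToHom (gr_succ t X i (j - 1) j h1).symm ≫ biprod.inl) ≫
    (elemAcyclic t X i).d (j - 1) j
  simp only [elemAcyclic, dif_pos h1]
  refine biprod.hom_ext _ _ ?_ ?_
  · simp [hx']
  · simp

/-! ### The Grothendieck group -/

variable (A) in
/-- The relations `[S₂] = [S₁] + [S₃]` for the short exact sequences `0 ⟶ S₁ ⟶ S₂ ⟶ S₃ ⟶ 0`. -/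
def K0.rel : AddSubgroup (FreeAbelianGroup A) :=
  AddSubgroup.closure {x | ∃ S : ShortComplex A, S.ShortExact ∧
    x = FreeAbelianGroup.of S.X₂ - (FreeAbelianGroup.of S.X₁ + FreeAbelianGroup.of S.X₃)}

variable (A) in
/-- The Grothendieck group `K₀(A)`. -/
abbrev K0 : Type u := FreeAbelianGroup A ⧸ K0.rel A

/-- The class of an object in `K₀(A)`. -/
def K0.cls (X : A) : K0 A := QuotientAddGroup.mk (FreeAbelianGroup.of X)

lemma K0.cls_eq {S : ShortComplex A} (hS : S.ShortExact) :
    K0.cls S.X₂ = K0.cls S.X₁ + K0.cls S.X₃ := by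
  refine (QuotientAddGroup.eq_iff_sub_mem.2 ?_)
  exact AddSubgroup.subset_closure ⟨S, hS, rfl⟩

lemma K0.cls_biprod (X Y : A) : K0.cls (X ⊞ Y) = K0.cls X + K0.cls Y :=
  K0.cls_eq (S := ShortComplex.mk (biprod.inl : X ⟶ X ⊞ Y) (biprod.snd : X ⊞ Y ⟶ Y) (by simp))
    (ShortComplex.Splitting.ofHasBinaryBiproduct X Y).shortExact

/-- Every element of `K₀(A)` is a difference of classes of objects. -/
lemma K0.exists_sub (α : K0 A) : ∃ x : A × A, α = K0.cls x.1 - K0.cls x.2 := by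
  obtain ⟨x, rfl⟩ := QuotientAddGroup.mk_surjective α
  induction x using FreeAbelianGroup.induction_on with
  | zero => exact ⟨(0, 0), by simp⟩
  | of X => exact ⟨(X ⊞ X, X), by rw [K0.cls_biprod, add_sub_cancel_right]; rfl⟩
  | neg X _ => exact ⟨(X, X ⊞ X), by rw [K0.cls_biprod, sub_add_cancel_left]; rfl⟩
  | add x y hx hy =>
    obtain ⟨⟨P, N⟩, h⟩ := hx
    obtain ⟨⟨P', N'⟩, h'⟩ := hy
    refine ⟨(P ⊞ P', N ⊞ N'), ?_⟩
    rw [QuotientAddGroup.mk_add, h, h']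
    simp only [K0.cls_biprod]
    abel

/-- The Euler form `⟨X, Y⟩ = |Hom(X, Y)| / |Ext¹(X, Y)|`. -/
def euler (X Y : A) : ℚ :=
  (Nat.card (X ⟶ Y) : ℚ) / (Nat.card (Abelian.Ext.{max u v} X Y 1) : ℚ)

/-! ### The semi-derived Ringel-Hall algebra -/

variable (A t)

/-- Two complexes with isomorphic homologies, and with images of the differentials having the same
classes in `K₀(A)`, in all degrees. -/
def SameType {A : Type u} [Category.{v} A] [Abelian A] {t : ℕ} (M₁ M₂ : Cplx A t) : Prop :=
  ∀ i : ZMod t, Nonempty (M₁.homology i ≅ M₂.homology i) ∧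
    K0.cls (image (M₁.d i (i + 1))) = K0.cls (image (M₂.d i (i + 1)))

variable [FiniteHomExt A] [NeZero t]

/-- The two-sided ideal `J` generated by the differences `[M₁] - [M₂]`, for `M₁` and `M₂` as in
`SameType`. -/
def idealJ : TwoSidedIdeal (HallAlgebra (Cplx A t)) :=
  TwoSidedIdeal.span {x | ∃ M₁ M₂ : Cplx A t, SameType M₁ M₂ ∧
    x = HallAlgebra.of (IsoClass.mk M₁) - HallAlgebra.of (IsoClass.mk M₂)}

/-- The quotient algebra of the Ringel-Hall algebra by `J`. -/
abbrev HallQuot : Type (max u v) := (idealJ A t).ringCon.Quotient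

variable {A t} in
/-- The class of `[M]` in the quotient algebra. -/
def HallQuot.of (x : IsoClass (Cplx A t)) : HallQuot A t :=
  (idealJ A t).ringCon.mk' (HallAlgebra.of x)

/-- The set `S` of all `r [K]` with `r` a nonzero rational number and `K` an acyclic complex. -/
def acyclicSet : Set (HallQuot A t) :=
  {x | ∃ (r : ℚ) (K : Cplx A t), r ≠ 0 ∧ K.Acyclic ∧ x = r • HallQuot.of (IsoClass.mk K)}

/-- The semi-derived Ringel-Hall algebra of `A`, for `ℤ/t`-graded complexes. -/
abbrev SDH : Type (max u v) := Loc (acyclicSet A t)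

variable {A}

/-- The class `[M]` in the semi-derived Ringel-Hall algebra. -/
def SDH.of (x : IsoClass (Cplx A t)) : SDH A t := Loc.incl (acyclicSet A t) (HallQuot.of x)

lemma elemAcyclic_mem (X : A) (i : ZMod t) :
    HallQuot.of (IsoClass.mk (elemAcyclic t X i)) ∈ acyclicSet A t :=
  ⟨1, _, one_ne_zero, elemAcyclic_acyclic X i, (one_smul ℚ _).symm⟩

/-- The invertible element `[K_{X,i}]` of the semi-derived Ringel-Hall algebra. -/
def SDH.K (X : A) (i : ZMod t) : (SDH A t)ˣ :=
  Loc.unit (acyclicSet A t) ⟨_, elemAcyclic_mem t X i⟩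

/-- The element `⟨α, N⟩⁻ᵐ [K_{P,i}] ⋄ [K_{N,i}]⁻¹` for `α = P - N` in `K₀(A)`, where `m = 2` if
`t = 1` and `m = 1` otherwise. Here `⟨α, N⟩ = ⟨P, N⟩ / ⟨N, N⟩`. -/
def SDH.KFrac (P N : A) (i : ZMod t) : SDH A t :=
  ((euler P N / euler N N)⁻¹ ^ (if t = 1 then 2 else 1)) •
    ((SDH.K t P i : SDH A t) * ((SDH.K t N i)⁻¹ : (SDH A t)ˣ))

/-- The element `K_{α,i}` for `α` in `K₀(A)`, defined through a choice of objects `P` and `N` with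
`α = P - N`. -/
def SDH.Kα (α : K0 A) (i : ZMod t) : SDH A t :=
  SDH.KFrac t (K0.exists_sub α).choose.1 (K0.exists_sub α).choose.2 i

/-- The element `[U_{X,i}]`, for an isomorphism class `x = [X]`. -/
def SDH.U (x : IsoClass A) (i : ZMod t) : SDH A t := SDH.of t (IsoClass.mk (stalk t x.rep i))

end Complexes

end SemiDerived

end

/-! Call the isomorphism classes of the homologies of a complex, together with the `K0`-classes of
the images of its differentials, its type. By definition of the ideal, the class of a complex in
`SDH` depends only on its type. Let V be the vector space on all pairs (h, β) of a family h of
isomorphism classes and a family β in `K0 A`, whether or not a complex has that type. The core of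
the proof is to embed `SDH` in V by sending a complex to the basis vector of its type, and to do so
by letting `SDH` act on V. It must be shown that different types stay independent modulo the ideal
and after localization.

Heredity enters twice. First, Ext² into an acyclic complex vanishes (`ext_acyclic_eq_zero`), and so
does Ext² from an acyclic complex to one with zero differential (`ext_to_zeroCplx_eq_zero`). Hence
enlarging one factor of a Hall product by an acyclic complex changes the types in the product only
by a shift of β and by an Euler form scalar (`typeLin_mul_of_sub_acyclic`,
`typeLin_mul_of_quot_acyclic`). Second, a complex and its homology are both quotients of one complex
with acyclic kernels, and both subobjects of another with acyclic cokernels (`exists_zigzag`,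
`exists_cozigzag`). So the types in [M] ⋄ [N] are, up to scalar and shift, those of [M] ⋄ [H(N)],
and when the right factor has zero differential they depend on M only through its type
(`typeLin_mul_right`, `typeLin_mul_congr`). This defines the action `act`. It is multiplicative
because the Hall algebra is associative and because rescaling by the classes of the terms is
multiplicative (`rescale_mul`). The ideal acts by zero, and an acyclic complex acts by an invertible
operator: a shift of β combined with nonzero scalars (`act_acyclic`). The action therefore extends
to `SDH`, and evaluating it on the type of the zero complex gives `SDH.typeLin`. Every element of
`SDH` is a fraction with acyclic denominator, so this map is injective (`SDH.typeLin_injective`).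

The element attached to α in degree i goes to the vector with zero homology and image class α in
degree i - 1. The normalizing power of the Euler form makes the coefficient 1, whence independence
of the choice of P and N (`typeLin_KFrac`). For the basis, an extension of a stalk in degree j by a
graded object that vanishes in degree j can have a nonzero differential only from degree j to degree
j + 1. In the product of the stalks this can happen only for the last factor, from degree t - 1
around to degree 0. Then X and B in these degrees are replaced by the kernel and the cokernel of a
nonzero morphism X ⟶ B, and |End X| |End B| |Ext¹(B, X)| strictly decreases (`extMeasure_lt`). So
the ordered products are triangular with respect to the standard basis of V, which gives linear
independence and, with injectivity, spanning. -/

noncomputable section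

namespace SemiDerived

open CategoryTheory.Limits CategoryTheory.Abelian
open scoped ZeroObject

/-! ### Yoneda description of `Ext` by short exact sequences -/

section Yoneda

variable {E : Type u} [Category.{v} E] [Abelian E]

attribute [local instance] HasExt.standard

-- Since `K` vanishes in positive degrees, its term in degree 0 consists of cycles and maps onto the
-- homology, which is `X` because `π` is a quasi-isomorphism. That term serves as `P`.
open HomologicalComplex in
lemma exists_single_fac {E : Type u} [Category.{v} E] [Abelian E] {X : E}
    {K : CochainComplex E ℤ} (π : K ⟶ (single E (ComplexShape.up ℤ) 0).obj X)
    [K.IsStrictlyLE 0] [QuasiIso π] :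
    ∃ (P : E) (p : P ⟶ X) (_ : Epi p) (g : (single E (ComplexShape.up ℤ) 0).obj P ⟶ K),
      g ≫ π = (single E (ComplexShape.up ℤ) 0).map p := by
  let e := K.iCyclesIso 0 1 (by simp) ((K.isZero_of_isStrictlyLE 0 1 (by simp)).eq_of_tgt _ _)
  have he : K.iCycles 0 = e.hom := (iCyclesIso_hom _ _ _ _ _).symm
  let α := K.homologyπ 0 ≫ homologyMap π 0 ≫ (singleObjHomologySelfIso (ComplexShape.up ℤ) 0 X).hom
  have hα : e.hom ≫ π.f 0 = α ≫ (singleObjXSelf (ComplexShape.up ℤ) 0 X).inv := by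
    rw [← he]
    simp only [α, homologyπ_naturality_assoc, Category.assoc]
    rw [← cyclesMap_i]
    congr 1
    rw [homologyπ_singleObjHomologySelfIso_hom_assoc, ← singleObjCyclesSelfIso_inv_iCycles,
      Iso.hom_inv_id_assoc]
  have hα' : Epi α := by
    have : IsIso (homologyMap π 0) := inferInstance
    dsimp only [α]
    infer_instance
  refine ⟨K.X 0, e.inv ≫ α, epi_comp _ _, mkHomFromSingle (𝟙 _) ?_, ?_⟩
  · rintro _ rfl
    apply (K.isZero_of_isStrictlyLE 0 1 (by simp)).eq_of_tgt
  · apply HomologicalComplex.from_single_hom_ext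
    rw [comp_f, mkHomFromSingle_f, single_map_f_self, Category.comp_id, Category.assoc, ← hα, Iso.inv_hom_id_assoc]

/-- Classes of positive degree are killed by an epimorphism. -/
lemma exists_epi_comp_eq_zero {X Y : E} {n : ℕ} (e : Abelian.Ext.{max u v} X Y (n + 1)) :
    ∃ (P : E) (p : P ⟶ X) (_ : Epi p), (Ext.mk₀ p).comp e (zero_add _) = 0 := by
  let := HasDerivedCategory.standard E
  -- The shift is moved to the source side, so that `φ` goes from `X` in degree 0 to `Y` in degree
  -- `-(n + 1)`. It is then a roof whose apex lives in degrees at most 0.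
  let φ := e.hom ≫ ((DerivedCategory.singleFunctors E).shiftIso (n + 1) (-(n + 1)) 0
    (by lia)).hom.app _
  obtain ⟨K, _, π, h, g, hg⟩ := DerivedCategory.right_fac_of_isStrictlyLE
    (X := (CochainComplex.singleFunctor E 0).obj X)
    (Y := (CochainComplex.singleFunctor E (-(n+1))).obj Y) φ 0
  have h' : QuasiIso π := by rwa [DerivedCategory.isIso_Q_map_iff_quasiIso] at h
  obtain ⟨P, p, hp, q, hq⟩ := @exists_single_fac E _ _ X K π _ h'
  refine ⟨P, p, hp, ?_⟩
  apply Ext.homEquiv.injective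
  -- The source is concentrated in degree 0 and the target in a negative degree.
  have hqg : q ≫ g = 0 := by
    apply HomologicalComplex.from_single_hom_ext
    apply (HomologicalComplex.isZero_single_obj_X (ComplexShape.up ℤ)
      (-((n : ℤ)+1)) Y 0 (by lia)).eq_of_tgt
  simp only [← cancel_mono (((DerivedCategory.singleFunctors E).shiftIso (n + 1) (-(n + 1)) 0
    (by lia)).hom.app _), Ext.zero_hom, Limits.zero_comp]
  have h1 : (DerivedCategory.singleFunctor E 0).map p ≫ φ = 0 := by
    have : (DerivedCategory.singleFunctor E 0).map p = DerivedCategory.Q.map q ≫ DerivedCategory.Q.map π := by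
      exact (congrArg DerivedCategory.Q.map hq).symm.trans (Functor.map_comp _ _ _)
    rw [this, hg]
    refine (Category.assoc _ _ _).trans ?_
    refine (congrArg (DerivedCategory.Q.map q ≫ ·) (@IsIso.hom_inv_id_assoc _ _ _ _ (DerivedCategory.Q.map π) h _ _)).trans ?_
    refine (DerivedCategory.Q.map_comp q g).symm.trans ?_
    rw [hqg, Functor.map_zero]
    rfl
  have h2 : ((Ext.mk₀ p).comp e (zero_add _)).hom =
      (DerivedCategory.singleFunctor E 0).map p ≫ e.hom := by
    rw [Ext.comp_hom, Ext.mk₀_hom, ShiftedHom.mk₀_comp]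
  refine Eq.trans ?_ h1
  refine (congrArg (· ≫ ((DerivedCategory.singleFunctors E).shiftIso ((n : ℤ) + 1)
    (-((n : ℤ) + 1)) 0 (by lia)).hom.app Y) h2).trans ?_
  exact Category.assoc _ _ _

/-- The short exact sequence of an epimorphism. -/
def Ses.ker {A M : E} (q : M ⟶ A) [Epi q] : Ses A (kernel q) M := Ses.ofEpi q (Iso.refl _)

def Ses.coker {A M : E} (q : M ⟶ A) [Mono q] : Ses (cokernel q) M A := Ses.ofMono q (Iso.refl _)

@[simp] lemma Ses.ker_p {A M : E} (q : M ⟶ A) [Epi q] : (Ses.ker q).p = q := rfl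

variable {A C B : E}

lemma Ses.comp_cls (s : Ses A C B) : (Ext.mk₀ s.p).comp s.cls (zero_add 1) = 0 :=
  s.exact.comp_extClass

lemma Ses.cls_comp (s : Ses A C B) : s.cls.comp (Ext.mk₀ s.i) (add_zero 1) = 0 :=
  s.exact.extClass_comp

lemma Ses.cls_naturality (s : Ses A C B) {A' C' B' : E} (s' : Ses A' C' B') (a : A ⟶ A')
    (c : C ⟶ C') (b : B ⟶ B') (h1 : c ≫ s'.i = s.i ≫ b) (h2 : b ≫ s'.p = s.p ≫ a) :
    s.cls.comp (Ext.mk₀ c) (add_zero 1) = (Ext.mk₀ a).comp s'.cls (zero_add 1) :=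
  ShortComplex.ShortExact.extClass_naturality s.exact s'.exact (ShortComplex.homMk c b a h1 h2)

/-- A class of degree `n + 1` is the product of a class of degree `1` and a class of degree `n`. -/
lemma exists_cls_comp {X Y : E} {n : ℕ} (e : Abelian.Ext.{max u v} X Y (n + 1)) :
    ∃ (K P : E) (s : Ses X K P) (e' : Abelian.Ext.{max u v} K Y n),
      s.cls.comp e' (add_comm 1 n) = e := by
  obtain ⟨P, p, hp, h⟩ := exists_epi_comp_eq_zero e
  obtain ⟨e', he'⟩ := Ext.contravariant_sequence_exact₃ (Ses.ker p).exact Y e h (add_comm 1 n)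
  exact ⟨_, _, Ses.ker p, e', he'⟩

/-- Pushout of a short exact sequence. -/
lemma Ses.exists_pushout (s : Ses A C B) {C' : E} (f : C ⟶ C') :
    ∃ (B' : E) (s' : Ses A C' B') (b : B ⟶ B'), f ≫ s'.i = s.i ≫ b ∧ b ≫ s'.p = s.p := by
  have hpo : IsPushout f s.i (pushout.inl f s.i) (pushout.inr f s.i) := IsPushout.of_hasPushout _ _
  obtain ⟨p, hl, hr⟩ : ∃ p : pushout f s.i ⟶ A, pushout.inl f s.i ≫ p = 0 ∧
      pushout.inr f s.i ≫ p = s.p :=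
    ⟨pushout.desc 0 s.p (by simp [s.w]), pushout.inl_desc _ _ _, pushout.inr_desc _ _ _⟩
  have hp : Epi p := by
    have : Epi (pushout.inr f s.i ≫ p) := by rw [hr]; infer_instance
    exact epi_of_epi (pushout.inr f s.i) p
  refine ⟨_, Ses.mk (pushout.inl f s.i) p hl
    { exact := ShortComplex.exact_of_g_is_cokernel _
        (CokernelCofork.IsColimit.ofπ' _ hl (fun {T} k hk => ?_))
      mono_f := inferInstanceAs (Mono (pushout.inl f s.i))
      epi_g := hp }, pushout.inr f s.i, hpo.w, hr⟩
  have hk' : s.i ≫ pushout.inr f s.i ≫ k = 0 := by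
    rw [← Category.assoc, ← hpo.w, Category.assoc]
    exact (congrArg (f ≫ ·) hk).trans comp_zero
  refine ⟨(s.exists_desc _ hk').choose, pushout.hom_ext ?_ ?_⟩
  · rw [← Category.assoc, hl, zero_comp]; exact hk.symm
  · rw [← Category.assoc, hr]; exact (s.exists_desc _ hk').choose_spec

/-- Every class of degree `1` is the class of a short exact sequence. -/
lemma Ses.exists_cls {X Y : E} (e : Abelian.Ext.{max u v} X Y 1) :
    ∃ (B : E) (s : Ses X Y B), s.cls = e := by
  -- The second factor has degree 0, so it is a morphism; pushing out along it realizes the class.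
  obtain ⟨K, P, s, e', he⟩ := exists_cls_comp e
  obtain ⟨f, rfl⟩ := (Ext.mk₀_bijective _ _).2 e'
  obtain ⟨B, s', b, h1, h2⟩ := s.exists_pushout f
  refine ⟨B, s', ?_⟩
  rw [← he, s.cls_naturality s' (𝟙 _) f b h1 (by simp [h2]), Ext.mk₀_id_comp]

/-- A morphism between short exact sequences. -/
lemma Ses.exists_hom_of_cls_comp_eq {B' C' A' : E} (s : Ses A C B) (s' : Ses A' C' B')
    (f : C ⟶ C') (a : A ⟶ A')
    (h : s.cls.comp (Ext.mk₀ f) (add_zero 1) = (Ext.mk₀ a).comp s'.cls (zero_add 1)) :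
    ∃ φ : B ⟶ B', s.i ≫ φ = f ≫ s'.i ∧ φ ≫ s'.p = s.p ≫ a := by
  have h1 : (Ext.mk₀ (s.p ≫ a)).comp s'.cls (zero_add 1) = 0 := by
    rw [← Ext.mk₀_comp_mk₀_assoc, ← h,
      ← Ext.comp_assoc_of_third_deg_zero, s.comp_cls, Ext.zero_comp]
  obtain ⟨x, hx⟩ := Ext.covariant_sequence_exact₃ B s'.exact (Ext.mk₀ (s.p ≫ a)) (zero_add 1) h1
  obtain ⟨φ, rfl⟩ := Ext.mk₀_bijective _ _ |>.2 x
  have hφ : φ ≫ s'.p = s.p ≫ a := by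
    apply (Ext.mk₀_bijective _ _).1
    simpa using hx
  obtain ⟨c, hc⟩ := s'.exists_lift (s.i ≫ φ) (by simp [hφ, reassoc_of% s.w])
  have h2 := s.cls_naturality s' a c φ hc hφ
  -- The induced map `c` on subobjects need not be `f`, but `c - f` is killed by the class of `s`.
  -- It therefore extends to the middle term, and `φ` can be corrected.
  have h3 : s.cls.comp (Ext.mk₀ (c - f)) (add_zero 1) = 0 := by
    rw [sub_eq_add_neg, Ext.mk₀_add, Ext.comp_add, Ext.mk₀_neg, Ext.comp_neg, h2, h, add_neg_cancel]
  obtain ⟨y, hy⟩ := Ext.contravariant_sequence_exact₁ s.exact C' (Ext.mk₀ (c - f)) (add_zero 1) h3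
  obtain ⟨g, rfl⟩ := Ext.mk₀_bijective _ _ |>.2 y
  have hg : s.i ≫ g = c - f := by
    apply (Ext.mk₀_bijective _ _).1
    simpa using hy
  refine ⟨φ - g ≫ s'.i, ?_, ?_⟩
  · rw [Preadditive.comp_sub, ← Category.assoc, hg, Preadditive.sub_comp, hc]
    simp
  · simp [hφ, s'.w]

instance [HallFinite E] (X Y : E) : Finite (X ⟶ Y) := HallFinite.finite_hom X Y

/-- Up to isomorphism there are finitely many middle terms, each supports finitely many short exact
sequences, and their classes exhaust `Ext`. -/
instance [HallFinite E] (X Y : E) : Finite (Abelian.Ext.{max u v} X Y 1) := by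
  have := HallFinite.finite_mid X Y
  have := Set.finite_coe_iff.2 this
  refine Finite.of_surjective
    (fun x : Σ b : {b : IsoClass E | (extMid X Y b.rep).Nonempty}, Ses X Y b.1.rep => x.2.cls) ?_
  intro e
  obtain ⟨B, s, hs⟩ := Ses.exists_cls e
  let s' := s.map (Iso.refl _) (Iso.refl _) (IsoClass.nonempty_iso B).some.symm
  refine ⟨⟨⟨IsoClass.mk B, extMid_nonempty_iff.2 ⟨s'⟩⟩, s'⟩, ?_⟩
  rw [← hs]
  exact (s.cls_eq_of_hom s' (IsoClass.nonempty_iso B).some.inv (by simp [s']) (by simp [s'])).symm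

end Yoneda

/-! ### Counting in exact sequences of groups -/

section Count

lemma card_eq_card_ker_mul_card_range {G H : Type*} [AddCommGroup G] [AddCommGroup H]
    (f : G →+ H) : Nat.card G = Nat.card f.ker * Nat.card f.range := by
  rw [AddSubgroup.card_eq_card_quotient_mul_card_addSubgroup f.ker, mul_comm,
    Nat.card_congr (QuotientAddGroup.quotientKerEquivRange f).toEquiv]

lemma card_eq_card_mul_card_of_surjective {G H : Type*} [AddCommGroup G] [AddCommGroup H]
    (f : G →+ H) (hf : Function.Surjective f) : Nat.card G = Nat.card f.ker * Nat.card H := by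
  rw [card_eq_card_ker_mul_card_range f, AddMonoidHom.range_eq_top.2 hf,
    Nat.card_congr (AddSubgroup.topEquiv (G := H)).toEquiv]

/-- Each order is that of the kernel times that of the image; by exactness the factors pair off. -/
lemma card_exact_six {G₁ G₂ G₃ G₄ G₅ G₆ : Type*} [AddCommGroup G₁] [AddCommGroup G₂]
    [AddCommGroup G₃] [AddCommGroup G₄] [AddCommGroup G₅] [AddCommGroup G₆]
    (f₁ : G₁ →+ G₂) (f₂ : G₂ →+ G₃) (f₃ : G₃ →+ G₄) (f₄ : G₄ →+ G₅) (f₅ : G₅ →+ G₆)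
    (h₁ : Function.Injective f₁) (h₂ : f₂.ker = f₁.range) (h₃ : f₃.ker = f₂.range)
    (h₄ : f₄.ker = f₃.range) (h₅ : f₅.ker = f₄.range) (h₆ : Function.Surjective f₅) :
    Nat.card G₁ * Nat.card G₃ * Nat.card G₅ = Nat.card G₂ * Nat.card G₄ * Nat.card G₆ := by
  have e₁ : Nat.card G₁ = Nat.card f₁.range := Nat.card_congr (AddMonoidHom.ofInjective h₁).toEquiv
  have e₂ := card_eq_card_ker_mul_card_range f₂
  have e₃ := card_eq_card_ker_mul_card_range f₃
  have e₄ := card_eq_card_ker_mul_card_range f₄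
  have e₅ := card_eq_card_mul_card_of_surjective f₅ h₆
  rw [h₂] at e₂; rw [h₃] at e₃; rw [h₄] at e₄; rw [h₅] at e₅
  rw [e₁, e₂, e₃, e₄, e₅]
  ring

end Count

/-! ### Multiplicativity of the Euler form -/

section Euler

variable {E : Type u} [Category.{v} E] [Abelian E]

attribute [local instance] HasExt.standard

lemma card_hom_eq (X Y : E) :
    Nat.card (X ⟶ Y) = Nat.card (Abelian.Ext.{max u v} X Y 0) :=
  Nat.card_congr (Equiv.ofBijective _ (Ext.mk₀_bijective X Y))

lemma euler_eq_div (X Y : E) : euler X Y = (Nat.card (Abelian.Ext.{max u v} X Y 0) : ℚ) /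
    Nat.card (Abelian.Ext.{max u v} X Y 1) := by
  rw [euler, card_hom_eq]

lemma euler_ne_zero [HallFinite E] (X Y : E) : euler X Y ≠ 0 := by
  unfold euler
  exact div_ne_zero (by exact_mod_cast Nat.card_pos.ne') (by exact_mod_cast Nat.card_pos.ne')

/-- The long exact sequence has only six terms: it ends with a surjection on `Ext` of degree 1,
since the next obstruction lies in the vanishing group of degree 2. -/
lemma Ses.card_covariant {X Y Z : E} (s : Ses Z X Y) (W : E)
    (h : ∀ e : Abelian.Ext.{max u v} W X 2, e = 0) :
    Nat.card (Abelian.Ext.{max u v} W X 0) * Nat.card (Abelian.Ext.{max u v} W Z 0) *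
      Nat.card (Abelian.Ext.{max u v} W Y 1) =
    Nat.card (Abelian.Ext.{max u v} W Y 0) * Nat.card (Abelian.Ext.{max u v} W X 1) *
      Nat.card (Abelian.Ext.{max u v} W Z 1) := by
  refine card_exact_six ((Ext.mk₀ s.i).postcomp W (add_zero 0))
    ((Ext.mk₀ s.p).postcomp W (add_zero 0)) (s.cls.postcomp W (zero_add 1))
    ((Ext.mk₀ s.i).postcomp W (add_zero 1)) ((Ext.mk₀ s.p).postcomp W (add_zero 1))
    (Ext.postcomp_mk₀_injective_of_mono W s.i) ?_ ?_ ?_ ?_ ?_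
  · ext x
    constructor
    · exact fun hx => Ext.covariant_sequence_exact₂ W s.exact x hx
    · rintro ⟨y, rfl⟩
      simp [AddMonoidHom.mem_ker, s.w]
  · ext x
    constructor
    · exact fun hx => Ext.covariant_sequence_exact₃ W s.exact x (zero_add 1) hx
    · rintro ⟨y, rfl⟩
      simp [AddMonoidHom.mem_ker, Ext.comp_assoc_of_second_deg_zero, s.comp_cls]
  · ext x
    constructor
    · exact fun hx => Ext.covariant_sequence_exact₁ W s.exact x hx (zero_add 1)
    · rintro ⟨y, rfl⟩
      simp [AddMonoidHom.mem_ker, Ext.comp_assoc_of_third_deg_zero, s.cls_comp]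
  · ext x
    constructor
    · exact fun hx => Ext.covariant_sequence_exact₂ W s.exact x hx
    · rintro ⟨y, rfl⟩
      simp [AddMonoidHom.mem_ker, s.w, Ext.comp_assoc_of_second_deg_zero]
  · intro x
    exact Ext.covariant_sequence_exact₃ W s.exact x (rfl : 1 + 1 = 2) (h _)

lemma Ses.card_contravariant {X Y Z : E} (s : Ses Z X Y) (W : E)
    (h : ∀ e : Abelian.Ext.{max u v} Z W 2, e = 0) :
    Nat.card (Abelian.Ext.{max u v} Z W 0) * Nat.card (Abelian.Ext.{max u v} X W 0) *
      Nat.card (Abelian.Ext.{max u v} Y W 1) =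
    Nat.card (Abelian.Ext.{max u v} Y W 0) * Nat.card (Abelian.Ext.{max u v} Z W 1) *
      Nat.card (Abelian.Ext.{max u v} X W 1) := by
  refine card_exact_six ((Ext.mk₀ s.p).precomp W (zero_add 0))
    ((Ext.mk₀ s.i).precomp W (zero_add 0)) (s.cls.precomp W (add_zero 1))
    ((Ext.mk₀ s.p).precomp W (zero_add 1)) ((Ext.mk₀ s.i).precomp W (zero_add 1))
    (Ext.precomp_mk₀_injective_of_epi W s.p) ?_ ?_ ?_ ?_ ?_
  · ext x
    constructor
    · exact fun hx => Ext.contravariant_sequence_exact₂ s.exact W x hx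
    · rintro ⟨y, rfl⟩
      simp [AddMonoidHom.mem_ker, s.w]
  · ext x
    constructor
    · exact fun hx => Ext.contravariant_sequence_exact₁ s.exact W x (add_zero 1) hx
    · rintro ⟨y, rfl⟩
      simp [AddMonoidHom.mem_ker, ← Ext.comp_assoc_of_third_deg_zero, s.cls_comp]
  · ext x
    constructor
    · exact fun hx => Ext.contravariant_sequence_exact₃ s.exact W x hx (add_zero 1)
    · rintro ⟨y, rfl⟩
      simp [AddMonoidHom.mem_ker, ← Ext.comp_assoc_of_third_deg_zero, s.comp_cls]
  · ext x
    constructor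
    · exact fun hx => Ext.contravariant_sequence_exact₂ s.exact W x hx
    · rintro ⟨y, rfl⟩
      simp [AddMonoidHom.mem_ker, s.w]
  · intro x
    exact Ext.contravariant_sequence_exact₁ s.exact W x (rfl : 1 + 1 = 2) (h _)

variable [HallFinite E]

lemma Ses.euler_covariant {X Y Z : E} (s : Ses Z X Y) (W : E)
    (h : ∀ e : Abelian.Ext.{max u v} W X 2, e = 0) :
    euler W Y = euler W X * euler W Z := by
  have := congrArg (Nat.cast (R := ℚ)) (s.card_covariant W h)
  push_cast at this
  rw [euler_eq_div, euler_eq_div, euler_eq_div, div_mul_div_comm, div_eq_div_iff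
    (by exact_mod_cast Nat.card_pos.ne') (by
      exact mul_ne_zero (by exact_mod_cast Nat.card_pos.ne') (by exact_mod_cast Nat.card_pos.ne'))]
  linarith

lemma Ses.euler_contravariant {X Y Z : E} (s : Ses Z X Y) (W : E)
    (h : ∀ e : Abelian.Ext.{max u v} Z W 2, e = 0) :
    euler Y W = euler X W * euler Z W := by
  have := congrArg (Nat.cast (R := ℚ)) (s.card_contravariant W h)
  push_cast at this
  rw [euler_eq_div, euler_eq_div, euler_eq_div, div_mul_div_comm, div_eq_div_iff
    (by exact_mod_cast Nat.card_pos.ne') (by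
      exact mul_ne_zero (by exact_mod_cast Nat.card_pos.ne') (by exact_mod_cast Nat.card_pos.ne'))]
  linarith

end Euler

/-! ### The Hall product as a sum over extension classes -/

section HallSum

variable {E : Type u} [Category.{v} E] [Abelian E]

attribute [local instance] HasExt.standard

/-- The middle term of an extension. -/
def mid {X Y : E} (e : Abelian.Ext.{max u v} X Y 1) : E := (Ses.exists_cls e).choose

def midSes {X Y : E} (e : Abelian.Ext.{max u v} X Y 1) : Ses X Y (mid e) :=
  (Ses.exists_cls e).choose_spec.choose

@[simp] lemma midSes_cls {X Y : E} (e : Abelian.Ext.{max u v} X Y 1) : (midSes e).cls = e :=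
  (Ses.exists_cls e).choose_spec.choose_spec

/-- Sequences with equal class have isomorphic middle terms, and a sequence can be transported along
an isomorphism of middle terms. -/
lemma mem_extMid_iff_nonempty_iso {X Y L : E} {e : Abelian.Ext.{max u v} X Y 1} :
    e ∈ extMid X Y L ↔ Nonempty (mid e ≅ L) := by
  rw [mem_extMid_iff]
  constructor
  · rintro ⟨s, hs⟩
    obtain ⟨φ, -⟩ := (midSes e).exists_iso_of_cls_eq s ((midSes_cls e).trans hs.symm)
    exact ⟨φ⟩
  · rintro ⟨φ⟩
    refine ⟨(midSes e).map (Iso.refl _) (Iso.refl _) φ, ?_⟩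
    rw [← Ses.cls_eq_of_hom (midSes e) _ φ.hom (by simp) (by simp), midSes_cls]

variable [HallFinite E] {W : Type*} [AddCommGroup W] [Module ℚ W]

/-- The linear map on the Ringel-Hall algebra given by a function of isomorphism classes. -/
def hallLin (g : IsoClass E → W) : HallAlgebra E →ₗ[ℚ] W := Finsupp.linearCombination ℚ g

@[simp] lemma hallLin_of (g : IsoClass E → W) (a : IsoClass E) :
    hallLin g (HallAlgebra.of a) = g a :=
  (Finsupp.linearCombination_single ℚ 1 a).trans (one_smul _ _)

/-- The product in the Ringel-Hall algebra as a sum over extension classes. -/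
lemma hallLin_mul (g : IsoClass E → W) (M N : E) :
    hallLin g (HallAlgebra.of (IsoClass.mk M) * HallAlgebra.of (IsoClass.mk N)) =
      (Nat.card (M ⟶ N) : ℚ)⁻¹ •
        ∑ᶠ e : Abelian.Ext.{max u v} M N 1, g (IsoClass.mk (mid e)) := by
  classical
  have := Fintype.ofFinite (Abelian.Ext.{max u v} M N 1)
  rw [HallAlgebra.of_mul_of, finsum_eq_sum_of_fintype]
  have hsupp : ∀ e ∈ (Finset.univ : Finset (Abelian.Ext.{max u v} M N 1)),
      IsoClass.mk (mid e) ∈ (hallProd (IsoClass.mk M) (IsoClass.mk N)).support := by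
    intro e _
    rw [Finsupp.mem_support_iff, hallProd_apply, hallCoeff_ne_zero_iff]
    exact ⟨(midSes e).map (IsoClass.nonempty_iso _).some.symm
      (IsoClass.nonempty_iso _).some.symm (IsoClass.nonempty_iso _).some.symm⟩
  -- Extension classes are grouped by the isomorphism class of the middle term; each fibre is the
  -- set counted by the structure constant.
  rw [← Finset.sum_fiberwise_of_maps_to hsupp, Finset.smul_sum]
  change Finsupp.linearCombination ℚ g _ = _
  rw [Finsupp.linearCombination_apply, Finsupp.sum]
  refine Finset.sum_congr rfl fun b _ => ?_
  rw [Finset.sum_congr rfl (g := fun _ => g b)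
    (fun e he => by rw [(Finset.mem_filter.1 he).2]), Finset.sum_const, hallProd_apply,
    ← IsoClass.mk_rep b, hallCoeff_mk, hallNumber, IsoClass.mk_rep, ← Nat.cast_smul_eq_nsmul ℚ,
    smul_smul, div_eq_inv_mul]
  have hb : extMid M N b.rep = {e | IsoClass.mk (mid e) = b} := by
    ext e
    rw [mem_extMid_iff_nonempty_iso, ← IsoClass.mk_eq_iff, IsoClass.mk_rep]
    rfl
  rw [hb, Nat.card_eq_fintype_card (α := {e | IsoClass.mk (mid e) = b}), ← Set.toFinset_card,
    Set.toFinset_ofPred]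

/-- All extension classes contribute alike, leaving the factor |Ext¹| / |Hom|, the inverse Euler
form. -/
lemma hallLin_mul_of_forall_eq (g : IsoClass E → W) (M N : E) (w : W)
    (h : ∀ L, Nonempty (Ses M N L) → g (IsoClass.mk L) = w) :
    hallLin g (HallAlgebra.of (IsoClass.mk M) * HallAlgebra.of (IsoClass.mk N)) =
      (euler M N)⁻¹ • w := by
  have := Fintype.ofFinite (Abelian.Ext.{max u v} M N 1)
  rw [hallLin_mul, finsum_eq_sum_of_fintype, Finset.sum_congr rfl (fun e _ => h _ ⟨midSes e⟩),
    Finset.sum_const, ← Nat.cast_smul_eq_nsmul ℚ, smul_smul, Finset.card_univ,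
    ← Nat.card_eq_fintype_card, euler, inv_div, div_eq_inv_mul]

/-- The fibres are cosets of the kernel, so all have |G| / |H| elements. -/
lemma finsum_comp_of_surjective {G H : Type*} [AddCommGroup G] [AddCommGroup H] [Finite G]
    [Finite H] (π : G →+ H) (hπ : Function.Surjective π) (f : H → W) :
    ∑ᶠ x, f (π x) = ((Nat.card G : ℚ) / Nat.card H) • ∑ᶠ y, f y := by
  classical
  have := Fintype.ofFinite G
  have := Fintype.ofFinite H
  rw [finsum_eq_sum_of_fintype, finsum_eq_sum_of_fintype, ← Finset.sum_fiberwise _ π,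
    Finset.smul_sum]
  refine Finset.sum_congr rfl fun y _ => ?_
  rw [Finset.sum_congr rfl (g := fun _ => f y)
    (fun e he => by rw [(Finset.mem_filter.1 he).2]), Finset.sum_const, ← Nat.cast_smul_eq_nsmul ℚ]
  congr 1
  rw [card_eq_card_mul_card_of_surjective π hπ, Nat.cast_mul,
    mul_div_cancel_right₀ _ (by exact_mod_cast Nat.card_pos.ne')]
  obtain ⟨x₀, rfl⟩ := hπ y
  rw [← Fintype.card_subtype, ← Nat.card_eq_fintype_card]
  congr 1
  exact Nat.card_congr
    { toFun := fun x => ⟨x.1 - x₀, by simp [AddMonoidHom.mem_ker, x.2]⟩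
      invFun := fun x => ⟨x.1 + x₀, by simp [AddMonoidHom.mem_ker.1 x.2]⟩
      left_inv := fun x => by simp
      right_inv := fun x => by simp }

end HallSum

/-! ### Hall products under replacing a factor by a quotient or subobject -/

section Shift

variable {E : Type u} [Category.{v} E] [Abelian E]

attribute [local instance] HasExt.standard

/-- The kernel of the morphism between middle terms given by a quotient of the left hand term. -/
lemma Ses.nonempty_of_quotient {M N N' K L L' : E} (s : Ses N K N') (t : Ses M N' L)
    (t' : Ses M N L') (φ : L ⟶ L') (h₁ : t.i ≫ φ = s.p ≫ t'.i) (h₂ : φ ≫ t'.p = t.p) :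
    Nonempty (Ses L' K L) := by
  refine ⟨Ses.mk (s.i ≫ t.i) φ (by rw [Category.assoc, h₁, ← Category.assoc, s.w, zero_comp])
    { exact := ?_, mono_f := mono_comp _ _, epi_g := ?_ }⟩
  · rw [ShortComplex.exact_iff_exact_up_to_refinements]
    intro T x hx
    dsimp at x hx
    obtain ⟨n, rfl⟩ := t.exists_lift x (by rw [← h₂, ← Category.assoc, hx, zero_comp])
    obtain ⟨k, rfl⟩ := s.exists_lift n (by
      rw [← cancel_mono t'.i, Category.assoc, ← h₁, ← Category.assoc, hx]; simp)
    exact ⟨T, 𝟙 T, inferInstance, k, by simp⟩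
  · dsimp
    rw [epi_iff_surjective_up_to_refinements]
    intro T y
    obtain ⟨T₁, π₁, _, x, hx⟩ := surjective_up_to_refinements_of_epi t.p (y ≫ t'.p)
    obtain ⟨n, hn⟩ := t'.exists_lift (π₁ ≫ y - x ≫ φ) (by simp [h₂, hx])
    obtain ⟨T₂, π₂, _, n', hn'⟩ := surjective_up_to_refinements_of_epi s.p n
    refine ⟨T₂, π₂ ≫ π₁, epi_comp _ _, π₂ ≫ x + n' ≫ t.i, ?_⟩
    rw [Preadditive.add_comp, Category.assoc, Category.assoc n', h₁, ← Category.assoc n', ← hn',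
      Category.assoc π₂ n,
      hn]
    simp

/-- The cokernel of the morphism between middle terms given by a subobject of the right hand
term. -/
lemma Ses.nonempty_of_sub {G N N' K L L' : E} (s : Ses K N N') (t : Ses N G L)
    (t' : Ses N' G L') (φ : L ⟶ L') (h₁ : t.i ≫ φ = t'.i) (h₂ : φ ≫ t'.p = t.p ≫ s.i) :
    Nonempty (Ses K L L') := by
  refine ⟨Ses.mk φ (t'.p ≫ s.p) (by rw [← Category.assoc, h₂, Category.assoc, s.w, comp_zero])
    { exact := ?_, mono_f := ?_, epi_g := epi_comp _ _ }⟩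
  · rw [ShortComplex.exact_iff_exact_up_to_refinements]
    intro T x hx
    dsimp at x hx
    obtain ⟨n, hn⟩ := s.exists_lift (x ≫ t'.p) (by rw [Category.assoc, hx])
    obtain ⟨T₁, π₁, _, l, hl⟩ := surjective_up_to_refinements_of_epi t.p n
    obtain ⟨g, hg⟩ := t'.exists_lift (π₁ ≫ x - l ≫ φ) (by
      rw [Preadditive.sub_comp, Category.assoc, Category.assoc, h₂, ← hn, ← Category.assoc l,
        ← hl, Category.assoc, sub_self])
    refine ⟨T₁, π₁, inferInstance, l + g ≫ t.i, ?_⟩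
    dsimp
    rw [Preadditive.add_comp, Category.assoc, h₁, hg]
    abel
  · dsimp
    refine Preadditive.mono_of_cancel_zero _ fun {T} x hx => ?_
    obtain ⟨g, rfl⟩ := t.exists_lift x (by
      rw [← cancel_mono s.i, Category.assoc, ← h₂, ← Category.assoc, hx, zero_comp, zero_comp])
    rw [Category.assoc, h₁] at hx
    rw [(cancel_mono t'.i).1 (hx.trans zero_comp.symm), zero_comp]

variable [HallFinite E] {W : Type*} [AddCommGroup W] [Module ℚ W]

/-- Comparison of the products `[M] ⋄ [N']` and `[M] ⋄ [N]` for a quotient `N` of `N'`. -/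
lemma hallLin_mul_of_quotient (g : IsoClass E → W) (σ : W →ₗ[ℚ] W) (M : E) {K N N' : E}
    (s : Ses N K N') (hK : ∀ e : Abelian.Ext.{max u v} M K 2, e = 0)
    (hg : ∀ L L' : E, Nonempty (Ses L' K L) → g (IsoClass.mk L) = σ (g (IsoClass.mk L'))) :
    hallLin g (HallAlgebra.of (IsoClass.mk M) * HallAlgebra.of (IsoClass.mk N')) =
      (euler M K)⁻¹ •
        σ (hallLin g (HallAlgebra.of (IsoClass.mk M) * HallAlgebra.of (IsoClass.mk N))) := by
  let π : Abelian.Ext.{max u v} M N' 1 →+ Abelian.Ext.{max u v} M N 1 :=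
    (Ext.mk₀ s.p).postcomp M (add_zero 1)
  -- This is the only use of the vanishing of Ext²: every extension by `N` lifts to one by `N'`.
  have hπ : Function.Surjective π := fun x =>
    Ext.covariant_sequence_exact₃ M s.exact x (rfl : 1 + 1 = 2) (hK _)
  -- The middle term of `e` maps onto that of its image with kernel `K`, so `hg` compares the two
  -- contributions.
  have hmid : ∀ e, g (IsoClass.mk (mid e)) = σ (g (IsoClass.mk (mid (π e)))) := fun e => by
    obtain ⟨φ, h₁, h₂⟩ := (midSes e).exists_hom_of_cls_comp_eq (midSes (π e)) s.p (𝟙 M)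
      (by rw [midSes_cls, midSes_cls, Ext.mk₀_id_comp]; rfl)
    exact hg _ _ (s.nonempty_of_quotient _ _ φ h₁ (by simpa using h₂))
  have he := s.euler_covariant M hK
  rw [hallLin_mul, hallLin_mul, finsum_congr hmid,
    finsum_comp_of_surjective π hπ (fun y => σ (g (IsoClass.mk (mid y)))), map_smul,
    map_finsum _ (Set.toFinite _), smul_smul, smul_smul]
  -- Pulling back the sum along `π` gives |Ext¹(M, N')| / |Ext¹(M, N)|. Together with the two Hom
  -- factors this is the inverse of `euler M K`, by multiplicativity along `s`.
  congr 1
  unfold euler at *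
  have c1 : (Nat.card (M ⟶ N) : ℚ) ≠ 0 := by exact_mod_cast Nat.card_pos.ne'
  have c2 : (Nat.card (M ⟶ N') : ℚ) ≠ 0 := by exact_mod_cast Nat.card_pos.ne'
  have c3 : (Nat.card (Abelian.Ext.{max u v} M N 1) : ℚ) ≠ 0 := by exact_mod_cast Nat.card_pos.ne'
  have c4 : (Nat.card (Abelian.Ext.{max u v} M N' 1) : ℚ) ≠ 0 := by exact_mod_cast Nat.card_pos.ne'
  have c5 : (Nat.card (M ⟶ K) : ℚ) ≠ 0 := by exact_mod_cast Nat.card_pos.ne'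
  have c6 : (Nat.card (Abelian.Ext.{max u v} M K 1) : ℚ) ≠ 0 := by exact_mod_cast Nat.card_pos.ne'
  field_simp at he ⊢
  linear_combination -he

/-- Comparison of the products `[N'] ⋄ [G]` and `[N] ⋄ [G]` for a subobject `N` of `N'`. -/
lemma hallLin_mul_of_sub (g : IsoClass E → W) (σ : W →ₗ[ℚ] W) (G : E) {K N N' : E}
    (s : Ses K N N') (hK : ∀ e : Abelian.Ext.{max u v} K G 2, e = 0)
    (hg : ∀ L L' : E, Nonempty (Ses K L L') → g (IsoClass.mk L') = σ (g (IsoClass.mk L))) :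
    hallLin g (HallAlgebra.of (IsoClass.mk N') * HallAlgebra.of (IsoClass.mk G)) =
      (euler K G)⁻¹ •
        σ (hallLin g (HallAlgebra.of (IsoClass.mk N) * HallAlgebra.of (IsoClass.mk G))) := by
  let π : Abelian.Ext.{max u v} N' G 1 →+ Abelian.Ext.{max u v} N G 1 :=
    (Ext.mk₀ s.i).precomp G (zero_add 1)
  have hπ : Function.Surjective π := fun x =>
    Ext.contravariant_sequence_exact₁ s.exact G x (rfl : 1 + 1 = 2) (hK _)
  have hmid : ∀ e, g (IsoClass.mk (mid e)) = σ (g (IsoClass.mk (mid (π e)))) := fun e => by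
    obtain ⟨φ, h₁, h₂⟩ := (midSes (π e)).exists_hom_of_cls_comp_eq (midSes e) (𝟙 G) s.i
      (by rw [midSes_cls, midSes_cls, Ext.comp_mk₀_id]; rfl)
    exact hg _ _ (s.nonempty_of_sub _ _ φ (by simpa using h₁) h₂)
  have he := s.euler_contravariant G hK
  rw [hallLin_mul, hallLin_mul, finsum_congr hmid,
    finsum_comp_of_surjective π hπ (fun y => σ (g (IsoClass.mk (mid y)))), map_smul,
    map_finsum _ (Set.toFinite _), smul_smul, smul_smul]
  congr 1
  unfold euler at *
  have c1 : (Nat.card (N ⟶ G) : ℚ) ≠ 0 := by exact_mod_cast Nat.card_pos.ne'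
  have c2 : (Nat.card (N' ⟶ G) : ℚ) ≠ 0 := by exact_mod_cast Nat.card_pos.ne'
  have c3 : (Nat.card (Abelian.Ext.{max u v} N G 1) : ℚ) ≠ 0 := by exact_mod_cast Nat.card_pos.ne'
  have c4 : (Nat.card (Abelian.Ext.{max u v} N' G 1) : ℚ) ≠ 0 := by exact_mod_cast Nat.card_pos.ne'
  have c5 : (Nat.card (K ⟶ G) : ℚ) ≠ 0 := by exact_mod_cast Nat.card_pos.ne'
  have c6 : (Nat.card (Abelian.Ext.{max u v} K G 1) : ℚ) ≠ 0 := by exact_mod_cast Nat.card_pos.ne'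
  field_simp at he ⊢
  linear_combination -he

end Shift

/-! ### Complexes with the same object in two adjacent degrees -/

section TwoTerm

open HomologicalComplex

variable {A : Type u} [Category.{v} A] [Abelian A] {t : ℕ}

/-- The identification of the term of degree `i` of a stalk complex with that of degree `i + 1`. -/
def stalkShift (X : A) (i j k : ZMod t) :
    ((single A (ComplexShape.up (ZMod t)) i).obj X).X j ⟶ ((single A (ComplexShape.up (ZMod t)) (i + 1)).obj X).X k :=
  if h : j = i ∧ k = i + 1 then
    (singleObjXIsoOfEq (ComplexShape.up (ZMod t)) i X j h.1).hom ≫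
      (singleObjXIsoOfEq (ComplexShape.up (ZMod t)) (i + 1) X k h.2).inv
  else 0

lemma stalkShift_self (X : A) (i : ZMod t) : stalkShift X i i (i + 1) =
    (singleObjXSelf (ComplexShape.up (ZMod t)) i X).hom ≫
      (singleObjXSelf (ComplexShape.up (ZMod t)) (i + 1) X).inv :=
  dif_pos ⟨rfl, rfl⟩

lemma stalkShift_shape (X : A) (i j k : ZMod t) (h : ¬ j + 1 = k) : stalkShift X i j k = 0 :=
  dif_neg fun ⟨h1, h2⟩ => h (by rw [h1, h2])

variable (A) in
/-- The functor mapping `X` to the complex `X ⟶ X` in the degrees `i` and `i + 1`. -/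
def twoTerm (i : ZMod t) : A ⥤ Cplx A t where
  obj X :=
    { X := fun j => ((single A (ComplexShape.up (ZMod t)) i).obj X).X j ⊞ ((single A (ComplexShape.up (ZMod t)) (i + 1)).obj X).X j
      d := fun j k => biprod.fst ≫ stalkShift X i j k ≫ biprod.inr
      shape := fun j k h => by rw [stalkShift_shape X i j k h, zero_comp, comp_zero]
      d_comp_d' := fun j k l _ _ => by simp }
  map f :=
    { f := fun j => biprod.map (((single A _ i).map f).f j) (((single A _ (i + 1)).map f).f j)
      comm' := fun j k h => by
        have h : j + 1 = k := h
        subst h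
        dsimp only
        rw [biprod.map_fst_assoc, Category.assoc, Category.assoc, biprod.inr_map]
        congr 1
        rw [← Category.assoc, ← Category.assoc]
        congr 1
        by_cases hj : j = i
        · subst hj
          rw [stalkShift_self, stalkShift_self, single_map_f_self, single_map_f_self]
          simp
        · exact (isZero_single_obj_X _ _ _ _ hj).eq_of_src _ _ }
  map_id X := by ext j : 1; exact biprod.hom_ext _ _ (by simp) (by simp)
  map_comp f g := by ext j : 1; exact biprod.hom_ext _ _ (by simp) (by simp)

lemma isZero_single_X (X : A) {i j : ZMod t} (h : j ≠ i) :
    IsZero (((single A (ComplexShape.up (ZMod t)) i).obj X).X j) :=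
  isZero_single_obj_X _ _ _ _ h

lemma singleObjXIsoOfEq_rfl (X : A) (i : ZMod t) :
    singleObjXIsoOfEq (ComplexShape.up (ZMod t)) i X i rfl = singleObjXSelf _ i X := rfl

/-- Morphisms from `twoTerm`. -/
def twoTermDesc {X : A} {i : ZMod t} {K : Cplx A t} (f : X ⟶ K.X i) :
    (twoTerm A i).obj X ⟶ K where
  f := fun j => biprod.desc
    (if h : j = i then (singleObjXIsoOfEq _ i X j h).hom ≫ f ≫ (K.XIsoOfEq h).inv else 0)
    (if h : j = i + 1 then (singleObjXIsoOfEq _ (i + 1) X j h).hom ≫ f ≫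
      K.d i (i + 1) ≫ (K.XIsoOfEq h).inv else 0)
  comm' := by
    rintro j k (rfl : j + 1 = k)
    refine biprod.hom_ext' _ _ ?_ ?_
    · by_cases h : j = i
      · subst h
        simp [twoTerm, stalkShift_self, singleObjXIsoOfEq_rfl]
      · exact (isZero_single_X X h).eq_of_src _ _
    · by_cases h : j = i + 1
      · subst h
        simp [twoTerm, singleObjXIsoOfEq_rfl]
      · exact (isZero_single_X X h).eq_of_src _ _

/-- The inclusion of `X` in the lower degree. -/
def twoTermInl (X : A) (i : ZMod t) : X ⟶ ((twoTerm A i).obj X).X i :=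
  (singleObjXSelf _ i X).inv ≫ biprod.inl

/-- The inclusion of `X` in the upper degree. -/
def twoTermInr (X : A) (i : ZMod t) : X ⟶ ((twoTerm A i).obj X).X (i + 1) :=
  (singleObjXSelf _ (i + 1) X).inv ≫ biprod.inr

/-- The projection to `X` in the lower degree. -/
def twoTermFst (X : A) (i : ZMod t) : ((twoTerm A i).obj X).X i ⟶ X :=
  biprod.fst ≫ (singleObjXSelf _ i X).hom

/-- The projection to `X` in the upper degree. -/
def twoTermSnd (X : A) (i : ZMod t) : ((twoTerm A i).obj X).X (i + 1) ⟶ X :=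
  biprod.snd ≫ (singleObjXSelf _ (i + 1) X).hom

lemma twoTermInl_d (X : A) (i : ZMod t) :
    twoTermInl X i ≫ ((twoTerm A i).obj X).d i (i + 1) = twoTermInr X i := by
  change ((singleObjXSelf _ i X).inv ≫ biprod.inl) ≫ biprod.fst ≫ stalkShift X i i (i + 1) ≫
    biprod.inr = (singleObjXSelf _ (i + 1) X).inv ≫ biprod.inr
  rw [stalkShift_self]
  simp

lemma twoTerm_d_snd (X : A) (i : ZMod t) :
    ((twoTerm A i).obj X).d i (i + 1) ≫ twoTermSnd X i = twoTermFst X i := by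
  change (biprod.fst ≫ stalkShift X i i (i + 1) ≫ biprod.inr) ≫ biprod.snd ≫
    (singleObjXSelf _ (i + 1) X).hom = biprod.fst ≫ (singleObjXSelf _ i X).hom
  rw [stalkShift_self]
  simp

@[simp]
lemma twoTerm_map_inl {X Y : A} (f : X ⟶ Y) (i : ZMod t) :
    twoTermInl X i ≫ ((twoTerm A i).map f).f i = f ≫ twoTermInl Y i := by
  change ((singleObjXSelf _ i X).inv ≫ biprod.inl) ≫
    biprod.map (((single A _ i).map f).f i) (((single A _ (i + 1)).map f).f i) =
      f ≫ (singleObjXSelf _ i Y).inv ≫ biprod.inl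
  rw [single_map_f_self]
  simp

lemma twoTerm_map_snd {X Y : A} (f : X ⟶ Y) (i : ZMod t) :
    ((twoTerm A i).map f).f (i + 1) ≫ twoTermSnd Y i = twoTermSnd X i ≫ f := by
  change biprod.map (((single A _ i).map f).f (i + 1)) (((single A _ (i + 1)).map f).f (i + 1)) ≫
    biprod.snd ≫ (singleObjXSelf _ (i + 1) Y).hom =
      (biprod.snd ≫ (singleObjXSelf _ (i + 1) X).hom) ≫ f
  rw [single_map_f_self]
  simp

lemma twoTermDesc_f {X : A} {i : ZMod t} {K : Cplx A t} (f : X ⟶ K.X i) :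
    twoTermInl X i ≫ (twoTermDesc f).f i = f := by
  change ((singleObjXSelf _ i X).inv ≫ biprod.inl) ≫ biprod.desc (dite _ _ _) _ = f
  simp [singleObjXIsoOfEq_rfl]

/-- On the upper copy a morphism is forced, since that copy is the image of the lower one under the
differential. -/
lemma twoTerm_hom_ext {X : A} {i : ZMod t} {K : Cplx A t} {φ ψ : (twoTerm A i).obj X ⟶ K}
    (h : twoTermInl X i ≫ φ.f i = twoTermInl X i ≫ ψ.f i) : φ = ψ := by
  have h' : twoTermInr X i ≫ φ.f (i + 1) = twoTermInr X i ≫ ψ.f (i + 1) := by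
    rw [← twoTermInl_d]
    simp only [Category.assoc, ← HomologicalComplex.Hom.comm]
    rw [reassoc_of% h]
  ext j : 1
  refine biprod.hom_ext' _ _ ?_ ?_
  · by_cases hj : j = i
    · subst hj
      exact (cancel_epi (singleObjXSelf _ j X).inv).1
        ((Category.assoc _ _ _).symm.trans (h.trans (Category.assoc _ _ _)))
    · exact (isZero_single_X X hj).eq_of_src _ _
  · by_cases hj : j = i + 1
    · subst hj
      exact (cancel_epi (singleObjXSelf _ (i + 1) X).inv).1
        ((Category.assoc _ _ _).symm.trans (h'.trans (Category.assoc _ _ _)))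
    · exact (isZero_single_X X hj).eq_of_src _ _

/-- The adjunction of `twoTerm` and of the evaluation in the lower degree. -/
def twoTermAdjEval (i : ZMod t) :
    twoTerm A i ⊣ HomologicalComplex.eval A (ComplexShape.up (ZMod t)) i :=
  Adjunction.mkOfHomEquiv
    { homEquiv := fun X K =>
        { toFun := fun φ => twoTermInl X i ≫ φ.f i
          invFun := fun f => twoTermDesc f
          left_inv := fun φ => twoTerm_hom_ext (twoTermDesc_f _)
          right_inv := fun f => twoTermDesc_f f }
      homEquiv_naturality_left_symm := fun {X' X Y} f g => twoTerm_hom_ext (by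
        refine (twoTermDesc_f _).trans ?_
        rw [HomologicalComplex.comp_f, ← Category.assoc, twoTerm_map_inl, Category.assoc]
        exact congrArg (f ≫ ·) (twoTermDesc_f g).symm)
      homEquiv_naturality_right := fun f g => (Category.assoc _ _ _).symm }

/-- Morphisms to `twoTerm`. -/
def twoTermLift {X : A} {i : ZMod t} {K : Cplx A t} (f : K.X (i + 1) ⟶ X) :
    K ⟶ (twoTerm A i).obj X where
  f := fun j => biprod.lift
    (if h : j = i then (K.XIsoOfEq h).hom ≫ K.d i (i + 1) ≫ f ≫
      (singleObjXIsoOfEq _ i X j h).inv else 0)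
    (if h : j = i + 1 then (K.XIsoOfEq h).hom ≫ f ≫ (singleObjXIsoOfEq _ (i + 1) X j h).inv else 0)
  comm' := by
    rintro j k (rfl : j + 1 = k)
    refine biprod.hom_ext _ _ ?_ ?_
    · by_cases h : j + 1 = i
      · subst h
        simp [twoTerm, singleObjXIsoOfEq_rfl]
      · exact (isZero_single_X X h).eq_of_tgt _ _
    · by_cases h : j = i
      · subst h
        simp [twoTerm, stalkShift_self, singleObjXIsoOfEq_rfl]
      · exact (isZero_single_X X (fun h' => h (add_right_cancel h'))).eq_of_tgt _ _

lemma twoTermLift_f {X : A} {i : ZMod t} {K : Cplx A t} (f : K.X (i + 1) ⟶ X) :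
    (twoTermLift f).f (i + 1) ≫ twoTermSnd X i = f := by
  change biprod.lift _ (dite _ _ _) ≫ biprod.snd ≫ (singleObjXSelf _ (i + 1) X).hom = f
  rw [biprod.lift_snd_assoc]
  simp [singleObjXIsoOfEq_rfl]

lemma twoTerm_hom_ext' {X : A} {i : ZMod t} {K : Cplx A t} {φ ψ : K ⟶ (twoTerm A i).obj X}
    (h : φ.f (i + 1) ≫ twoTermSnd X i = ψ.f (i + 1) ≫ twoTermSnd X i) : φ = ψ := by
  have h' : φ.f i ≫ twoTermFst X i = ψ.f i ≫ twoTermFst X i := by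
    rw [← twoTerm_d_snd]
    simp only [HomologicalComplex.Hom.comm_assoc]
    rw [h]
  ext j : 1
  refine biprod.hom_ext _ _ ?_ ?_
  · by_cases hj : j = i
    · subst hj
      exact (cancel_mono (singleObjXSelf _ j X).hom).1
        ((Category.assoc _ _ _).trans (h'.trans (Category.assoc _ _ _).symm))
    · exact (isZero_single_X X hj).eq_of_tgt _ _
  · by_cases hj : j = i + 1
    · subst hj
      exact (cancel_mono (singleObjXSelf _ (i + 1) X).hom).1
        ((Category.assoc _ _ _).trans (h.trans (Category.assoc _ _ _).symm))
    · exact (isZero_single_X X hj).eq_of_tgt _ _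

/-- The adjunction of `twoTerm` and of the evaluation in the upper degree. -/
def evalAdjTwoTerm (i : ZMod t) :
    HomologicalComplex.eval A (ComplexShape.up (ZMod t)) (i + 1) ⊣ twoTerm A i :=
  Adjunction.mkOfHomEquiv
    { homEquiv := fun K X =>
        { toFun := fun f => twoTermLift f
          invFun := fun φ => φ.f (i + 1) ≫ twoTermSnd X i
          left_inv := fun f => twoTermLift_f f
          right_inv := fun φ => twoTerm_hom_ext' (twoTermLift_f _) }
      homEquiv_naturality_left_symm := fun f g => Category.assoc _ _ _
      homEquiv_naturality_right := fun {K X Y} f g => twoTerm_hom_ext' (by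
        refine (twoTermLift_f _).trans ?_
        rw [HomologicalComplex.comp_f, Category.assoc, twoTerm_map_snd, ← Category.assoc]
        exact congrArg (· ≫ g) (twoTermLift_f f).symm) }

/-- The functor has evaluation in degree `i + 1` as left adjoint and evaluation in degree `i` as
right adjoint, hence is exact on both sides. -/
instance (i : ZMod t) : PreservesFiniteLimits (twoTerm A i) :=
  have := (evalAdjTwoTerm (A := A) i).rightAdjoint_preservesLimits
  inferInstance

instance (i : ZMod t) : PreservesFiniteColimits (twoTerm A i) :=
  have := (twoTermAdjEval (A := A) i).leftAdjoint_preservesColimits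
  inferInstance

instance (i : ZMod t) : (twoTerm A i).Additive := Functor.additive_of_preserves_binary_products _

end TwoTerm

/-! ### Exact functors and adjunctions on `Ext` -/

section ExactFunctors

attribute [local instance] HasExt.standard

universe v' u' v'' u''

variable {E : Type u} [Category.{v} E] [Abelian E] {D : Type u'} [Category.{v'} D] [Abelian D]
  {D' : Type u''} [Category.{v''} D'] [Abelian D']

/-- The image of a short exact sequence under an exact functor. -/
def Ses.mapFunctor {A C B : E} (s : Ses A C B) (F : E ⥤ D) [F.Additive] [PreservesFiniteLimits F]
    [PreservesFiniteColimits F] : Ses (F.obj A) (F.obj C) (F.obj B) :=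
  Ses.mk (F.map s.i) (F.map s.p) (by rw [← F.map_comp, s.w, F.map_zero]) (s.exact.map_of_exact F)

section

variable (F F' : E ⥤ D) [F.Additive] [PreservesFiniteLimits F] [PreservesFiniteColimits F]
  [F'.Additive] [PreservesFiniteLimits F'] [PreservesFiniteColimits F']
  (G : D ⥤ D') [G.Additive] [PreservesFiniteLimits G] [PreservesFiniteColimits G]

lemma Ses.cls_mapFunctor {A C B : E} (s : Ses A C B) :
    (s.mapFunctor F).cls = s.cls.mapExactFunctor F :=
  (Ext.mapExactFunctor_extClass F s.exact).symm

/-- By `exists_cls_comp` every class is built from classes of short exact sequences and a morphism,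
so an induction on the degree reduces to these. -/
lemma mapExactFunctor_id {X Y : E} {n : ℕ} (e : Abelian.Ext.{max u v} X Y n) :
    e.mapExactFunctor (𝟭 E) = e := by
  induction n generalizing X with
  | zero =>
    obtain ⟨f, rfl⟩ := (Ext.mk₀_bijective _ _).2 e
    exact Ext.mapExactFunctor_mk₀ (𝟭 E) f
  | succ n ih =>
    obtain ⟨K, P, s, e', rfl⟩ := exists_cls_comp e
    rw [Ext.mapExactFunctor_comp, ← Ses.cls_mapFunctor, ih]
    rfl

lemma mapExactFunctor_comp_functor {X Y : E} {n : ℕ} (e : Abelian.Ext.{max u v} X Y n) :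
    (e.mapExactFunctor F).mapExactFunctor G = e.mapExactFunctor (F ⋙ G) := by
  induction n generalizing X with
  | zero =>
    obtain ⟨f, rfl⟩ := (Ext.mk₀_bijective _ _).2 e
    rw [Ext.mapExactFunctor_mk₀, Ext.mapExactFunctor_mk₀, Ext.mapExactFunctor_mk₀]
    rfl
  | succ n ih =>
    obtain ⟨K, P, s, e', rfl⟩ := exists_cls_comp e
    rw [Ext.mapExactFunctor_comp, Ext.mapExactFunctor_comp, Ext.mapExactFunctor_comp, ih,
      ← Ses.cls_mapFunctor, ← Ses.cls_mapFunctor, ← Ses.cls_mapFunctor]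
    rfl

variable {F F'} in
/-- Natural transformations of exact functors are compatible with the classes of all degrees. -/
lemma mapExactFunctor_naturality (α : F ⟶ F') {X Y : E} {n : ℕ}
    (e : Abelian.Ext.{max u v} X Y n) :
    (e.mapExactFunctor F).comp (Ext.mk₀ (α.app Y)) (add_zero n) =
      (Ext.mk₀ (α.app X)).comp (e.mapExactFunctor F') (zero_add n) := by
  induction n generalizing X with
  | zero =>
    obtain ⟨f, rfl⟩ := (Ext.mk₀_bijective _ _).2 e
    rw [Ext.mapExactFunctor_mk₀, Ext.mapExactFunctor_mk₀, Ext.mk₀_comp_mk₀, Ext.mk₀_comp_mk₀,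
      α.naturality]
  | succ n ih =>
    obtain ⟨K, P, s, e', rfl⟩ := exists_cls_comp e
    rw [Ext.mapExactFunctor_comp, Ext.mapExactFunctor_comp,
      Ext.comp_assoc_of_third_deg_zero, ih, ← Ext.comp_assoc_of_second_deg_zero,
      ← Ses.cls_mapFunctor, ← Ses.cls_mapFunctor,
      (s.mapFunctor F).cls_naturality (s.mapFunctor F') (α.app X) (α.app K) (α.app P)
        (α.naturality _).symm (α.naturality _).symm, Ext.comp_assoc]
    omega

end

section

variable {L : E ⥤ D} {R : D ⥤ E} [L.Additive] [PreservesFiniteLimits L] [PreservesFiniteColimits L]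
  [R.Additive] [PreservesFiniteLimits R] [PreservesFiniteColimits R]

/-- By naturality of the counit, the counit at `L.obj X` followed by `e` factors through the class
obtained from `e` by applying `R` and then `L`, which vanishes by `h`. A triangle identity recovers
`e` from this composite. -/
lemma ext_leftAdjoint_eq_zero (adj : L ⊣ R) {X : E} {K : D} {n : ℕ}
    (h : ∀ e : Abelian.Ext.{max u v} (R.obj (L.obj X)) (R.obj K) n, e = 0)
    (e : Abelian.Ext.{max u' v'} (L.obj X) K n) : e = 0 := by
  have h1 := mapExactFunctor_naturality adj.counit e
  rw [← mapExactFunctor_comp_functor, h (e.mapExactFunctor R), mapExactFunctor_id,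
    Ext.mapExactFunctor_zero, Ext.zero_comp] at h1
  have h2 : (Ext.mk₀ (L.map (adj.unit.app X))).comp
      ((Ext.mk₀ (adj.counit.app (L.obj X))).comp e (zero_add n)) (zero_add n) = e := by
    rw [Ext.mk₀_comp_mk₀_assoc]
    exact (congrArg (fun f => (Ext.mk₀ f).comp e (zero_add n))
      (adj.left_triangle_components X)).trans (Ext.mk₀_id_comp e)
  rw [← h2]
  exact (congrArg (fun x => (Ext.mk₀ (L.map (adj.unit.app X))).comp x (zero_add n)) h1.symm).trans
    (Ext.comp_zero ..)

/-- The dual argument, with the unit and the other triangle identity. -/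
lemma ext_rightAdjoint_eq_zero (adj : L ⊣ R) {X : D} {K : E} {n : ℕ}
    (h : ∀ e : Abelian.Ext.{max u' v'} (L.obj K) (L.obj (R.obj X)) n, e = 0)
    (e : Abelian.Ext.{max u v} K (R.obj X) n) : e = 0 := by
  have h1 := mapExactFunctor_naturality adj.unit e
  rw [← mapExactFunctor_comp_functor, h (e.mapExactFunctor L), mapExactFunctor_id,
    Ext.mapExactFunctor_zero, Ext.comp_zero] at h1
  have h2 : (e.comp (Ext.mk₀ (adj.unit.app (R.obj X))) (add_zero n)).comp
      (Ext.mk₀ (R.map (adj.counit.app X))) (add_zero n) = e := by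
    rw [Ext.comp_assoc_of_third_deg_zero, Ext.mk₀_comp_mk₀, adj.right_triangle_components,
      Ext.comp_mk₀_id]
  rw [← h2]
  exact (congrArg (fun x => x.comp (Ext.mk₀ (R.map (adj.counit.app X))) (add_zero n)) h1).trans
    (Ext.zero_comp ..)

end

end ExactFunctors

/-- The split short exact sequence. -/
def Ses.biprod {E : Type u} [Category.{v} E] [Abelian E] (X Y : E) : Ses X Y (X ⊞ Y) :=
  Ses.mk biprod.inr biprod.fst (by simp)
    (ShortComplex.Splitting.shortExact
      { r := biprod.snd
        s := biprod.inl
        f_r := by simp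
        s_g := by simp
        id := (add_comm _ _).trans biprod.total })

/-! ### Stalk complexes -/

section Stalks

open HomologicalComplex

attribute [local instance] HasExt.standard

variable {A : Type u} [Category.{v} A] [Abelian A] {t : ℕ}

variable (A) in
/-- The functor `X ↦ U_{X,i}`. -/
abbrev stalkFunctor (i : ZMod t) : A ⥤ Cplx A t := single A (ComplexShape.up (ZMod t)) i

instance (i : ZMod t) : PreservesFiniteLimits (stalkFunctor A i) := inferInstance
instance (i : ZMod t) : PreservesFiniteColimits (stalkFunctor A i) := inferInstance
instance (i : ZMod t) : (stalkFunctor A i).Additive := inferInstance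

variable (A) in
/-- The inclusion of the upper term. -/
def stalkToTwoTerm (i : ZMod t) : stalkFunctor A (i + 1) ⟶ twoTerm A i where
  app X :=
    { f := fun j => biprod.inr
      comm' := fun j k _ => by simp [twoTerm] }
  naturality X Y f := by
    ext : 1
    exact (biprod.inr_map _ _).symm

variable (A) in
/-- The projection to the lower term. -/
def twoTermToStalk (i : ZMod t) : twoTerm A i ⟶ stalkFunctor A i where
  app X :=
    { f := fun j => biprod.fst
      comm' := fun j k _ => by simp [twoTerm] }
  naturality X Y f := by
    ext : 1
    exact biprod.map_fst _ _

/-- The short exact sequence `0 ⟶ U_{X,i+1} ⟶ L ⟶ U_{X,i} ⟶ 0`. -/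
def twoTermSes (X : A) (i : ZMod t) :
    Ses ((stalkFunctor A i).obj X) ((stalkFunctor A (i + 1)).obj X) ((twoTerm A i).obj X) :=
  Ses.mk ((stalkToTwoTerm A i).app X) ((twoTermToStalk A i).app X)
    (by ext : 1; exact biprod.inr_fst)
    (by
      rw [HomologicalComplex.shortExact_iff_degreewise_shortExact]
      intro j
      exact (Ses.biprod (((stalkFunctor A i).obj X).X j)
        (((stalkFunctor A (i + 1)).obj X).X j)).exact)

variable [Hereditary A]

/-- The exact adjunction with evaluation reduces this to degree 2 in `A`, where heredity applies. -/
lemma ext_twoTerm_eq_zero (X : A) (i : ZMod t) (K : Cplx A t)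
    (e : Abelian.Ext.{max u v} ((twoTerm A i).obj X) K 2) : e = 0 :=
  ext_leftAdjoint_eq_zero (twoTermAdjEval i) (Hereditary.ext_eq_zero _ _ 2 le_rfl) e

lemma ext_to_twoTerm_eq_zero (X : A) (i : ZMod t) (K : Cplx A t)
    (e : Abelian.Ext.{max u v} K ((twoTerm A i).obj X) 2) : e = 0 :=
  ext_rightAdjoint_eq_zero (evalAdjTwoTerm i) (Hereditary.ext_eq_zero _ _ 2 le_rfl) e

end Stalks

/-! ### Short exact sequences from universal properties -/

section

variable {E : Type u} [Category.{v} E] [Abelian E]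

/-- A short exact sequence from the lifting property of the kernel. -/
def Ses.ofLift {A C B : E} (i : C ⟶ B) (p : B ⟶ A) [hi : Mono i] [hp : Epi p] (w : i ≫ p = 0)
    (h : ∀ (T : E) (x : T ⟶ B), x ≫ p = 0 → ∃ y : T ⟶ C, y ≫ i = x) : Ses A C B :=
  Ses.mk i p w
    { exact := ShortComplex.exact_of_f_is_kernel _
        (KernelFork.IsLimit.ofι' _ w (fun k hk => ⟨(h _ k hk).choose, (h _ k hk).choose_spec⟩))
      mono_f := hi
      epi_g := hp }

/-- A short exact sequence from the descent property of the cokernel. -/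
def Ses.ofDesc {A C B : E} (i : C ⟶ B) (p : B ⟶ A) [hi : Mono i] [hp : Epi p] (w : i ≫ p = 0)
    (h : ∀ (T : E) (x : B ⟶ T), i ≫ x = 0 → ∃ y : A ⟶ T, p ≫ y = x) : Ses A C B :=
  Ses.mk i p w
    { exact := ShortComplex.exact_of_g_is_cokernel _
        (CokernelCofork.IsColimit.ofπ' _ w (fun k hk => ⟨(h _ k hk).choose, (h _ k hk).choose_spec⟩))
      mono_f := hi
      epi_g := hp }

@[simp] lemma Ses.ofLift_i {A C B : E} (i : C ⟶ B) (p : B ⟶ A) [Mono i] [Epi p] (w h) :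
    (Ses.ofLift i p w h).i = i := rfl
@[simp] lemma Ses.ofLift_p {A C B : E} (i : C ⟶ B) (p : B ⟶ A) [Mono i] [Epi p] (w h) :
    (Ses.ofLift i p w h).p = p := rfl
@[simp] lemma Ses.ofDesc_i {A C B : E} (i : C ⟶ B) (p : B ⟶ A) [Mono i] [Epi p] (w h) :
    (Ses.ofDesc i p w h).i = i := rfl
@[simp] lemma Ses.ofDesc_p {A C B : E} (i : C ⟶ B) (p : B ⟶ A) [Mono i] [Epi p] (w h) :
    (Ses.ofDesc i p w h).p = p := rfl

end

/-! ### Cycles and opcycles in extensions of stalk and acyclic complexes -/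

section Acyclic

open HomologicalComplex

attribute [local instance] HasExt.standard

variable {A : Type u} [Category.{v} A] [Abelian A] {t : ℕ}

/-- The degreewise short exact sequences of a short exact sequence of complexes. -/
def Ses.eval {M N L : Cplx A t} (s : Ses M N L) (j : ZMod t) : Ses (M.X j) (N.X j) (L.X j) :=
  Ses.mk (s.i.f j) (s.p.f j) (by rw [← comp_f, s.w, zero_f])
    (s.exact.map_of_exact (HomologicalComplex.eval A (ComplexShape.up (ZMod t)) j))

@[simp] lemma Ses.eval_i {M N L : Cplx A t} (s : Ses M N L) (j : ZMod t) :
    (s.eval j).i = s.i.f j := rfl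
@[simp] lemma Ses.eval_p {M N L : Cplx A t} (s : Ses M N L) (j : ZMod t) :
    (s.eval j).p = s.p.f j := rfl

lemma Acyclic.exists_lift {K : Cplx A t} (hK : K.Acyclic) {i : ZMod t} {T : A}
    (x : T ⟶ K.X (i + 1)) (hx : x ≫ K.d (i + 1) (i + 1 + 1) = 0) :
    ∃ (T' : A) (π : T' ⟶ T) (_ : Epi π) (y : T' ⟶ K.X i), y ≫ K.d i (i + 1) = π ≫ x := by
  have h := (K.exactAt_iff' i (i + 1) (i + 1 + 1)
    ((ComplexShape.up (ZMod t)).prev_eq' rfl) ((ComplexShape.up (ZMod t)).next_eq' rfl)).1 (hK (i + 1))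
  rw [ShortComplex.exact_iff_exact_up_to_refinements] at h
  obtain ⟨T', π, hπ, y, hy⟩ := h x hx
  exact ⟨T', π, hπ, y, hy.symm⟩

/-- By exactness `x` kills the kernel of the next differential, so it factors through the image; a
pushout along the inclusion of the image gives the extension, after enlarging `T`. -/
lemma Acyclic.exists_desc {K : Cplx A t} (hK : K.Acyclic) {i : ZMod t} {T : A}
    (x : K.X (i + 1) ⟶ T) (hx : K.d i (i + 1) ≫ x = 0) :
    ∃ (T' : A) (ι : T ⟶ T') (_ : Mono ι) (y : K.X (i + 1 + 1) ⟶ T'),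
      K.d (i + 1) (i + 1 + 1) ≫ y = x ≫ ι := by
  have h := (K.exactAt_iff' i (i + 1) (i + 1 + 1)
    ((ComplexShape.up (ZMod t)).prev_eq' rfl) ((ComplexShape.up (ZMod t)).next_eq' rfl)).1 (hK (i + 1))
  have hz : kernel.ι (K.d (i + 1) (i + 1 + 1)) ≫ x = 0 := by
    have : Epi (kernel.lift (K.d (i + 1) (i + 1 + 1)) (K.d i (i + 1)) (K.d_comp_d _ _ _)) :=
      h.epi_kernelLift
    rw [← cancel_epi (kernel.lift _ _ (K.d_comp_d i (i + 1) (i + 1 + 1))), comp_zero,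
      ← Category.assoc, kernel.lift_ι]
    exact hx
  let p := factorThruImage (K.d (i + 1) (i + 1 + 1))
  obtain ⟨x', hx'⟩ := (Ses.ker p).exists_desc x (by
    have h1 : (Ses.ker p).i ≫ K.d (i + 1) (i + 1 + 1) = 0 := by
      refine (congrArg (_ ≫ ·) (Limits.image.fac (K.d (i + 1) (i + 1 + 1))).symm).trans ?_
      rw [← Category.assoc]
      exact (congrArg (· ≫ _) (Ses.ker p).w).trans zero_comp
    rw [← kernel.lift_ι _ _ h1, Category.assoc, hz, comp_zero])
  refine ⟨pushout x' (Limits.image.ι (K.d (i + 1) (i + 1 + 1))), pushout.inl _ _, inferInstance,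
    pushout.inr _ _, ?_⟩
  rw [← hx', Category.assoc, pushout.condition, ← Category.assoc]
  exact congrArg (· ≫ _) (Limits.image.fac (K.d (i + 1) (i + 1 + 1))).symm

/-- The morphism from the stalk complex of the cycles. -/
def cyclesι (K : Cplx A t) (i : ZMod t) : (stalkFunctor A i).obj (K.cycles i) ⟶ K :=
  mkHomFromSingle (K.iCycles i) fun k _ => K.iCycles_d i k

/-- The morphism to the stalk complex of the opcycles. -/
def opcyclesπ (K : Cplx A t) (i : ZMod t) : K ⟶ (stalkFunctor A i).obj (K.opcycles i) :=
  mkHomToSingle (K.pOpcycles i) fun k _ => K.d_pOpcycles k i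

lemma cyclesι_f (K : Cplx A t) (i : ZMod t) :
    (singleObjXSelf _ i _).inv ≫ (cyclesι K i).f i = K.iCycles i := by
  rw [cyclesι, mkHomFromSingle_f, Iso.inv_hom_id_assoc]

lemma opcyclesπ_f (K : Cplx A t) (i : ZMod t) :
    (opcyclesπ K i).f i ≫ (singleObjXSelf _ i _).hom = K.pOpcycles i := by
  rw [opcyclesπ, mkHomToSingle_f, Category.assoc, Iso.inv_hom_id, Category.comp_id]

/-- A morphism from a complex with zero differential out of the degree maps to the cycles. -/
lemma exists_lift_cycles (K : Cplx A t) {i : ZMod t} {T : A} (x : T ⟶ K.X i)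
    (hx : x ≫ K.d i (i + 1) = 0) : ∃ y : T ⟶ K.cycles i, y ≫ K.iCycles i = x :=
  ⟨K.liftCycles x (i + 1) ((ComplexShape.up (ZMod t)).next_eq' rfl) hx, K.liftCycles_i _ _ _ _⟩

lemma exists_desc_opcycles (K : Cplx A t) {i : ZMod t} {T : A} (x : K.X (i + 1) ⟶ T)
    (hx : K.d i (i + 1) ≫ x = 0) :
    ∃ y : K.opcycles (i + 1) ⟶ T, K.pOpcycles (i + 1) ≫ y = x :=
  ⟨K.descOpcycles x i ((ComplexShape.up (ZMod t)).prev_eq' rfl) hx, K.p_descOpcycles _ _ _ _⟩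

lemma stalk_comp_d {X : A} {i k l : ZMod t} {T : A}
    (x : T ⟶ ((stalkFunctor A i).obj X).X k) : x ≫ ((stalkFunctor A i).obj X).d k l = 0 := by
  have : ((stalkFunctor A i).obj X).d k l = 0 := single_obj_d _ _ _ _ _
  rw [this, comp_zero]

lemma exists_eq_map_cyclesι {K : Cplx A t} {i : ZMod t} {X : A}
    (g : (stalkFunctor A i).obj X ⟶ K) :
    ∃ f : X ⟶ K.cycles i, (stalkFunctor A i).map f ≫ cyclesι K i = g := by
  obtain ⟨f, hf⟩ := exists_lift_cycles K ((singleObjXSelf _ i X).inv ≫ g.f i) (by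
    rw [Category.assoc, g.comm]
    exact (Category.assoc _ _ _).symm.trans ((congrArg (· ≫ g.f (i + 1))
      (stalk_comp_d (singleObjXSelf _ i X).inv)).trans zero_comp))
  refine ⟨f, from_single_hom_ext ?_⟩
  rw [comp_f, single_map_f_self, Category.assoc, Category.assoc, cyclesι_f, hf,
    Iso.hom_inv_id_assoc]

lemma map_cyclesι_injective (K : Cplx A t) {i : ZMod t} {X : A} {f g : X ⟶ K.cycles i}
    (h : (stalkFunctor A i).map f ≫ cyclesι K i = (stalkFunctor A i).map g ≫ cyclesι K i) :
    f = g := by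
  have h' := congrArg (fun φ => φ.f i) h
  simp only [comp_f, single_map_f_self, Category.assoc, cyclesι_f, cancel_epi, cancel_mono] at h'
  exact h'

lemma exists_eq_opcyclesπ_map {K : Cplx A t} {i : ZMod t} {X : A}
    (g : K ⟶ (stalkFunctor A (i + 1)).obj X) :
    ∃ f : K.opcycles (i + 1) ⟶ X, opcyclesπ K (i + 1) ≫ (stalkFunctor A (i + 1)).map f = g := by
  obtain ⟨f, hf⟩ := exists_desc_opcycles K (g.f (i + 1) ≫ (singleObjXSelf _ (i + 1) X).hom) (by
    rw [← Category.assoc, ← g.comm]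
    exact (congrArg (· ≫ _) (stalk_comp_d _)).trans zero_comp)
  refine ⟨f, to_single_hom_ext ?_⟩
  rw [comp_f, single_map_f_self, ← Category.assoc, ← Category.assoc, opcyclesπ_f, hf,
    Category.assoc, Iso.hom_inv_id, Category.comp_id]

lemma opcyclesπ_map_injective (K : Cplx A t) {i : ZMod t} {X : A} {f g : K.opcycles i ⟶ X}
    (h : opcyclesπ K i ≫ (stalkFunctor A i).map f = opcyclesπ K i ≫ (stalkFunctor A i).map g) :
    f = g := by
  have h' := congrArg (fun φ => φ.f i) h
  simp only [comp_f, single_map_f_self] at h'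
  rw [← Category.assoc, ← Category.assoc, ← Category.assoc, ← Category.assoc, cancel_mono,
    opcyclesπ_f, cancel_epi] at h'
  exact h'

/-- The cycles of an extension of a stalk complex by an acyclic complex. -/
lemma Acyclic.exists_cycles_ses {K L : Cplx A t} (hK : K.Acyclic) {i : ZMod t} {X : A}
    (s : Ses ((stalkFunctor A i).obj X) K L) :
    ∃ s' : Ses X (K.cycles i) (L.cycles i), s'.i ≫ L.iCycles i = K.iCycles i ≫ s.i.f i ∧
      s'.p = L.iCycles i ≫ s.p.f i ≫ (singleObjXSelf _ i X).hom := by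
  have hi := cyclesMap_i s.i i
  have : Mono (s.i.f i) := inferInstanceAs (Mono (s.eval i).i)
  have : Mono (cyclesMap s.i i) := by
    have : Mono (cyclesMap s.i i ≫ L.iCycles i) := by rw [hi]; infer_instance
    exact mono_of_mono _ (L.iCycles i)
  have : Epi (L.iCycles i ≫ s.p.f i ≫ (singleObjXSelf _ i X).hom) := by
    rw [epi_iff_surjective_up_to_refinements]
    intro T x
    obtain ⟨T₁, π₁, hπ₁, l, hl⟩ := surjective_up_to_refinements_of_epi (s.eval i).p
      (x ≫ (singleObjXSelf _ i X).inv)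
    -- The differential of the lift `l` comes from a cycle `k` of `K`. As `K` is acyclic, `k` is
    -- locally a boundary, and subtracting turns `l` into a cycle of `L`.
    obtain ⟨k, hk⟩ := (s.eval (i + 1)).exists_lift (l ≫ L.d i (i + 1)) (by
      rw [Category.assoc, Ses.eval_p, ← s.p.comm, ← Category.assoc]
      exact stalk_comp_d _)
    have hk' : k ≫ K.d (i + 1) (i + 1 + 1) = 0 := by
      rw [← cancel_mono (s.eval (i + 1 + 1)).i, Category.assoc, Ses.eval_i, ← s.i.comm,
        ← Category.assoc]
      refine (congrArg (· ≫ _) hk).trans ?_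
      rw [Category.assoc, L.d_comp_d, comp_zero, zero_comp]
    obtain ⟨T₂, π₂, hπ₂, y, hy⟩ := Acyclic.exists_lift hK k hk'
    obtain ⟨z, hz⟩ := exists_lift_cycles L (π₂ ≫ l - y ≫ s.i.f i) (by
      rw [Preadditive.sub_comp, Category.assoc, Category.assoc, s.i.comm, reassoc_of% hy, ← hk,
        Ses.eval_i, sub_self])
    refine ⟨T₂, π₂ ≫ π₁, epi_comp _ _, z, ?_⟩
    have hw : s.i.f i ≫ s.p.f i = 0 := (s.eval i).w
    rw [reassoc_of% hz, Preadditive.sub_comp, Category.assoc, Category.assoc, Category.assoc,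
      reassoc_of% hw, zero_comp, comp_zero, sub_zero]
    rw [Ses.eval_p] at hl
    rw [← reassoc_of% hl, Iso.inv_hom_id, Category.comp_id]
  refine ⟨Ses.ofLift (cyclesMap s.i i) (L.iCycles i ≫ s.p.f i ≫ (singleObjXSelf _ i X).hom) ?_ ?_,
    hi, rfl⟩
  · have hw : s.i.f i ≫ s.p.f i = 0 := (s.eval i).w
    rw [reassoc_of% hi, reassoc_of% hw, zero_comp, comp_zero]
  · intro T x hx
    obtain ⟨y, hy⟩ := (s.eval i).exists_lift (x ≫ L.iCycles i) (by
      rw [← cancel_mono (singleObjXSelf _ i X).hom, Ses.eval_p, Category.assoc, Category.assoc, hx,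
        zero_comp])
    rw [Ses.eval_i] at hy
    obtain ⟨z, hz⟩ := exists_lift_cycles K y (by
      rw [← cancel_mono (s.eval (i + 1)).i, Category.assoc, Ses.eval_i, ← s.i.comm,
        reassoc_of% hy, L.iCycles_d, comp_zero, zero_comp])
    exact ⟨z, by rw [← cancel_mono (L.iCycles i), Category.assoc, hi, reassoc_of% hz, hy]⟩

/-- The opcycles of an extension of an acyclic complex by a stalk complex. -/
lemma Acyclic.exists_opcycles_ses {K L : Cplx A t} (hK : K.Acyclic) {i : ZMod t} {X : A}
    (s : Ses K ((stalkFunctor A (i + 1 + 1)).obj X) L) :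
    ∃ s' : Ses (K.opcycles (i + 1 + 1)) X (L.opcycles (i + 1 + 1)),
      L.pOpcycles (i + 1 + 1) ≫ s'.p = s.p.f (i + 1 + 1) ≫ K.pOpcycles (i + 1 + 1) ∧
      s'.i = (singleObjXSelf _ (i + 1 + 1) X).inv ≫ s.i.f (i + 1 + 1) ≫
        L.pOpcycles (i + 1 + 1) := by
  have hp := p_opcyclesMap s.p (i + 1 + 1)
  have : Epi (s.p.f (i + 1 + 1)) := inferInstanceAs (Epi (s.eval (i + 1 + 1)).p)
  have : Epi (opcyclesMap s.p (i + 1 + 1)) := by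
    have : Epi (L.pOpcycles (i + 1 + 1) ≫ opcyclesMap s.p (i + 1 + 1)) := by
      rw [hp]; infer_instance
    exact epi_of_epi (L.pOpcycles (i + 1 + 1)) _
  have hw : s.i.f (i + 1 + 1) ≫ s.p.f (i + 1 + 1) = 0 := (s.eval (i + 1 + 1)).w
  have : Mono ((singleObjXSelf _ (i + 1 + 1) X).inv ≫ s.i.f (i + 1 + 1) ≫
      L.pOpcycles (i + 1 + 1)) := by
    -- The goal is a map out of the opcycles that is monic on `X`. The map `l` is monic on `X` but
    -- need not kill boundaries; acyclicity of `K` supplies a correction `y`, after enlarging the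
    -- target, which vanishes on `X`.
    obtain ⟨T₁, s₁, l, hl, -⟩ := (s.eval (i + 1 + 1)).exists_pushout (singleObjXSelf _ (i + 1 + 1) X).hom
    obtain ⟨k, hk⟩ := (s.eval (i + 1)).exists_desc (L.d (i + 1) (i + 1 + 1) ≫ l) (by
      rw [← Category.assoc, Ses.eval_i, s.i.comm]
      refine (congrArg (· ≫ l) ((congrArg (· ≫ s.i.f (i + 1 + 1)) ?_).trans zero_comp)).trans
        zero_comp
      exact single_obj_d _ _ _ _ _)
    have hk' : K.d i (i + 1) ≫ k = 0 := by
      rw [← cancel_epi (s.eval i).p, ← Category.assoc, Ses.eval_p, s.p.comm, Category.assoc]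
      refine (congrArg (_ ≫ ·) hk).trans ?_
      rw [← Category.assoc, L.d_comp_d, comp_zero, zero_comp]
    obtain ⟨T₂, ι, hι, y, hy⟩ := Acyclic.exists_desc hK k hk'
    obtain ⟨z, hz⟩ := exists_desc_opcycles L (i := i + 1) (l ≫ ι - s.p.f (i + 1 + 1) ≫ y) (by
      rw [Preadditive.comp_sub, ← s.p.comm_assoc, hy, ← Category.assoc, ← Category.assoc, ← hk,
        Ses.eval_p, sub_self])
    have hm : ((singleObjXSelf _ (i + 1 + 1) X).inv ≫ s.i.f (i + 1 + 1) ≫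
        L.pOpcycles (i + 1 + 1)) ≫ z = s₁.i ≫ ι := by
      rw [Ses.eval_i] at hl
      rw [Category.assoc, Category.assoc, hz, Preadditive.comp_sub, reassoc_of% hw, zero_comp,
        sub_zero, ← reassoc_of% hl, Iso.inv_hom_id_assoc]
    have : Mono (((singleObjXSelf _ (i + 1 + 1) X).inv ≫ s.i.f (i + 1 + 1) ≫
        L.pOpcycles (i + 1 + 1)) ≫ z) := by rw [hm]; infer_instance
    exact mono_of_mono _ z
  refine ⟨Ses.ofDesc ((singleObjXSelf _ (i + 1 + 1) X).inv ≫ s.i.f (i + 1 + 1) ≫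
    L.pOpcycles (i + 1 + 1)) (opcyclesMap s.p (i + 1 + 1)) ?_ ?_, hp, rfl⟩
  · rw [Category.assoc, Category.assoc, hp, reassoc_of% hw, zero_comp, comp_zero]
  · intro T x hx
    obtain ⟨y, hy⟩ := (s.eval (i + 1 + 1)).exists_desc (L.pOpcycles (i + 1 + 1) ≫ x) (by
      rw [← cancel_epi (singleObjXSelf _ (i + 1 + 1) X).inv, comp_zero]
      simpa only [Category.assoc, Ses.eval_i] using hx)
    rw [Ses.eval_p] at hy
    obtain ⟨z, hz⟩ := exists_desc_opcycles K y (by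
      rw [← cancel_epi (s.eval (i + 1)).p, Ses.eval_p, s.p.comm_assoc, hy, L.d_pOpcycles_assoc,
        zero_comp, comp_zero])
    exact ⟨z, by rw [← cancel_epi (L.pOpcycles (i + 1 + 1)), reassoc_of% hp, hz, hy]⟩

end Acyclic

/-! ### `Ext` between stalk and acyclic complexes -/

section Acyclic

open HomologicalComplex

attribute [local instance] HasExt.standard

variable {A : Type u} [Category.{v} A] [Abelian A] {t : ℕ}

/-- The homomorphism `Ext¹(X, Zⁱ K) ⟶ Ext¹(U_{X,i}, K)`. -/
def extStalkCycles (X : A) (K : Cplx A t) (i : ZMod t) :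
    Abelian.Ext.{max u v} X (K.cycles i) 1 →+
      Abelian.Ext.{max u v} ((stalkFunctor A i).obj X) K 1 where
  toFun a := (a.mapExactFunctor (stalkFunctor A i)).comp (Ext.mk₀ (cyclesι K i)) (add_zero 1)
  map_zero' := by rw [Ext.mapExactFunctor_zero, Ext.zero_comp]
  map_add' a b := by rw [Ext.mapExactFunctor_add, Ext.add_comp]

/-- The homomorphism `Ext¹(Kⁱ / Bⁱ, X) ⟶ Ext¹(K, U_{X,i})`. -/
def extOpcyclesStalk (X : A) (K : Cplx A t) (i : ZMod t) :
    Abelian.Ext.{max u v} (K.opcycles i) X 1 →+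
      Abelian.Ext.{max u v} K ((stalkFunctor A i).obj X) 1 where
  toFun a := (Ext.mk₀ (opcyclesπ K i)).comp (a.mapExactFunctor (stalkFunctor A i)) (zero_add 1)
  map_zero' := by rw [Ext.mapExactFunctor_zero, Ext.comp_zero]
  map_add' a b := by rw [Ext.mapExactFunctor_add, Ext.comp_add]

/-- If the image class vanishes, the inclusion of the cycles extends over the stalk complex of the
middle term. A morphism from a stalk complex factors through the cycles, so the extension gives a
retraction of `s.i`. -/
lemma extStalkCycles_injective (X : A) (K : Cplx A t) (i : ZMod t) :
    Function.Injective (extStalkCycles X K i) := by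
  rw [injective_iff_map_eq_zero]
  intro a ha
  obtain ⟨W, s, rfl⟩ := Ses.exists_cls a
  have ha : (s.cls.mapExactFunctor (stalkFunctor A i)).comp (Ext.mk₀ (cyclesι K i))
    (add_zero 1) = 0 := ha
  rw [← Ses.cls_mapFunctor] at ha
  obtain ⟨r, hr⟩ := Ext.contravariant_sequence_exact₁ (s.mapFunctor (stalkFunctor A i)).exact K _
    (add_zero 1) ha
  obtain ⟨r, rfl⟩ := (Ext.mk₀_bijective _ _).2 r
  obtain ⟨f, rfl⟩ := exists_eq_map_cyclesι r
  rw [Ext.mk₀_comp_mk₀] at hr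
  have h1 := (Ext.mk₀_bijective _ _).1 hr
  have h2 : s.i ≫ f = 𝟙 _ := by
    apply map_cyclesι_injective K (i := i)
    rw [Functor.map_comp, CategoryTheory.Functor.map_id, Category.id_comp, Category.assoc]
    exact h1
  rw [← Ext.comp_mk₀_id s.cls, ← h2, ← Ext.mk₀_comp_mk₀, ← Ext.comp_assoc_of_third_deg_zero,
    s.cls_comp, Ext.zero_comp]

lemma extOpcyclesStalk_injective (X : A) (K : Cplx A t) (i : ZMod t) :
    Function.Injective (extOpcyclesStalk X K (i + 1)) := by
  rw [injective_iff_map_eq_zero]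
  intro a ha
  obtain ⟨W, s, rfl⟩ := Ses.exists_cls a
  have ha : (Ext.mk₀ (opcyclesπ K (i + 1))).comp (s.cls.mapExactFunctor (stalkFunctor A (i + 1)))
    (zero_add 1) = 0 := ha
  rw [← Ses.cls_mapFunctor] at ha
  obtain ⟨r, hr⟩ := Ext.covariant_sequence_exact₃ K (s.mapFunctor (stalkFunctor A (i + 1))).exact _
    (zero_add 1) ha
  obtain ⟨r, rfl⟩ := (Ext.mk₀_bijective _ _).2 r
  obtain ⟨f, rfl⟩ := exists_eq_opcyclesπ_map r
  rw [Ext.mk₀_comp_mk₀] at hr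
  have h1 := (Ext.mk₀_bijective _ _).1 hr
  have h2 : f ≫ s.p = 𝟙 _ := by
    apply opcyclesπ_map_injective K (i := i + 1)
    rw [Functor.map_comp, CategoryTheory.Functor.map_id, Category.comp_id, ← Category.assoc]
    exact h1
  rw [← Ext.mk₀_id_comp s.cls, ← h2, ← Ext.mk₀_comp_mk₀,
    Ext.comp_assoc (h₁₂ := zero_add 0) (h₂₃ := zero_add 1) (h := rfl), s.comp_cls, Ext.comp_zero]

/-- An extension of a stalk complex by an acyclic complex is the pushout of the extension of cycles
it induces; acyclicity keeps the sequence of cycles exact. -/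
lemma extStalkCycles_surjective (X : A) {K : Cplx A t} (hK : K.Acyclic) (i : ZMod t) :
    Function.Surjective (extStalkCycles X K i) := by
  intro e
  obtain ⟨L, s, rfl⟩ := Ses.exists_cls e
  obtain ⟨s', h1, h2⟩ := Acyclic.exists_cycles_ses hK s
  refine ⟨s'.cls, ?_⟩
  have h := (s'.mapFunctor (stalkFunctor A i)).cls_naturality s (𝟙 _) (cyclesι K i)
    ((stalkFunctor A i).map (𝟙 _) ≫ cyclesι L i) ?_ ?_
  · rw [Ext.mk₀_id_comp, Ses.cls_mapFunctor] at h
    exact h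
  · rw [CategoryTheory.Functor.map_id, Category.id_comp]
    refine from_single_hom_ext ((cancel_epi (singleObjXSelf _ i _).inv).1 ?_)
    rw [comp_f, comp_f, ← Category.assoc, cyclesι_f, ← h1]
    refine Eq.symm ((congrArg ((singleObjXSelf _ i _).inv ≫ · ≫ (cyclesι L i).f i)
      (single_map_f_self _ i s'.i)).trans ?_)
    rw [Category.assoc, Category.assoc, cyclesι_f, Iso.inv_hom_id_assoc]
  · rw [CategoryTheory.Functor.map_id, Category.id_comp, Category.comp_id]
    refine from_single_hom_ext ((cancel_epi (singleObjXSelf _ i _).inv).1 ?_)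
    rw [comp_f, ← Category.assoc, cyclesι_f]
    refine Eq.symm ((congrArg ((singleObjXSelf _ i _).inv ≫ ·)
      (single_map_f_self _ i s'.p)).trans ?_)
    rw [Iso.inv_hom_id_assoc, h2, Category.assoc, Category.assoc, Iso.hom_inv_id, Category.comp_id]

/-- The dual statement: the extension is pulled back from the sequence of opcycles. -/
lemma extOpcyclesStalk_surjective (X : A) {K : Cplx A t} (hK : K.Acyclic) (i : ZMod t) :
    Function.Surjective (extOpcyclesStalk X K i) := by
  obtain ⟨i, rfl⟩ : ∃ j, i = j + 1 + 1 := ⟨i - 1 - 1, by ring⟩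
  intro e
  obtain ⟨L, s, rfl⟩ := Ses.exists_cls e
  obtain ⟨s', h1, h2⟩ := Acyclic.exists_opcycles_ses hK s
  refine ⟨s'.cls, ?_⟩
  have h := s.cls_naturality (s'.mapFunctor (stalkFunctor A (i + 1 + 1))) (opcyclesπ K (i + 1 + 1))
    (𝟙 _) (opcyclesπ L (i + 1 + 1)) ?_ ?_
  · rw [Ext.comp_mk₀_id, Ses.cls_mapFunctor] at h
    exact h.symm
  · rw [Category.id_comp]
    refine to_single_hom_ext ((cancel_mono (singleObjXSelf _ (i + 1 + 1) _).hom).1 ?_)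
    rw [comp_f, Category.assoc, opcyclesπ_f]
    refine ((congrArg (· ≫ (singleObjXSelf _ (i + 1 + 1) _).hom)
      (single_map_f_self _ (i + 1 + 1) s'.i)).trans ?_)
    rw [Category.assoc, Category.assoc, Iso.inv_hom_id, Category.comp_id, h2,
      Iso.hom_inv_id_assoc]
  · refine to_single_hom_ext ((cancel_mono (singleObjXSelf _ (i + 1 + 1) _).hom).1 ?_)
    rw [comp_f, comp_f, Category.assoc, Category.assoc, opcyclesπ_f, ← h1]
    refine ((congrArg ((opcyclesπ L (i + 1 + 1)).f (i + 1 + 1) ≫ · ≫ (singleObjXSelf _ (i + 1 + 1) _).hom)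
      (single_map_f_self _ (i + 1 + 1) s'.p)).trans ?_)
    rw [Category.assoc, Category.assoc, Iso.inv_hom_id, Category.comp_id, ← opcyclesπ_f L,
      Category.assoc]

lemma card_hom_stalk (X : A) (K : Cplx A t) (i : ZMod t) :
    Nat.card ((stalkFunctor A i).obj X ⟶ K) = Nat.card (X ⟶ K.cycles i) :=
  (Nat.card_congr (Equiv.ofBijective (fun f => (stalkFunctor A i).map f ≫ cyclesι K i)
    ⟨fun _ _ h => map_cyclesι_injective K h, fun g => exists_eq_map_cyclesι g⟩)).symm

lemma card_hom_to_stalk (X : A) (K : Cplx A t) (i : ZMod t) :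
    Nat.card (K ⟶ (stalkFunctor A i).obj X) = Nat.card (K.opcycles i ⟶ X) := by
  obtain ⟨i, rfl⟩ : ∃ j, i = j + 1 := ⟨i - 1, by ring⟩
  exact (Nat.card_congr (Equiv.ofBijective
    (fun f => opcyclesπ K (i + 1) ≫ (stalkFunctor A (i + 1)).map f)
    ⟨fun _ _ h => opcyclesπ_map_injective K h, fun g => exists_eq_opcyclesπ_map g⟩)).symm

lemma euler_stalk (X : A) {K : Cplx A t} (hK : K.Acyclic) (i : ZMod t) :
    euler ((stalkFunctor A i).obj X) K = euler X (K.cycles i) := by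
  rw [euler, euler, card_hom_stalk, Nat.card_congr (Equiv.ofBijective _
    ⟨extStalkCycles_injective X K i, extStalkCycles_surjective X hK i⟩)]

lemma euler_to_stalk (X : A) {K : Cplx A t} (hK : K.Acyclic) (i : ZMod t) :
    euler K ((stalkFunctor A i).obj X) = euler (K.opcycles i) X := by
  rw [euler, euler, card_hom_to_stalk, Nat.card_congr (Equiv.ofBijective _
    ⟨?_, extOpcyclesStalk_surjective X hK i⟩)]
  obtain ⟨i, rfl⟩ : ∃ j, i = j + 1 := ⟨i - 1, by ring⟩
  exact extOpcyclesStalk_injective X K i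

lemma Acyclic.epi_toCycles {K : Cplx A t} (hK : K.Acyclic) (i : ZMod t) :
    Epi (K.toCycles i (i + 1)) := by
  rw [epi_iff_surjective_up_to_refinements]
  intro T x
  obtain ⟨T', π, hπ, y, hy⟩ := Acyclic.exists_lift hK (x ≫ K.iCycles (i + 1)) (by
    rw [Category.assoc, K.iCycles_d, comp_zero])
  exact ⟨T', π, hπ, y, by
    rw [← cancel_mono (K.iCycles (i + 1)), Category.assoc, Category.assoc, K.toCycles_i, hy]⟩

lemma Acyclic.mono_fromOpcycles {K : Cplx A t} (hK : K.Acyclic) (i : ZMod t) :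
    Mono (K.fromOpcycles i (i + 1)) := by
  obtain ⟨i, rfl⟩ : ∃ j, i = j + 1 := ⟨i - 1, by ring⟩
  obtain ⟨T', ι, hι, y, hy⟩ := Acyclic.exists_desc hK (K.pOpcycles (i + 1)) (K.d_pOpcycles _ _)
  have h : K.fromOpcycles (i + 1) (i + 1 + 1) ≫ y = ι := by
    rw [← cancel_epi (K.pOpcycles (i + 1)), K.p_fromOpcycles_assoc, hy]
  have : Mono (K.fromOpcycles (i + 1) (i + 1 + 1) ≫ y) := by rw [h]; exact hι
  exact mono_of_mono _ y

section

variable [Hereditary A]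

/-- Covariant right exactness of `Ext¹`. -/
lemma exists_ext_comp_epi {X Y Z : A} (p : Y ⟶ Z) [Epi p] (a : Abelian.Ext.{max u v} X Z 1) :
    ∃ b : Abelian.Ext.{max u v} X Y 1, b.comp (Ext.mk₀ p) (add_zero 1) = a :=
  Ext.covariant_sequence_exact₃ X (Ses.ker p).exact a rfl (Hereditary.ext_eq_zero _ _ 2 le_rfl _)

lemma exists_ext_mono_comp {X Y Z : A} (i : X ⟶ Y) [Mono i] (a : Abelian.Ext.{max u v} X Z 1) :
    ∃ b : Abelian.Ext.{max u v} Y Z 1, (Ext.mk₀ i).comp b (zero_add 1) = a :=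
  Ext.contravariant_sequence_exact₁ (Ses.coker i).exact Z a rfl
    (Hereditary.ext_eq_zero _ _ 2 le_rfl _)

/-- Dimension shift along `twoTermSes`: the class is the connecting class times a class `e'` of
degree 1 on the stalk in degree `i + 1`. The latter is a class from `X` to the cycles in degree `i +
1`, and heredity lifts it to the term of `K` in degree `i`. The lift yields an extension of `e'` to
`twoTerm`, so its product with the connecting class vanishes. -/
lemma ext_stalk_eq_zero (X : A) {K : Cplx A t} (hK : K.Acyclic) (i : ZMod t)
    (e : Abelian.Ext.{max u v} ((stalkFunctor A i).obj X) K 2) : e = 0 := by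
  have h : (Ext.mk₀ (twoTermSes X i).p).comp e (zero_add 2) = 0 := ext_twoTerm_eq_zero _ _ _ _
  obtain ⟨e', rfl⟩ := Ext.contravariant_sequence_exact₃ (twoTermSes X i).exact K e h one_add_one_eq_two
  obtain ⟨a, rfl⟩ := extStalkCycles_surjective X hK (i + 1) e'
  have := Acyclic.epi_toCycles hK i
  obtain ⟨b, rfl⟩ := exists_ext_comp_epi (K.toCycles i (i + 1)) a
  let f : Abelian.Ext.{max u v} ((twoTerm A i).obj X) K 1 :=
    (b.mapExactFunctor (twoTerm A i)).comp (Ext.mk₀ (twoTermDesc (𝟙 (K.X i)))) (add_zero 1)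
  have hf : (Ext.mk₀ (twoTermSes X i).i).comp f (zero_add 1) =
      extStalkCycles X K (i + 1) (b.comp (Ext.mk₀ (K.toCycles i (i + 1))) (add_zero 1)) := by
    have h1 : (stalkToTwoTerm A i).app (K.X i) ≫ twoTermDesc (𝟙 (K.X i)) =
        (stalkFunctor A (i + 1)).map (K.toCycles i (i + 1)) ≫ cyclesι K (i + 1) := by
      refine from_single_hom_ext ((cancel_epi (singleObjXSelf _ (i + 1) _).inv).1 ?_)
      rw [comp_f, comp_f, single_map_f_self, Category.assoc, Category.assoc, cyclesι_f,
        Iso.inv_hom_id_assoc, K.toCycles_i, ← Category.assoc]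
      change twoTermInr (K.X i) i ≫ _ = _
      rw [← twoTermInl_d, Category.assoc, ← Hom.comm, ← Category.assoc, twoTermDesc_f,
        Category.id_comp]
    change (Ext.mk₀ ((stalkToTwoTerm A i).app X)).comp (Ext.comp _ _ _) _ = Ext.comp _ _ (add_zero 1)
    rw [← Ext.comp_assoc_of_third_deg_zero, ← mapExactFunctor_naturality,
      Ext.comp_assoc_of_third_deg_zero, Ext.mk₀_comp_mk₀, h1, Ext.mapExactFunctor_comp,
      Ext.mapExactFunctor_mk₀, Ext.comp_assoc_of_third_deg_zero, Ext.mk₀_comp_mk₀]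
  rw [← hf]
  exact (twoTermSes X i).exact.extClass_comp_assoc f

/-- Dual to `ext_stalk_eq_zero`: opcycles embed in the next term, and heredity extends the class to
that term. -/
lemma ext_to_stalk_eq_zero (X : A) {K : Cplx A t} (hK : K.Acyclic) (i : ZMod t)
    (e : Abelian.Ext.{max u v} K ((stalkFunctor A i).obj X) 2) : e = 0 := by
  obtain ⟨i, rfl⟩ : ∃ j, i = j + 1 := ⟨i - 1, by ring⟩
  have h : e.comp (Ext.mk₀ (twoTermSes X i).i) (add_zero 2) = 0 := ext_to_twoTerm_eq_zero _ _ _ _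
  obtain ⟨e', rfl⟩ := Ext.covariant_sequence_exact₁ K (twoTermSes X i).exact e h one_add_one_eq_two
  obtain ⟨a, rfl⟩ := extOpcyclesStalk_surjective X hK i e'
  have := Acyclic.mono_fromOpcycles hK i
  obtain ⟨b, rfl⟩ := exists_ext_mono_comp (K.fromOpcycles i (i + 1)) a
  let f : Abelian.Ext.{max u v} K ((twoTerm A i).obj X) 1 :=
    (Ext.mk₀ (twoTermLift (𝟙 (K.X (i + 1))))).comp (b.mapExactFunctor (twoTerm A i)) (zero_add 1)
  have hf : f.comp (Ext.mk₀ (twoTermSes X i).p) (add_zero 1) =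
      extOpcyclesStalk X K i ((Ext.mk₀ (K.fromOpcycles i (i + 1))).comp b (zero_add 1)) := by
    have h1 : twoTermLift (𝟙 (K.X (i + 1))) ≫ (twoTermToStalk A i).app (K.X (i + 1)) =
        opcyclesπ K i ≫ (stalkFunctor A i).map (K.fromOpcycles i (i + 1)) := by
      refine to_single_hom_ext ((cancel_mono (singleObjXSelf _ i _).hom).1 ?_)
      rw [comp_f, comp_f, single_map_f_self]
      simp only [Category.assoc]
      rw [reassoc_of% opcyclesπ_f K i, Iso.inv_hom_id, Category.comp_id, K.p_fromOpcycles]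
      change _ ≫ twoTermFst (K.X (i + 1)) i = _
      rw [← twoTerm_d_snd, Hom.comm_assoc, twoTermLift_f, Category.comp_id]
    change Ext.comp (Ext.comp _ _ _) (Ext.mk₀ ((twoTermToStalk A i).app X)) _ =
      Ext.comp _ _ (zero_add 1)
    rw [Ext.comp_assoc_of_third_deg_zero, mapExactFunctor_naturality,
      ← Ext.comp_assoc_of_second_deg_zero, Ext.mk₀_comp_mk₀, h1, Ext.mapExactFunctor_comp,
      Ext.mapExactFunctor_mk₀, ← Ext.comp_assoc_of_second_deg_zero, Ext.mk₀_comp_mk₀]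
  rw [← hf, Ext.comp_assoc_of_second_deg_zero]
  exact (congrArg (fun x => f.comp x one_add_one_eq_two) (twoTermSes X i).comp_cls).trans
    (Ext.comp_zero ..)

end

end Acyclic

/-! ### The Grothendieck group and the bilinear Euler form -/

section Grothendieck

attribute [local instance] HasExt.standard

variable {A : Type u} [Category.{v} A] [Abelian A]

lemma Ses.k0_cls_eq {X Y Z : A} (s : Ses Z X Y) : K0.cls Y = K0.cls X + K0.cls Z :=
  K0.cls_eq s.exact

lemma K0.cls_zero : K0.cls (0 : A) = 0 := by
  have h1 := (Ses.ofLift (A := (0 : A)) (C := 0) (B := 0) 0 0 (by simp)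
    (fun T x _ => ⟨x, (isZero_zero A).eq_of_tgt _ _⟩)).k0_cls_eq
  simpa using h1

lemma K0.cls_iso {X Y : A} (e : X ≅ Y) : K0.cls X = K0.cls Y := by
  have h1 := (Ses.ofLift (A := (0 : A)) e.hom 0 (by simp)
    (fun T x _ => ⟨x ≫ e.inv, by simp⟩)).k0_cls_eq
  rw [h1, K0.cls_zero, add_zero]

/-- The universal property of the Grothendieck group. -/
def K0.lift {G : Type*} [AddCommGroup G] (f : A → G)
    (hf : ∀ X Y Z : A, Ses Z X Y → f Y = f X + f Z) : K0 A →+ G :=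
  QuotientAddGroup.lift (K0.rel A) (FreeAbelianGroup.lift f) (by
    rw [K0.rel, AddSubgroup.closure_le]
    rintro _ ⟨S, hS, rfl⟩
    have h := hf _ _ _ (Ses.mk S.f S.g S.zero hS)
    simp [h])

@[simp] lemma K0.lift_cls {G : Type*} [AddCommGroup G] (f : A → G)
    (hf : ∀ X Y Z : A, Ses Z X Y → f Y = f X + f Z) (X : A) : K0.lift f hf (K0.cls X) = f X :=
  FreeAbelianGroup.lift_apply_of f X

lemma K0.hom_ext {G : Type*} [AddCommGroup G] {f g : K0 A →+ G}
    (h : ∀ X, f (K0.cls X) = g (K0.cls X)) : f = g :=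
  QuotientAddGroup.addMonoidHom_ext _ (FreeAbelianGroup.lift_ext _ _ h)

variable [FiniteHomExt A] [Hereditary A]

/-- The multiplicative Euler form as a unit. -/
def eulerUnit (X Y : A) : Additive ℚˣ := Additive.ofMul (Units.mk0 (euler X Y) (euler_ne_zero X Y))

/-- The multiplicative Euler form, extended in the second variable. -/
def eulerLeft (X : A) : K0 A →+ Additive ℚˣ :=
  K0.lift (eulerUnit X)
    (fun _ _ _ s => Units.ext (s.euler_covariant X (Hereditary.ext_eq_zero _ _ 2 le_rfl)))

lemma eulerLeft_cls (X Y : A) : eulerLeft X (K0.cls Y) = eulerUnit X Y := K0.lift_cls _ _ _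

/-- The bilinear extension of the multiplicative Euler form. -/
def eulerForm : K0 A →+ K0 A →+ Additive ℚˣ :=
  K0.lift eulerLeft (fun _ _ _ s => K0.hom_ext fun Y => by
    rw [AddMonoidHom.add_apply, eulerLeft_cls, eulerLeft_cls, eulerLeft_cls]
    exact Units.ext (s.euler_contravariant Y (Hereditary.ext_eq_zero _ _ 2 le_rfl)))

/-- The value of the bilinear extension of the multiplicative Euler form. -/
def chi (α β : K0 A) : ℚ := ((eulerForm α β).toMul : ℚˣ)

lemma chi_cls (X Y : A) : chi (K0.cls X) (K0.cls Y) = euler X Y := by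
  rw [chi, eulerForm, K0.lift_cls, eulerLeft_cls]
  rfl

lemma chi_ne_zero (α β : K0 A) : chi α β ≠ 0 := Units.ne_zero _

lemma chi_add_left (α α' β : K0 A) : chi (α + α') β = chi α β * chi α' β := by
  simp [chi]

lemma chi_add_right (α β β' : K0 A) : chi α (β + β') = chi α β * chi α β' := by
  simp [chi]

lemma chi_zero_left (β : K0 A) : chi 0 β = 1 := by simp [chi]
lemma chi_zero_right (α : K0 A) : chi α 0 = 1 := by simp [chi]

end Grothendieck

/-! ### Complexes with zero differential, and the Euler form with acyclic complexes -/

section ZeroDiff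

open HomologicalComplex

attribute [local instance] HasExt.standard

variable {A : Type u} [Category.{v} A] [Abelian A] {t : ℕ}

/-- The complex with the given terms and with zero differential. -/
def zeroCplx (h : ZMod t → A) : Cplx A t where
  X := h
  d _ _ := 0

/-- The image of the differential in degree `i`. -/
abbrev bd (M : Cplx A t) (i : ZMod t) : A := Limits.image (M.d i (i + 1))

/-- The classes of the terms. -/
def dimv (M : Cplx A t) (i : ZMod t) : K0 A := K0.cls (M.X i)

/-- The classes of the images of the differentials. -/
def imv (M : Cplx A t) (i : ZMod t) : K0 A := K0.cls (bd M i)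

/-- Cycles and boundaries of a complex. -/
def cyclesSes (M : Cplx A t) (i : ZMod t) : Ses (bd M i) (M.cycles i) (M.X i) :=
  Ses.ofLift (M.iCycles i) (factorThruImage (M.d i (i + 1)))
    (by rw [← cancel_mono (Limits.image.ι (M.d i (i + 1))), Category.assoc, Limits.image.fac,
      M.iCycles_d, zero_comp])
    (fun T x hx => exists_lift_cycles M x (by
      rw [← Limits.image.fac (M.d i (i + 1)), reassoc_of% hx, zero_comp]))

/-- The short exact sequence of the cycles and the boundaries. -/
def zeroCplxSes (M : Cplx A t) : Ses (zeroCplx (bd M)) (zeroCplx fun i => M.cycles i) M :=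
  Ses.mk { f := fun i => M.iCycles i, comm' := fun i j _ => by simp [zeroCplx] }
    { f := fun i => factorThruImage (M.d i (i + 1))
      comm' := fun i j _ => by
        refine comp_zero.trans (Eq.symm ?_)
        have h : M.d i j ≫ factorThruImage (M.d j (j + 1)) = 0 := by
          rw [← cancel_mono (Limits.image.ι (M.d j (j + 1))), Category.assoc, Limits.image.fac,
            M.d_comp_d, zero_comp]
        exact h }
    (by ext i : 1; exact (cyclesSes M i).w)
    (by
      rw [HomologicalComplex.shortExact_iff_degreewise_shortExact]
      exact fun i => (cyclesSes M i).exact)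

lemma Acyclic.cls_cycles {K : Cplx A t} (hK : K.Acyclic) (i : ZMod t) :
    K0.cls (K.cycles (i + 1)) = imv K i := by
  have := Acyclic.epi_toCycles hK i
  have : StrongEpi (K.toCycles i (i + 1)) := strongEpi_of_epi _
  exact K0.cls_iso (image.isoStrongEpiMono (K.toCycles i (i + 1)) (K.iCycles (i + 1))
    (K.toCycles_i i (i + 1)))

lemma Acyclic.cls_opcycles {K : Cplx A t} (hK : K.Acyclic) (i : ZMod t) :
    K0.cls (K.opcycles i) = imv K i := by
  have := Acyclic.mono_fromOpcycles hK i
  have : StrongEpi (K.pOpcycles i) := strongEpi_of_epi _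
  exact K0.cls_iso (image.isoStrongEpiMono (K.pOpcycles i) (K.fromOpcycles i (i + 1))
    (K.p_fromOpcycles i (i + 1)))

/-- The projection to a term. -/
def zeroCplxπ (h : ZMod t → A) (i : ZMod t) : zeroCplx h ⟶ (stalkFunctor A i).obj (h i) :=
  mkHomToSingle (K := zeroCplx h) (j := i) (𝟙 (h i)) fun _ _ => zero_comp

/-- The inclusion of a term. -/
def zeroCplxι (h : ZMod t → A) (i : ZMod t) : (stalkFunctor A i).obj (h i) ⟶ zeroCplx h :=
  mkHomFromSingle (K := zeroCplx h) (j := i) (𝟙 (h i)) fun _ _ => comp_zero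

lemma zeroCplxπ_f (h : ZMod t → A) (i : ZMod t) :
    (zeroCplxπ h i).f i = (singleObjXSelf (ComplexShape.up (ZMod t)) i (h i)).inv :=
  (mkHomToSingle_f _ _).trans (Category.id_comp _)

lemma zeroCplxι_f (h : ZMod t → A) (i : ZMod t) :
    (zeroCplxι h i).f i = (singleObjXSelf (ComplexShape.up (ZMod t)) i (h i)).hom :=
  (mkHomFromSingle_f _ _).trans (Category.comp_id _)

variable [NeZero t]

/-- A complex with zero differential is a direct sum of stalk complexes. -/
def zeroCplxBicone (h : ZMod t → A) : Bicone fun i => (stalkFunctor A i).obj (h i) where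
  pt := zeroCplx h
  π := zeroCplxπ h
  ι := zeroCplxι h
  ι_π i j := by
    split_ifs with hij
    · subst hij
      refine from_single_hom_ext ?_
      rw [comp_f, zeroCplxπ_f, zeroCplxι_f]
      exact Iso.hom_inv_id _
    · exact from_single_hom_ext ((isZero_single_X _ hij).eq_of_tgt _ _)

lemma zeroCplx_total (h : ZMod t → A) : ∑ i, zeroCplxπ h i ≫ zeroCplxι h i = 𝟙 _ := by
  refine HomologicalComplex.hom_ext _ _ fun j => ?_
  have hs : (∑ i, zeroCplxπ h i ≫ zeroCplxι h i).f j = ∑ i, (zeroCplxπ h i ≫ zeroCplxι h i).f j :=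
    map_sum (Hom.fAddMonoidHom (C₁ := zeroCplx h) (C₂ := zeroCplx h) j) _ _
  rw [hs, Finset.sum_eq_single j]
  · rw [comp_f, zeroCplxπ_f, zeroCplxι_f]
    exact Iso.inv_hom_id _
  · intro i _ hij
    rw [comp_f, (isZero_single_X (h i) (Ne.symm hij)).eq_of_tgt ((zeroCplxπ h i).f j) 0, zero_comp]
  · exact fun h => absurd (Finset.mem_univ _) h

def zeroCplxBicone_isBilimit (h : ZMod t → A) : (zeroCplxBicone h).IsBilimit :=
  isBilimitOfTotal _ (zeroCplx_total h)

lemma euler_zeroCplx (h : ZMod t → A) (K : Cplx A t) :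
    euler (zeroCplx h) K = ∏ i, euler ((stalkFunctor A i).obj (h i)) K := by
  simp_rw [euler_eq_div]
  rw [Finset.prod_div_distrib, ← Nat.cast_prod, ← Nat.cast_prod, ← Nat.card_pi, ← Nat.card_pi,
    ← Nat.card_congr (Ext.biproductAddEquiv (zeroCplxBicone_isBilimit h) K 0).toEquiv,
    ← Nat.card_congr (Ext.biproductAddEquiv (zeroCplxBicone_isBilimit h) K 1).toEquiv]
  rfl

lemma euler_to_zeroCplx (h : ZMod t → A) (K : Cplx A t) :
    euler K (zeroCplx h) = ∏ i, euler K ((stalkFunctor A i).obj (h i)) := by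
  simp_rw [euler_eq_div]
  rw [Finset.prod_div_distrib, ← Nat.cast_prod, ← Nat.cast_prod, ← Nat.card_pi, ← Nat.card_pi,
    ← Nat.card_congr (Ext.addEquivBiproduct K (zeroCplxBicone_isBilimit h) 0).toEquiv,
    ← Nat.card_congr (Ext.addEquivBiproduct K (zeroCplxBicone_isBilimit h) 1).toEquiv]
  rfl

variable [Hereditary A]

lemma ext_zeroCplx_eq_zero (h : ZMod t → A) {K : Cplx A t} (hK : K.Acyclic)
    (e : Abelian.Ext.{max u v} (zeroCplx h) K 2) : e = 0 := by
  refine (Ext.biproductAddEquiv (zeroCplxBicone_isBilimit h) K 2).injective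
    (Eq.trans (funext fun i => ?_) (map_zero _).symm)
  exact ext_stalk_eq_zero _ hK i _

lemma ext_to_zeroCplx_eq_zero (h : ZMod t → A) {K : Cplx A t} (hK : K.Acyclic)
    (e : Abelian.Ext.{max u v} K (zeroCplx h) 2) : e = 0 := by
  refine (Ext.addEquivBiproduct K (zeroCplxBicone_isBilimit h) 2).injective
    (Eq.trans (funext fun i => ?_) (map_zero _).symm)
  exact ext_to_stalk_eq_zero _ hK i _

/-- `Ext²(M, K)` vanishes for acyclic `K`. -/
lemma ext_acyclic_eq_zero (M : Cplx A t) {K : Cplx A t} (hK : K.Acyclic)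
    (e : Abelian.Ext.{max u v} M K 2) : e = 0 := by
  -- `M` is an extension of its boundaries by its cycles, two complexes with zero differential,
  -- hence finite sums of stalks.
  obtain ⟨e', rfl⟩ := Ext.contravariant_sequence_exact₂ (zeroCplxSes M).exact K e
    (ext_zeroCplx_eq_zero _ hK _)
  rw [ext_zeroCplx_eq_zero _ hK e']
  exact Ext.comp_zero ..

variable [FiniteHomExt A]

/-- The scalar by which the classes of acyclic complexes with boundaries `β` are moved past
complexes with terms of class `d`. -/
def twist (d β : ZMod t → K0 A) : ℚ := ∏ i, (chi (d (i + 1)) (β i))⁻¹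

/-- The scalar for the opposite order. -/
def cotwist (β d : ZMod t → K0 A) : ℚ := ∏ i, (chi (β i) (d i))⁻¹

/-- The Euler form is multiplicative along cycles and boundaries of `M`, which reduces it to stalks.
A stalk in degree `i + 1` sees the cycles of `K` in that degree, that is the image of the
differential from degree `i`; hence the index shift in `twist`. -/
lemma euler_acyclic (M : Cplx A t) {K : Cplx A t} (hK : K.Acyclic) :
    (euler M K)⁻¹ = twist (dimv M) (imv K) := by
  rw [(zeroCplxSes M).euler_contravariant K (ext_zeroCplx_eq_zero _ hK), euler_zeroCplx,
    euler_zeroCplx, ← Finset.prod_mul_distrib, twist, ← Finset.prod_inv_distrib,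
    ← Equiv.prod_comp (Equiv.addRight (1 : ZMod t))]
  refine Finset.prod_congr rfl fun i _ => ?_
  rw [Equiv.coe_addRight, euler_stalk _ hK, euler_stalk _ hK, ← Acyclic.cls_cycles hK i, dimv,
    chi_cls, (cyclesSes M (i + 1)).euler_contravariant _ (Hereditary.ext_eq_zero _ _ 2 le_rfl)]

/-- On this side a stalk in degree `i` sees the opcycles of `K`, which are isomorphic to the image
of the differential out of degree `i`; so `cotwist` has no index shift. -/
lemma euler_acyclic_zeroCplx (h : ZMod t → A) {K : Cplx A t} (hK : K.Acyclic) :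
    (euler K (zeroCplx h))⁻¹ = cotwist (imv K) (dimv (zeroCplx h)) := by
  rw [euler_to_zeroCplx, cotwist, ← Finset.prod_inv_distrib]
  refine Finset.prod_congr rfl fun i _ => ?_
  rw [euler_to_stalk _ hK, ← Acyclic.cls_opcycles hK i, dimv, chi_cls]
  rfl

end ZeroDiff

/-! ### Types of complexes -/

section Types

open HomologicalComplex

variable {A : Type u} [Category.{v} A] [Abelian A] {t : ℕ}

lemma Acyclic.isZero_homology {K : Cplx A t} (hK : K.Acyclic) (i : ZMod t) :
    IsZero (K.homology i) :=
  (hK i).isZero_homology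

/-- The homology of an extension by an acyclic subcomplex. -/
lemma Ses.nonempty_homology_iso_of_acyclic_sub {M K L : Cplx A t} (s : Ses M K L) (hK : K.Acyclic)
    (i : ZMod t) : Nonempty (L.homology i ≅ M.homology i) := by
  have h₁ : Mono (homologyMap s.p i) :=
    (s.exact.homology_exact₂ i).mono_g ((Acyclic.isZero_homology hK i).eq_of_src _ _)
  have h₂ : Epi (homologyMap s.p i) :=
    (s.exact.homology_exact₃ i (i + 1) rfl).epi_f ((Acyclic.isZero_homology hK _).eq_of_tgt _ _)
  have := isIso_of_mono_of_epi (homologyMap s.p i)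
  exact ⟨asIso (homologyMap s.p i)⟩

/-- The homology of an extension of an acyclic complex. -/
lemma Ses.nonempty_homology_iso_of_acyclic_quot {M K L : Cplx A t} (s : Ses K M L) (hK : K.Acyclic)
    (i : ZMod t) : Nonempty (L.homology i ≅ M.homology i) := by
  obtain ⟨i, rfl⟩ : ∃ j, i = j + 1 := ⟨i - 1, by ring⟩
  have h₁ : Mono (homologyMap s.i (i + 1)) :=
    (s.exact.homology_exact₁ i (i + 1) rfl).mono_g ((Acyclic.isZero_homology hK _).eq_of_src _ _)
  have h₂ : Epi (homologyMap s.i (i + 1)) :=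
    (s.exact.homology_exact₂ (i + 1)).epi_f ((Acyclic.isZero_homology hK _).eq_of_tgt _ _)
  have := isIso_of_mono_of_epi (homologyMap s.i (i + 1))
  exact ⟨(asIso (homologyMap s.i (i + 1))).symm⟩

lemma dimv_eq (M : Cplx A t) (i : ZMod t) : dimv M i = imv M i + K0.cls (M.cycles i) :=
  (cyclesSes M i).k0_cls_eq.trans (add_comm _ _)

lemma Ses.dimv_eq {M N L : Cplx A t} (s : Ses M N L) (i : ZMod t) :
    dimv L i = dimv N i + dimv M i :=
  (s.eval i).k0_cls_eq

/-- A short exact sequence of complexes stays exact on the cycles if these are lifted. -/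
lemma Ses.cls_cycles {M N L : Cplx A t} (s : Ses M N L) (i : ZMod t)
    (h : Epi (cyclesMap s.p i)) :
    K0.cls (L.cycles i) = K0.cls (N.cycles i) + K0.cls (M.cycles i) := by
  have hi := cyclesMap_i s.i i
  have : Mono (s.i.f i) := inferInstanceAs (Mono (s.eval i).i)
  have : Mono (cyclesMap s.i i) := by
    have : Mono (cyclesMap s.i i ≫ L.iCycles i) := by rw [hi]; infer_instance
    exact mono_of_mono _ (L.iCycles i)
  refine (Ses.ofLift (cyclesMap s.i i) (cyclesMap s.p i) ?_ ?_).k0_cls_eq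
  · rw [← cyclesMap_comp, s.w, cyclesMap_zero]
  · intro T x hx
    obtain ⟨y, hy⟩ := (s.eval i).exists_lift (x ≫ L.iCycles i) (by
      rw [Ses.eval_p, Category.assoc, ← cyclesMap_i, reassoc_of% hx, zero_comp])
    rw [Ses.eval_i] at hy
    obtain ⟨z, hz⟩ := exists_lift_cycles N y (by
      rw [← cancel_mono (s.eval (i + 1)).i, Category.assoc, Ses.eval_i, ← s.i.comm,
        reassoc_of% hy, L.iCycles_d, comp_zero, zero_comp])
    exact ⟨z, by rw [← cancel_mono (L.iCycles i), Category.assoc, hi, reassoc_of% hz, hy]⟩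

/-- The classes of terms are always additive and those of cycles are additive by hypothesis; the
image class is their difference. -/
lemma Ses.imv_eq_of_epi {M N L : Cplx A t} (s : Ses M N L) (i : ZMod t)
    (h : Epi (cyclesMap s.p i)) : imv L i = imv N i + imv M i := by
  have h1 := SemiDerived.dimv_eq L i
  rw [s.dimv_eq, s.cls_cycles i h, SemiDerived.dimv_eq N, SemiDerived.dimv_eq M] at h1
  have h2 : imv L i + (K0.cls (N.cycles i) + K0.cls (M.cycles i)) =
      (imv N i + imv M i) + (K0.cls (N.cycles i) + K0.cls (M.cycles i)) := by
    rw [← h1]; abel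
  exact add_right_cancel h2

/-- Cycles lift: the differential of any lift of a cycle is a cycle of `K`, hence locally a
boundary, by which the lift can be corrected. -/
lemma Ses.imv_of_acyclic_sub {M K L : Cplx A t} (s : Ses M K L) (hK : K.Acyclic) :
    imv L = imv K + imv M := by
  funext i
  refine s.imv_eq_of_epi i ?_
  rw [epi_iff_surjective_up_to_refinements]
  intro T x
  obtain ⟨T₁, π₁, hπ₁, l, hl⟩ := surjective_up_to_refinements_of_epi (s.eval i).p (x ≫ M.iCycles i)
  obtain ⟨k, hk⟩ := (s.eval (i + 1)).exists_lift (l ≫ L.d i (i + 1)) (by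
    rw [Category.assoc, Ses.eval_p, ← s.p.comm]
    rw [Ses.eval_p] at hl
    rw [← reassoc_of% hl, M.iCycles_d, comp_zero, comp_zero])
  have hk' : k ≫ K.d (i + 1) (i + 1 + 1) = 0 := by
    rw [← cancel_mono (s.eval (i + 1 + 1)).i, Category.assoc, Ses.eval_i, ← s.i.comm,
      ← Category.assoc]
    refine (congrArg (· ≫ _) hk).trans ?_
    rw [Category.assoc, L.d_comp_d, comp_zero, zero_comp]
  obtain ⟨T₂, π₂, hπ₂, y, hy⟩ := Acyclic.exists_lift hK k hk'
  obtain ⟨z, hz⟩ := exists_lift_cycles L (π₂ ≫ l - y ≫ s.i.f i) (by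
    rw [Preadditive.sub_comp, Category.assoc, Category.assoc, s.i.comm, reassoc_of% hy, ← hk,
      Ses.eval_i, sub_self])
  have hw : s.i.f i ≫ s.p.f i = 0 := (s.eval i).w
  rw [Ses.eval_p] at hl
  refine ⟨T₂, π₂ ≫ π₁, epi_comp _ _, z, ?_⟩
  rw [← cancel_mono (M.iCycles i), Category.assoc, Category.assoc, Category.assoc, cyclesMap_i,
    reassoc_of% hz, Preadditive.sub_comp, Category.assoc, Category.assoc, hw, comp_zero, sub_zero,
    hl]

/-- Cycles of an acyclic quotient are locally boundaries, and boundaries lift to boundaries. -/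
lemma Ses.imv_of_acyclic_quot {M K L : Cplx A t} (s : Ses K M L) (hK : K.Acyclic) :
    imv L = imv M + imv K := by
  funext i
  refine s.imv_eq_of_epi i ?_
  obtain ⟨i, rfl⟩ : ∃ j, i = j + 1 := ⟨i - 1, by ring⟩
  have := Acyclic.epi_toCycles hK i
  have : Epi (s.p.f i) := inferInstanceAs (Epi (s.eval i).p)
  have h : L.toCycles i (i + 1) ≫ cyclesMap s.p (i + 1) = s.p.f i ≫ K.toCycles i (i + 1) := by
    rw [← cancel_mono (K.iCycles (i + 1)), Category.assoc, Category.assoc, cyclesMap_i,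
      K.toCycles_i, L.toCycles_i_assoc, s.p.comm]
  have : Epi (L.toCycles i (i + 1) ≫ cyclesMap s.p (i + 1)) := by rw [h]; infer_instance
  exact epi_of_epi (L.toCycles i (i + 1)) _

variable (A t) in
/-- The types of complexes: the isomorphism classes of the homologies and the classes of the
images of the differentials. -/
abbrev CplxType : Type u := (ZMod t → IsoClass A) × (ZMod t → K0 A)

/-- The isomorphism classes of the homologies. -/
def hcls (M : Cplx A t) (i : ZMod t) : IsoClass A := IsoClass.mk (M.homology i)

/-- The type of a complex. -/
def typ (M : Cplx A t) : CplxType A t := (hcls M, imv M)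

lemma typ_eq_iff {M₁ M₂ : Cplx A t} : typ M₁ = typ M₂ ↔ SameType M₁ M₂ := by
  rw [typ, typ, Prod.ext_iff, funext_iff, funext_iff, SameType, ← forall_and]
  refine forall_congr' fun i => ?_
  exact and_congr IsoClass.mk_eq_iff Iff.rfl

lemma imv_congr {M₁ M₂ : Cplx A t} (e : M₁ ≅ M₂) : imv M₁ = imv M₂ := by
  funext i
  have he : (e.hom ≫ e.inv).f (i + 1) = 𝟙 _ := by rw [e.hom_inv_id, id_f]
  have : IsIso (e.hom.f i) := inferInstanceAs (IsIso ((eval A _ i).map e.hom))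
  have : IsIso (e.inv.f (i + 1)) := inferInstanceAs (IsIso ((eval A _ (i + 1)).map e.inv))
  have : StrongEpi (e.hom.f i ≫ factorThruImage (M₂.d i (i + 1))) := strongEpi_of_epi _
  refine (K0.cls_iso (image.isoStrongEpiMono (e.hom.f i ≫ factorThruImage (M₂.d i (i + 1)))
    (Limits.image.ι (M₂.d i (i + 1)) ≫ e.inv.f (i + 1)) ?_)).symm
  rw [Category.assoc, Limits.image.fac_assoc, e.hom.comm_assoc, ← comp_f, he, Category.comp_id]

lemma SameType.of_iso {M₁ M₂ : Cplx A t} (e : M₁ ≅ M₂) : SameType M₁ M₂ := fun i =>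
  ⟨⟨(homologyFunctor A _ i).mapIso e⟩, congrFun (imv_congr e) i⟩

/-- The type of an isomorphism class of complexes. -/
def ctyp (x : IsoClass (Cplx A t)) : CplxType A t := typ x.rep

@[simp] lemma ctyp_mk (M : Cplx A t) : ctyp (IsoClass.mk M) = typ M :=
  typ_eq_iff.2 (SameType.of_iso (IsoClass.nonempty_iso M).some)

/-- The right hand side does not involve the extension class. This makes products with acyclic
complexes scalar multiples of a single type. -/
lemma Ses.typ_of_acyclic_sub {M K L : Cplx A t} (s : Ses M K L) (hK : K.Acyclic) :
    typ L = (hcls M, imv K + imv M) := by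
  rw [typ, s.imv_of_acyclic_sub hK]
  exact Prod.ext (funext fun i =>
    IsoClass.mk_eq_iff.2 (s.nonempty_homology_iso_of_acyclic_sub hK i)) rfl

lemma Ses.typ_of_acyclic_quot {M K L : Cplx A t} (s : Ses K M L) (hK : K.Acyclic) :
    typ L = (hcls M, imv K + imv M) := by
  rw [typ, s.imv_of_acyclic_quot hK, add_comm]
  exact Prod.ext (funext fun i =>
    IsoClass.mk_eq_iff.2 (s.nonempty_homology_iso_of_acyclic_quot hK i)) rfl

/-- The inclusion of the boundaries into the cycles. -/
def bdToCycles (M : Cplx A t) (i : ZMod t) : bd M i ⟶ M.cycles (i + 1) :=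
  image.lift { I := M.cycles (i + 1), m := M.iCycles (i + 1), e := M.toCycles i (i + 1),
               fac := M.toCycles_i i (i + 1) }

lemma bdToCycles_i (M : Cplx A t) (i : ZMod t) :
    bdToCycles M i ≫ M.iCycles (i + 1) = Limits.image.ι (M.d i (i + 1)) :=
  image.lift_fac _

lemma factorThruImage_bdToCycles (M : Cplx A t) (i : ZMod t) :
    factorThruImage (M.d i (i + 1)) ≫ bdToCycles M i = M.toCycles i (i + 1) := by
  rw [← cancel_mono (M.iCycles (i + 1)), Category.assoc, bdToCycles_i, Limits.image.fac, M.toCycles_i]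

instance (M : Cplx A t) (i : ZMod t) : Mono (bdToCycles M i) := by
  have : Mono (bdToCycles M i ≫ M.iCycles (i + 1)) := by rw [bdToCycles_i]; infer_instance
  exact mono_of_mono _ (M.iCycles (i + 1))

/-- Boundaries, cycles and homology. -/
def homologySes (M : Cplx A t) (i : ZMod t) :
    Ses (M.homology (i + 1)) (bd M i) (M.cycles (i + 1)) :=
  Ses.ofDesc (bdToCycles M i) (M.homologyπ (i + 1))
    (by rw [← cancel_epi (factorThruImage (M.d i (i + 1))), ← Category.assoc,
      factorThruImage_bdToCycles, M.toCycles_comp_homologyπ, comp_zero])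
    (fun T x hx => by
      have h : M.toCycles i (i + 1) ≫ x = 0 := by
        rw [← factorThruImage_bdToCycles, Category.assoc, hx, comp_zero]
      have hr := (ComplexShape.up (ZMod t)).prev_eq' (show (ComplexShape.up (ZMod t)).Rel i (i + 1) from rfl)
      exact ⟨(M.homologyIsCokernel i (i + 1) hr).desc (CokernelCofork.ofπ x h),
        (M.homologyIsCokernel i (i + 1) hr).fac _ WalkingParallelPair.one⟩)

/-- The classes of the terms are determined by the type. -/
lemma dimv_succ (M : Cplx A t) (i : ZMod t) :
    dimv M (i + 1) = imv M i + imv M (i + 1) + K0.cls (M.homology (i + 1)) := by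
  rw [dimv_eq, (homologySes M i).k0_cls_eq, add_comm (imv M i), add_assoc]
  rfl

lemma dimv_eq_of_typ_eq {M N : Cplx A t} (h : typ M = typ N) : dimv M = dimv N := by
  funext i
  obtain ⟨i, rfl⟩ : ∃ j, i = j + 1 := ⟨i - 1, by ring⟩
  have hi : imv M = imv N := congrArg Prod.snd h
  have hh : hcls M = hcls N := congrArg Prod.fst h
  rw [dimv_succ, dimv_succ, hi, K0.cls_iso (IsoClass.mk_eq_iff.1 (congrFun hh (i + 1))).some]

end Types

/-! ### Zigzags between a complex and its homology -/

section Zigzag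

open HomologicalComplex

attribute [local instance] HasExt.standard

variable {A : Type u} [Category.{v} A] [Abelian A] {t : ℕ}

/-- A complex from its terms and differentials. -/
def mkCplx (X : ZMod t → A) (d : ∀ i j, i + 1 = j → (X i ⟶ X j))
    (hd : ∀ i j k (h : i + 1 = j) (h' : j + 1 = k), d i j h ≫ d j k h' = 0) : Cplx A t where
  X := X
  d i j := if h : i + 1 = j then d i j h else 0
  shape _ _ h := dif_neg h
  d_comp_d' i j k h h' := by
    have h : i + 1 = j := h
    have h' : j + 1 = k := h'
    rw [dif_pos h, dif_pos h', hd]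

lemma mkCplx_d (X : ZMod t → A) (d : ∀ i j, i + 1 = j → (X i ⟶ X j)) (hd) (i j : ZMod t)
    (h : i + 1 = j) : (mkCplx X d hd).d i j = d i j h := dif_pos h

/-- A morphism of complexes from its components. -/
def mkHom {M N : Cplx A t} (f : ∀ i, M.X i ⟶ N.X i)
    (h : ∀ i, f i ≫ N.d i (i + 1) = M.d i (i + 1) ≫ f (i + 1)) : M ⟶ N where
  f := f
  comm' := by
    rintro i j (rfl : i + 1 = j)
    exact h i

lemma Acyclic.of_lift {K : Cplx A t}
    (h : ∀ (i : ZMod t) (T : A) (x : T ⟶ K.X (i + 1)), x ≫ K.d (i + 1) (i + 1 + 1) = 0 →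
      ∃ (T' : A) (π : T' ⟶ T) (_ : Epi π) (y : T' ⟶ K.X i), y ≫ K.d i (i + 1) = π ≫ x) :
    K.Acyclic := by
  intro i
  obtain ⟨i, rfl⟩ : ∃ j, i = j + 1 := ⟨i - 1, by ring⟩
  rw [K.exactAt_iff' i (i + 1) (i + 1 + 1)
    ((ComplexShape.up (ZMod t)).prev_eq' rfl) ((ComplexShape.up (ZMod t)).next_eq' rfl),
    ShortComplex.exact_iff_exact_up_to_refinements]
  intro T x hx
  obtain ⟨T', π, hπ, y, hy⟩ := h i T x hx
  exact ⟨T', π, hπ, y, hy.symm⟩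

lemma mkCplx_acyclic (X : ZMod t → A) (d : ∀ i j, i + 1 = j → (X i ⟶ X j)) (hd)
    (h : ∀ (i : ZMod t) (T : A) (x : T ⟶ X (i + 1)), x ≫ d (i + 1) (i + 1 + 1) rfl = 0 →
      ∃ (T' : A) (π : T' ⟶ T) (_ : Epi π) (y : T' ⟶ X i), y ≫ d i (i + 1) rfl = π ≫ x) :
    (mkCplx X d hd).Acyclic :=
  Acyclic.of_lift fun i T x hx => by
    rw [mkCplx_d _ _ _ _ _ rfl] at hx
    obtain ⟨T', π, hπ, y, hy⟩ := h i T x hx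
    refine ⟨T', π, hπ, y, ?_⟩
    rw [mkCplx_d _ _ _ _ _ rfl]
    exact hy

/-- A morphism to a complex given by its terms and differentials. -/
def homToMk {M : Cplx A t} {X : ZMod t → A} {d : ∀ i j, i + 1 = j → (X i ⟶ X j)} {hd}
    (f : ∀ i, M.X i ⟶ X i) (h : ∀ i, f i ≫ d i (i + 1) rfl = M.d i (i + 1) ≫ f (i + 1)) :
    M ⟶ mkCplx X d hd :=
  mkHom (N := mkCplx X d hd) f fun i => by rw [mkCplx_d _ _ _ _ _ rfl]; exact h i

/-- A morphism from a complex given by its terms and differentials. -/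
def homFromMk {M : Cplx A t} {X : ZMod t → A} {d : ∀ i j, i + 1 = j → (X i ⟶ X j)} {hd}
    (f : ∀ i, X i ⟶ M.X i) (h : ∀ i, f i ≫ M.d i (i + 1) = d i (i + 1) rfl ≫ f (i + 1)) :
    mkCplx X d hd ⟶ M :=
  mkHom (M := mkCplx X d hd) f fun i => by rw [mkCplx_d _ _ _ _ _ rfl]; exact h i

/-- A morphism between complexes given by their terms and differentials. -/
def homMk {X : ZMod t → A} {d : ∀ i j, i + 1 = j → (X i ⟶ X j)} {hd}
    {X' : ZMod t → A} {d' : ∀ i j, i + 1 = j → (X' i ⟶ X' j)} {hd'}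
    (f : ∀ i, X i ⟶ X' i)
    (h : ∀ i, f i ≫ d' i (i + 1) rfl = d i (i + 1) rfl ≫ f (i + 1)) :
    mkCplx X d hd ⟶ mkCplx X' d' hd' :=
  homToMk (M := mkCplx X d hd) f fun i => by rw [mkCplx_d _ _ _ _ _ rfl]; exact h i

/-- The complex with terms `Yⁱ ⊞ Xⁱ` whose differentials are given by morphisms `Xⁱ ⟶ Yⁱ⁺¹`. -/
abbrev coneCplx (Y X : ZMod t → A) (φ : ∀ i j, i + 1 = j → (X i ⟶ Y j)) : Cplx A t :=
  mkCplx (fun i => Y i ⊞ X i) (fun i j h => biprod.snd ≫ φ i j h ≫ biprod.inl) (by simp)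

lemma coneCplx_acyclic (Y X : ZMod t → A) (φ : ∀ i j, i + 1 = j → (X i ⟶ Y j))
    (hφ : ∀ i j h, IsIso (φ i j h)) : (coneCplx Y X φ).Acyclic := by
  refine mkCplx_acyclic _ _ _ fun i T x hx => ?_
  have hx' : x ≫ biprod.snd = 0 := by
    have h2 := congrArg (· ≫ biprod.fst) hx
    simp only [Category.assoc, biprod.inl_fst, Category.comp_id, zero_comp] at h2
    rw [← cancel_mono (φ (i + 1) (i + 1 + 1) rfl), Category.assoc, h2, zero_comp]
  refine ⟨T, 𝟙 T, inferInstance, x ≫ biprod.fst ≫ inv (φ i (i + 1) rfl) ≫ biprod.inr, ?_⟩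
  refine biprod.hom_ext _ _ ?_ ?_ <;> simp [hx']

/-- The short exact sequence of the graph of a morphism. -/
def Ses.graph {E N : A} (f : E ⟶ N) : Ses N E (E ⊞ N) :=
  have : Mono (biprod.lift (𝟙 E) (-f)) := mono_of_mono_fac (biprod.lift_fst _ _)
  have : Epi (biprod.desc f (𝟙 N)) := epi_of_epi_fac (biprod.inr_desc _ _)
  Ses.ofLift (biprod.lift (𝟙 E) (-f)) (biprod.desc f (𝟙 N)) (by simp) fun T x hx =>
    ⟨x ≫ biprod.fst, by
      have h : x ≫ biprod.fst ≫ f + x ≫ biprod.snd = 0 := by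
        rw [← Preadditive.comp_add, ← hx]
        congr 1
        refine biprod.hom_ext' _ _ ?_ ?_ <;> simp
      refine biprod.hom_ext _ _ (by simp) ?_
      simp only [Category.assoc, biprod.lift_snd, Preadditive.comp_neg]
      exact neg_eq_of_add_eq_zero_right h⟩

/-- The short exact sequence of the cograph of a morphism. -/
def Ses.cograph {N E : A} (f : N ⟶ E) : Ses E N (N ⊞ E) :=
  have : Mono (biprod.lift (𝟙 N) f) := mono_of_mono_fac (biprod.lift_fst _ _)
  have : Epi (biprod.desc (-f) (𝟙 E)) := epi_of_epi_fac (biprod.inr_desc _ _)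
  Ses.ofLift (biprod.lift (𝟙 N) f) (biprod.desc (-f) (𝟙 E)) (by simp) fun T x hx =>
    ⟨x ≫ biprod.fst, by
      have h : -(x ≫ biprod.fst ≫ f) + x ≫ biprod.snd = 0 := by
        rw [← Preadditive.comp_neg, ← Preadditive.comp_add, ← hx]
        congr 1
        refine biprod.hom_ext' _ _ ?_ ?_ <;> simp
      refine biprod.hom_ext _ _ (by simp) ?_
      simp only [Category.assoc, biprod.lift_snd]
      exact neg_add_eq_zero.1 h⟩

/-- The sum of a short exact sequence and of an object, on the left. -/
def Ses.addRight {X Y Z : A} (s : Ses X Y Z) (N : A) : Ses X (Y ⊞ N) (Z ⊞ N) :=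
  have : Mono (biprod.map s.i (𝟙 N)) := inferInstance
  have : Epi ((biprod.fst : Z ⊞ N ⟶ Z) ≫ s.p) := epi_comp _ _
  Ses.ofLift (biprod.map s.i (𝟙 N)) (biprod.fst ≫ s.p) (by simp [s.w]) fun T x hx => by
    obtain ⟨y, hy⟩ := s.exists_lift (x ≫ biprod.fst) (by simpa using hx)
    exact ⟨biprod.lift y (x ≫ biprod.snd), biprod.hom_ext _ _ (by simp [hy]) (by simp)⟩

/-- The sum of a short exact sequence and of an object, on the right. -/
def Ses.addLeft {X Y Z : A} (s : Ses X Y Z) (N : A) : Ses (N ⊞ X) Y (N ⊞ Z) :=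
  have : Mono (s.i ≫ (biprod.inr : Z ⟶ N ⊞ Z)) := mono_comp _ _
  have : Epi (biprod.map (𝟙 N) s.p) := inferInstance
  Ses.ofLift (s.i ≫ biprod.inr) (biprod.map (𝟙 N) s.p) (by
      refine biprod.hom_ext _ _ ?_ ?_ <;> simp [s.w]) fun T x hx => by
    have h1 : x ≫ biprod.fst = 0 := by simpa using congrArg (· ≫ biprod.fst) hx
    obtain ⟨y, hy⟩ := s.exists_lift (x ≫ biprod.snd) (by simpa using congrArg (· ≫ biprod.snd) hx)
    exact ⟨y, biprod.hom_ext _ _ (by simp [h1]) (by simp [hy])⟩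

/-- A short exact sequence of complexes from the degreewise ones. -/
def sesOfEval {M N L : Cplx A t} (f : N ⟶ L) (g : L ⟶ M)
    (s : ∀ i, Ses (M.X i) (N.X i) (L.X i)) (hf : ∀ i, (s i).i = f.f i) (hg : ∀ i, (s i).p = g.f i) :
    Ses M N L :=
  Ses.mk f g (by ext i : 1; rw [comp_f, ← hf, ← hg, (s i).w]; rfl) (by
    rw [HomologicalComplex.shortExact_iff_degreewise_shortExact]
    intro i
    have h := (s i).exact
    simp only [hf, hg] at h
    exact h)

lemma Ses.epi_of_hom {A₁ C₁ B₁ A₂ C₂ B₂ : A} (s : Ses A₁ C₁ B₁) (s' : Ses A₂ C₂ B₂) (c : C₁ ⟶ C₂)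
    (b : B₁ ⟶ B₂) (a : A₁ ⟶ A₂) (h1 : s.i ≫ b = c ≫ s'.i) (h2 : b ≫ s'.p = s.p ≫ a) [Epi c]
    [Epi a] : Epi b := by
  rw [Preadditive.epi_iff_cancel_zero]
  intro T x hx
  have h3 : c ≫ s'.i ≫ x = 0 := by rw [← reassoc_of% h1, hx, comp_zero]
  have h4 : s'.i ≫ x = 0 := by rw [← cancel_epi c, h3, comp_zero]
  obtain ⟨y, rfl⟩ := s'.exists_desc x h4
  have h5 : s.p ≫ a ≫ y = 0 := by rw [← reassoc_of% h2, hx]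
  have h6 : y = 0 := by rw [← cancel_epi a, ← cancel_epi s.p, h5, comp_zero, comp_zero]
  rw [h6, comp_zero]

lemma Ses.mono_of_hom {A₁ C₁ B₁ A₂ C₂ B₂ : A} (s : Ses A₁ C₁ B₁) (s' : Ses A₂ C₂ B₂) (c : C₁ ⟶ C₂)
    (b : B₁ ⟶ B₂) (a : A₁ ⟶ A₂) (h1 : s.i ≫ b = c ≫ s'.i) (h2 : b ≫ s'.p = s.p ≫ a) [Mono c]
    [Mono a] : Mono b := by
  rw [Preadditive.mono_iff_cancel_zero]
  intro T x hx
  have h3 : (x ≫ s.p) ≫ a = 0 := by rw [Category.assoc, ← h2, reassoc_of% hx, zero_comp]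
  have h4 : x ≫ s.p = 0 := by rw [← cancel_mono a, h3, zero_comp]
  obtain ⟨y, rfl⟩ := s.exists_lift x h4
  have h5 : y ≫ c ≫ s'.i = 0 := by rw [← h1, ← Category.assoc, hx]
  have h6 : y = 0 := by rw [← cancel_mono c, ← cancel_mono s'.i, Category.assoc, h5, zero_comp, zero_comp]
  rw [h6, zero_comp]

/-- The opcycles and the boundaries. -/
def opToBd (M : Cplx A t) (i : ZMod t) : M.opcycles i ⟶ bd M i :=
  M.descOpcycles (factorThruImage (M.d i (i + 1))) (i - 1)
    ((ComplexShape.up (ZMod t)).prev_eq' (sub_add_cancel i 1)) (by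
      rw [← cancel_mono (Limits.image.ι (M.d i (i + 1))), Category.assoc, Limits.image.fac,
        M.d_comp_d, zero_comp])

lemma opToBd_ι (M : Cplx A t) (i : ZMod t) :
    opToBd M i ≫ Limits.image.ι (M.d i (i + 1)) = M.fromOpcycles i (i + 1) := by
  rw [← cancel_epi (M.pOpcycles i), M.p_fromOpcycles, opToBd, M.p_descOpcycles_assoc,
    Limits.image.fac]

/-- Homology, opcycles and boundaries. -/
def opcyclesSes (M : Cplx A t) (i : ZMod t) : Ses (bd M i) (M.homology i) (M.opcycles i) :=
  have h : M.pOpcycles i ≫ opToBd M i = factorThruImage (M.d i (i + 1)) :=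
    M.p_descOpcycles _ _ _ _
  have : Epi (M.pOpcycles i ≫ opToBd M i) := by rw [h]; infer_instance
  have : Epi (opToBd M i) := epi_of_epi (M.pOpcycles i) _
  Ses.ofLift (M.homologyι i) (opToBd M i)
    (by rw [← cancel_mono (Limits.image.ι (M.d i (i + 1))), Category.assoc, opToBd_ι,
      M.homologyι_comp_fromOpcycles, zero_comp])
    (fun T x hx => by
      have h : x ≫ M.fromOpcycles i (i + 1) = 0 := by rw [← opToBd_ι, reassoc_of% hx, zero_comp]
      have hr := (ComplexShape.up (ZMod t)).next_eq' (show (ComplexShape.up (ZMod t)).Rel i (i + 1) from rfl)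
      exact ⟨(M.homologyIsKernel i (i + 1) hr).lift (KernelFork.ofι x h),
        (M.homologyIsKernel i (i + 1) hr).fac _ WalkingParallelPair.zero⟩)

lemma exists_lift_of_comp_pOpcycles (M : Cplx A t) {i : ZMod t} {T : A} (x : T ⟶ M.X (i + 1))
    (hx : x ≫ M.pOpcycles (i + 1) = 0) :
    ∃ (T' : A) (π : T' ⟶ T) (_ : Epi π) (y : T' ⟶ M.X i), y ≫ M.d i (i + 1) = π ≫ x := by
  have h := ShortComplex.exact_of_g_is_cokernel
    (ShortComplex.mk (M.d i (i + 1)) (M.pOpcycles (i + 1)) (M.d_pOpcycles _ _))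
    (M.opcyclesIsCokernel i (i + 1) ((ComplexShape.up (ZMod t)).prev_eq' rfl))
  rw [ShortComplex.exact_iff_exact_up_to_refinements] at h
  obtain ⟨T', π, hπ, y, hy⟩ := h x hx
  exact ⟨T', π, hπ, y, hy.symm⟩

variable [Hereditary A]

/-- An extension of the homology by the preceding term, mapping onto the cycles. -/
lemma exists_lifted_homology (N : Cplx A t) (j : ZMod t) :
    ∃ (E : A) (p : E ⟶ N.homology j) (q : E ⟶ N.cycles j) (_ : Epi q),
      ∀ i, i + 1 = j → ∃ s : Ses (N.homology j) (N.X i) E, s.p = p ∧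
        s.i ≫ q = N.toCycles i j ∧ q ≫ N.homologyπ j = p := by
  obtain ⟨i, rfl⟩ : ∃ i, j = i + 1 := ⟨j - 1, by ring⟩
  -- By heredity the extension of the homology by the boundaries lifts along the epimorphism from
  -- the preceding term to the boundaries.
  obtain ⟨e, he⟩ := exists_ext_comp_epi (factorThruImage (N.d i (i + 1))) (homologySes N i).cls
  obtain ⟨E, s, rfl⟩ := Ses.exists_cls e
  obtain ⟨q, h1, h2⟩ := s.exists_hom_of_cls_comp_eq (homologySes N i) _ (𝟙 _)
    (he.trans (Ext.mk₀_id_comp _).symm)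
  have h1' : s.i ≫ q = N.toCycles i (i + 1) := h1.trans (factorThruImage_bdToCycles N i)
  have : Epi q := s.epi_of_hom (homologySes N i) _ q _ h1 h2
  refine ⟨E, s.p, q, this, fun i' h => ?_⟩
  obtain rfl : i' = i := add_right_cancel h
  exact ⟨s, rfl, h1', h2.trans (Category.comp_id _)⟩

/-- A complex `P` with epimorphisms to `N` and to the homology of `N` that have acyclic kernels. -/
lemma exists_zigzag (N : Cplx A t) : ∃ (P K K' : Cplx A t), K.Acyclic ∧ K'.Acyclic ∧
    Nonempty (Ses N K P) ∧ Nonempty (Ses (zeroCplx fun i => N.homology i) K' P) := by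
  choose E p q hq hE using exists_lifted_homology N
  choose s hs1 hs2 hs3 using hE
  -- The complex `P` has terms `E i ⊞ N.X i`, with differential given by these inclusions.
  let ι : ∀ i j, i + 1 = j → (N.X i ⟶ E j) := fun i j h => (s j i h).i
  have hιq : ∀ i j h, ι i j h ≫ q j = N.toCycles i j := fun i j h => hs2 j i h
  have hιp : ∀ i j h, ι i j h ≫ p j = 0 := fun i j h => by rw [← hs1 j i h, Ses.w]
  have hqp : ∀ j, q j ≫ N.homologyπ j = p j := fun j => hs3 j (j - 1) (by ring)
  have hp : ∀ i, Epi (p i) := fun i => by rw [← hqp]; exact epi_comp _ _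
  -- Each `κ` is an isomorphism, so the kernel of the map from `P` to the homology is a cone of
  -- isomorphisms.
  let κ : ∀ i j, i + 1 = j → (N.X i ⟶ kernel (p j)) := fun i j h => kernel.lift _ _ (hιp i j h)
  have hκι : ∀ i j h, κ i j h ≫ (Ses.ker (p j)).i = ι i j h := fun i j h =>
    (congrArg (κ i j h ≫ ·) (Category.id_comp _)).trans (kernel.lift_ι _ _ _)
  have hκ : ∀ i j h, IsIso (κ i j h) := fun i j h => by
    have : Mono (κ i j h ≫ (Ses.ker (p j)).i) := by
      rw [hκι]; exact inferInstanceAs (Mono (s j i h).i)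
    have := mono_of_mono (κ i j h) (Ses.ker (p j)).i
    obtain ⟨r, hr⟩ := (s j i h).exists_lift (Ses.ker (p j)).i (by rw [hs1]; exact Ses.w _)
    have h2 : r ≫ κ i j h = 𝟙 _ := by
      rw [← cancel_mono (Ses.ker (p j)).i, Category.assoc, hκι, hr, Category.id_comp]
    have : IsSplitEpi (κ i j h) := ⟨⟨r, h2⟩⟩
    exact isIso_of_mono_of_epi _
  -- The kernel of `P ⟶ N` is the graph of `E ⟶ N`, that is `E` with this differential. A cycle of
  -- it dies under `q`, hence comes through `ι` from a cycle of `N`, which lifts along `q`.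
  have hK : (mkCplx E (fun i j h => -(q i ≫ N.iCycles i ≫ ι i j h)) (fun i j k h h' => by
      simp only [Category.assoc, Preadditive.neg_comp, Preadditive.comp_neg, neg_neg]
      rw [reassoc_of% hιq i j h, N.toCycles_i_assoc, N.iCycles_d_assoc, zero_comp,
        comp_zero])).Acyclic := mkCplx_acyclic _ _ _ fun i T x hx => by
    rw [Preadditive.comp_neg, neg_eq_zero] at hx
    have h1 : x ≫ q (i + 1) = 0 := by
      rw [← cancel_mono (N.iCycles (i + 1)), ← cancel_mono (s _ (i + 1) rfl).i]
      simpa using hx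
    obtain ⟨y, hy⟩ := (s (i + 1) i rfl).exists_lift x (by
      rw [hs1, ← hqp, reassoc_of% h1, zero_comp])
    obtain ⟨z, hz⟩ := exists_lift_cycles N y (by
      rw [← N.toCycles_i, ← hιq i (i + 1) rfl, Category.assoc, reassoc_of% hy, reassoc_of% h1,
        zero_comp])
    obtain ⟨T', π, hπ, w, hw⟩ := surjective_up_to_refinements_of_epi (q i) z
    refine ⟨T', π, hπ, -w, ?_⟩
    rw [Preadditive.neg_comp, Preadditive.comp_neg, neg_neg, ← reassoc_of% hw,
      reassoc_of% hz, hy]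
  refine ⟨coneCplx E N.X ι, _, coneCplx (fun j => kernel (p j)) N.X κ, hK,
    coneCplx_acyclic _ _ _ hκ,
    ⟨sesOfEval (homMk (fun i => (Ses.graph (q i ≫ N.iCycles i)).i) fun i => ?_)
      (homFromMk (fun i => (Ses.graph (q i ≫ N.iCycles i)).p) fun i => ?_)
      (fun i => Ses.graph (q i ≫ N.iCycles i)) (fun i => rfl) (fun i => rfl)⟩,
    ⟨sesOfEval (homMk (fun i => ((Ses.ker (p i)).addRight (N.X i)).i) fun i => ?_)
      (homFromMk (M := zeroCplx fun i => N.homology i)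
        (fun i => ((Ses.ker (p i)).addRight (N.X i)).p) fun i => ?_)
      (fun i => (Ses.ker (p i)).addRight (N.X i)) (fun i => rfl) (fun i => rfl)⟩⟩
  · refine biprod.hom_ext _ _ ?_ ?_
    · simp [Ses.graph]
    · simp [Ses.graph, reassoc_of% hιq i (i + 1) rfl]
  · refine biprod.hom_ext' _ _ ?_ ?_
    · simp [Ses.graph]
    · simp [Ses.graph, reassoc_of% hιq i (i + 1) rfl]
  · refine biprod.hom_ext _ _ ?_ ?_
    · simp [Ses.addRight, hκι]
    · simp [Ses.addRight]
  · have h : ((biprod.snd : E i ⊞ N.X i ⟶ N.X i) ≫ ι i (i + 1) rfl ≫ biprod.inl) ≫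
        ((Ses.ker (p (i + 1))).addRight (N.X (i + 1))).p = 0 := by
      simp [Ses.addRight, hιp]
    exact comp_zero.trans h.symm

/-- An extension of the following term by the homology, containing the opcycles. -/
lemma exists_extended_homology (N : Cplx A t) (i : ZMod t) :
    ∃ (E : A) (ι : N.homology i ⟶ E) (q : N.opcycles i ⟶ E) (_ : Mono q),
      ∀ j, i + 1 = j → ∃ s : Ses (N.X j) (N.homology i) E, s.i = ι ∧
        q ≫ s.p = N.fromOpcycles i j ∧ N.homologyι i ≫ q = ι := by
  -- Dually, heredity extends the class of the opcycles along the inclusion of the boundaries in the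
  -- next term.
  obtain ⟨e, he⟩ := exists_ext_mono_comp (Limits.image.ι (N.d i (i + 1))) (opcyclesSes N i).cls
  obtain ⟨E, s, rfl⟩ := Ses.exists_cls e
  obtain ⟨q, h1, h2⟩ := (opcyclesSes N i).exists_hom_of_cls_comp_eq s (𝟙 _)
    (Limits.image.ι (N.d i (i + 1))) ((Ext.comp_mk₀_id _).trans he.symm)
  have : Mono q := (opcyclesSes N i).mono_of_hom s _ q _ h1 h2
  refine ⟨E, s.i, q, this, ?_⟩
  rintro _ rfl
  exact ⟨s, rfl, h2.trans (opToBd_ι N i), h1.trans (Category.id_comp _)⟩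

/-- A complex `P` with monomorphisms from `N` and from the homology of `N` that have acyclic
cokernels. -/
lemma exists_cozigzag (N : Cplx A t) : ∃ (P K K' : Cplx A t), K.Acyclic ∧ K'.Acyclic ∧
    Nonempty (Ses K N P) ∧ Nonempty (Ses K' (zeroCplx fun i => N.homology i) P) := by
  choose E ι q hq hE using exists_extended_homology N
  choose s hs1 hs2 hs3 using hE
  let p : ∀ i j, i + 1 = j → (E i ⟶ N.X j) := fun i j h => (s i j h).p
  have hqp : ∀ i j h, q i ≫ p i j h = N.fromOpcycles i j := fun i j h => hs2 i j h
  have hιq : ∀ i, N.homologyι i ≫ q i = ι i := fun i => hs3 i (i + 1) rfl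
  have hιp : ∀ i j h, ι i ≫ p i j h = 0 := fun i j h => by rw [← hs1 i j h, Ses.w]
  have hd : ∀ i j, N.d i j ≫ N.pOpcycles j = 0 := fun i j => N.d_pOpcycles i j
  -- The cokernel of the cograph inclusion of `N` is `E` with this differential. For a cycle `x`,
  -- its image in `N` is locally a boundary, so up to homology `x` comes from opcycles, and these
  -- are reached through the epimorphism `p`.
  have hK : (mkCplx E (fun i j h => -(p i j h ≫ N.pOpcycles j ≫ q j)) (fun i j k h h' => by
      simp only [Category.assoc, Preadditive.neg_comp, Preadditive.comp_neg, neg_neg]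
      rw [reassoc_of% hqp j k h', N.p_fromOpcycles_assoc, reassoc_of% hd j k, zero_comp, comp_zero])).Acyclic := mkCplx_acyclic _ _ _ fun i T x hx => by
    rw [Preadditive.comp_neg, neg_eq_zero] at hx
    have h1 : (x ≫ p (i + 1) (i + 1 + 1) rfl) ≫ N.pOpcycles (i + 1 + 1) = 0 := by
      rw [← cancel_mono (q (i + 1 + 1))]
      simpa using hx
    obtain ⟨T₁, π₁, hπ₁, n, hn⟩ := exists_lift_of_comp_pOpcycles N _ h1
    obtain ⟨y, hy⟩ := (s (i + 1) (i + 1 + 1) rfl).exists_lift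
      (π₁ ≫ x - n ≫ N.pOpcycles (i + 1) ≫ q (i + 1)) (by
        change _ ≫ p (i + 1) (i + 1 + 1) rfl = 0
        rw [Preadditive.sub_comp, Category.assoc, Category.assoc, Category.assoc, hqp,
          N.p_fromOpcycles, hn, sub_self])
    rw [hs1, ← hιq] at hy
    obtain ⟨T₂, π₂, hπ₂, m, hm⟩ := surjective_up_to_refinements_of_epi (N.pOpcycles (i + 1))
      (y ≫ N.homologyι (i + 1) + n ≫ N.pOpcycles (i + 1))
    have h2 : π₂ ≫ π₁ ≫ x = m ≫ N.pOpcycles (i + 1) ≫ q (i + 1) := by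
      rw [← reassoc_of% hm, Preadditive.add_comp, Category.assoc, Category.assoc, hy,
        sub_add_cancel]
    have : Epi (p i (i + 1) rfl) := inferInstanceAs (Epi (s i (i + 1) rfl).p)
    obtain ⟨T₃, π₃, hπ₃, w, hw⟩ := surjective_up_to_refinements_of_epi (p i (i + 1) rfl) m
    refine ⟨T₃, π₃ ≫ π₂ ≫ π₁, inferInstance, -w, ?_⟩
    rw [Preadditive.neg_comp, Preadditive.comp_neg, neg_neg, ← reassoc_of% hw, ← h2]
    simp only [Category.assoc]
  refine ⟨coneCplx N.X E p, _, coneCplx N.X (fun i => N.X (i + 1)) (fun i j h => eqToHom (by rw [h])),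
    hK, coneCplx_acyclic _ _ _ (fun i j h => inferInstance),
    ⟨sesOfEval (homToMk (fun i => (Ses.cograph (N.pOpcycles i ≫ q i)).i) fun i => ?_)
      (homMk (fun i => (Ses.cograph (N.pOpcycles i ≫ q i)).p) fun i => ?_)
      (fun i => Ses.cograph (N.pOpcycles i ≫ q i)) (fun i => rfl) (fun i => rfl)⟩,
    ⟨sesOfEval (homToMk (M := zeroCplx fun i => N.homology i)
        (fun i => ((s i (i + 1) rfl).addLeft (N.X i)).i) fun i => ?_)
      (homMk (fun i => ((s i (i + 1) rfl).addLeft (N.X i)).p) fun i => ?_)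
      (fun i => (s i (i + 1) rfl).addLeft (N.X i)) (fun i => rfl) (fun i => rfl)⟩⟩
  · refine biprod.hom_ext _ _ ?_ ?_
    · simp [Ses.cograph, hqp]
    · simp [Ses.cograph, reassoc_of% hd i (i + 1)]
  · refine biprod.hom_ext' _ _ ?_ ?_
    · simp [Ses.cograph, reassoc_of% hqp i (i + 1) rfl, reassoc_of% hd i (i + 1)]
    · simp [Ses.cograph]
  · have h : (((s i (i + 1) rfl).addLeft (N.X i)).i ≫ biprod.snd ≫ p i (i + 1) rfl ≫ biprod.inl :
        N.homology i ⟶ N.X (i + 1) ⊞ E (i + 1)) = 0 := by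
      have hw : (s i (i + 1) rfl).i ≫ p i (i + 1) rfl = 0 := Ses.w _
      simp [Ses.addLeft, reassoc_of% hw]
    exact h.trans zero_comp.symm
  · refine biprod.hom_ext' _ _ ?_ ?_
    · simp [Ses.addLeft]
    · simp [Ses.addLeft, p]

end Zigzag

/-! ### The action of the Hall algebra on the space of types -/

section Representation

open HomologicalComplex

attribute [local instance] HasExt.standard

variable {A : Type u} [Category.{v} A] [Abelian A] {t : ℕ}

lemma imv_zeroCplx (h : ZMod t → A) : imv (zeroCplx h) = 0 := by
  funext i
  have hz : IsZero (Limits.image (0 : h i ⟶ h (i + 1))) := by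
    rw [IsZero.iff_id_eq_zero, ← cancel_epi (factorThruImage _), ← cancel_mono (Limits.image.ι _)]
    simp
  exact (K0.cls_iso hz.isoZero).trans K0.cls_zero

lemma mk_zeroCplx_eq {h h' : ZMod t → A} (H : ∀ i, IsoClass.mk (h i) = IsoClass.mk (h' i)) :
    IsoClass.mk (zeroCplx h) = IsoClass.mk (zeroCplx h') := by
  refine IsoClass.mk_eq_iff.2 ⟨HomologicalComplex.Hom.isoOfComponents
    (fun i => (IsoClass.mk_eq_iff.1 (H i)).some) ?_⟩
  intro i j _
  exact comp_zero.trans zero_comp.symm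

lemma hcls_zeroCplx (h : ZMod t → A) : hcls (zeroCplx h) = fun i => IsoClass.mk (h i) := by
  funext i
  refine IsoClass.mk_eq_iff.2 ?_
  have hp : IsIso ((zeroCplx h).homologyπ i) :=
    (zeroCplx h).isIso_homologyπ (i - 1) i ((ComplexShape.up (ZMod t)).prev_eq' (sub_add_cancel i 1)) rfl
  have hc : IsIso ((zeroCplx h).iCycles i) :=
    (zeroCplx h).isIso_iCycles i (i + 1) ((ComplexShape.up (ZMod t)).next_eq' rfl) rfl
  exact ⟨(@asIso _ _ _ _ _ hp).symm ≪≫ @asIso _ _ _ _ _ hc⟩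

/-- The isomorphism class of the complex with zero differential and given homology. -/
def Gc (h : ZMod t → IsoClass A) : IsoClass (Cplx A t) :=
  IsoClass.mk (zeroCplx fun i => (h i).rep)

lemma Gc_hcls (N : Cplx A t) : Gc (hcls N) = IsoClass.mk (zeroCplx fun i => N.homology i) :=
  mk_zeroCplx_eq fun _ => IsoClass.mk_rep _

lemma ctyp_Gc (h : ZMod t → IsoClass A) : ctyp (Gc h) = (h, 0) := by
  rw [Gc, ctyp_mk, typ, imv_zeroCplx, hcls_zeroCplx]
  exact Prod.ext (funext fun i => IsoClass.mk_rep _) rfl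

lemma dimv_congr {M₁ M₂ : Cplx A t} (e : M₁ ≅ M₂) : dimv M₁ = dimv M₂ :=
  dimv_eq_of_typ_eq (typ_eq_iff.2 (SameType.of_iso e))

/-- The classes of the terms, for an isomorphism class of complexes. -/
def cdim (x : IsoClass (Cplx A t)) : ZMod t → K0 A := dimv x.rep

@[simp] lemma cdim_mk (M : Cplx A t) : cdim (IsoClass.mk M) = dimv M :=
  dimv_congr (IsoClass.nonempty_iso M).some

/-- The shift of the classes of the images of the differentials. -/
def shiftV (β : ZMod t → K0 A) : (CplxType A t →₀ ℚ) →ₗ[ℚ] (CplxType A t →₀ ℚ) :=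
  Finsupp.lmapDomain ℚ ℚ fun x => (x.1, β + x.2)

@[simp] lemma shiftV_single (β : ZMod t → K0 A) (x : CplxType A t) (r : ℚ) :
    shiftV β (Finsupp.single x r) = Finsupp.single (x.1, β + x.2) r :=
  Finsupp.mapDomain_single

lemma shiftV_shiftV (β γ : ZMod t → K0 A) (w : CplxType A t →₀ ℚ) :
    shiftV β (shiftV γ w) = shiftV (β + γ) w := by
  have h : shiftV β ∘ₗ shiftV γ = shiftV (A := A) (β + γ) :=
    Finsupp.lhom_ext fun x r => by simp [add_assoc]
  exact congrArg (fun f => f w) h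

lemma shiftV_zero (w : CplxType A t →₀ ℚ) : shiftV 0 w = w := by
  have h : shiftV 0 = (LinearMap.id : (CplxType A t →₀ ℚ) →ₗ[ℚ] _) :=
    Finsupp.lhom_ext fun x r => by simp
  exact congrArg (fun f => f w) h

variable [NeZero t] [FiniteHomExt A]

variable (A t) in
/-- The linear map recording the types of complexes. -/
def typeLin : HallAlgebra (Cplx A t) →ₗ[ℚ] (CplxType A t →₀ ℚ) :=
  hallLin fun x => Finsupp.single (ctyp x) 1

@[simp] lemma typeLin_of (x : IsoClass (Cplx A t)) :
    typeLin A t (HallAlgebra.of x) = Finsupp.single (ctyp x) 1 := hallLin_of _ _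

/-- Linear maps on the space of types are determined on the shifts of products. -/
lemma typeEnd_ext {W : Type*} [AddCommGroup W] [Module ℚ W] {f g : (CplxType A t →₀ ℚ) →ₗ[ℚ] W}
    (h : ∀ γ b, f (shiftV γ (typeLin A t b)) = g (shiftV γ (typeLin A t b))) : f = g := by
  refine Finsupp.lhom_ext' fun x => LinearMap.ext_ring ?_
  have := h x.2 (HallAlgebra.of (Gc x.1))
  simpa [ctyp_Gc] using this

variable [Hereditary A]

lemma twist_add_left (d d' β : ZMod t → K0 A) : twist (d + d') β = twist d β * twist d' β := by
  simp [twist, chi_add_left, mul_comm, Finset.prod_mul_distrib]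

lemma twist_add_right (d β β' : ZMod t → K0 A) : twist d (β + β') = twist d β * twist d β' := by
  simp [twist, chi_add_right, mul_comm, Finset.prod_mul_distrib]

lemma twist_zero_left (β : ZMod t → K0 A) : twist 0 β = 1 := by simp [twist, chi_zero_left]
lemma twist_ne_zero (d β : ZMod t → K0 A) : twist d β ≠ 0 :=
  Finset.prod_ne_zero_iff.2 fun _ _ => inv_ne_zero (chi_ne_zero _ _)

lemma cotwist_add_left (β β' d : ZMod t → K0 A) :
    cotwist (β + β') d = cotwist β d * cotwist β' d := by
  simp [cotwist, chi_add_left, mul_comm, Finset.prod_mul_distrib]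

lemma cotwist_ne_zero (β d : ZMod t → K0 A) : cotwist β d ≠ 0 :=
  Finset.prod_ne_zero_iff.2 fun _ _ => inv_ne_zero (chi_ne_zero _ _)

/-- Each extension of `M` by `N'` maps onto one by `N` with kernel `K`, so its type is shifted by
the images of `K`; the scalar is the inverse Euler form of `M` and `K`. -/
lemma typeLin_mul_of_sub_acyclic (M : Cplx A t) {N K N' : Cplx A t} (s : Ses N K N')
    (hK : K.Acyclic) :
    typeLin A t (HallAlgebra.of (IsoClass.mk M) * HallAlgebra.of (IsoClass.mk N')) =
      twist (dimv M) (imv K) • shiftV (imv K)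
        (typeLin A t (HallAlgebra.of (IsoClass.mk M) * HallAlgebra.of (IsoClass.mk N))) := by
  rw [← euler_acyclic M hK]
  refine hallLin_mul_of_quotient (fun x => Finsupp.single (ctyp x) (1 : ℚ)) (shiftV (imv K)) M s (ext_acyclic_eq_zero M hK) ?_
  rintro L L' ⟨s'⟩
  rw [ctyp_mk, ctyp_mk, shiftV_single, s'.typ_of_acyclic_sub hK]
  rfl

/-- The counterpart for the left factor. A right factor with zero differential suffices, since the
action is defined through such factors. -/
lemma typeLin_mul_of_quot_acyclic (h : ZMod t → A) {N K N' : Cplx A t} (s : Ses K N N')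
    (hK : K.Acyclic) :
    typeLin A t (HallAlgebra.of (IsoClass.mk N') * HallAlgebra.of (IsoClass.mk (zeroCplx h))) =
      cotwist (imv K) (dimv (zeroCplx h)) • shiftV (imv K)
        (typeLin A t
          (HallAlgebra.of (IsoClass.mk N) * HallAlgebra.of (IsoClass.mk (zeroCplx h)))) := by
  rw [← euler_acyclic_zeroCplx h hK]
  refine hallLin_mul_of_sub (fun x => Finsupp.single (ctyp x) (1 : ℚ)) (shiftV (imv K)) (zeroCplx h) s (ext_to_zeroCplx_eq_zero h hK) ?_
  rintro L L' ⟨s'⟩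
  rw [ctyp_mk, ctyp_mk, shiftV_single, s'.typ_of_acyclic_quot hK]
  rfl

/-- `N` and its homology are both quotients of one complex with acyclic kernels. Computing the
product of `M` with that complex in both ways and comparing gives the formula. -/
lemma typeLin_mul_right (M N : Cplx A t) :
    typeLin A t (HallAlgebra.of (IsoClass.mk M) * HallAlgebra.of (IsoClass.mk N)) =
      twist (dimv M) (imv N) • shiftV (imv N)
        (typeLin A t (HallAlgebra.of (IsoClass.mk M) * HallAlgebra.of (Gc (hcls N)))) := by
  obtain ⟨P, K, K', hK, hK', ⟨s⟩, ⟨s'⟩⟩ := exists_zigzag N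
  have h1 := typeLin_mul_of_sub_acyclic M s hK
  have h2 := typeLin_mul_of_sub_acyclic M s' hK'
  have h3 : imv K' = imv K + imv N := by
    rw [← s.imv_of_acyclic_sub hK, s'.imv_of_acyclic_sub hK', imv_zeroCplx, add_zero]
  -- The twist by `K` is nonzero and cancels; the shift by `K` is then undone by the opposite shift.
  rw [h1, h3, twist_add_right, mul_smul, smul_right_injective _ (twist_ne_zero _ _) |>.eq_iff,
    ← Gc_hcls] at h2
  have h4 := congrArg (shiftV (-imv K)) h2
  rwa [shiftV_shiftV, neg_add_cancel, shiftV_zero, map_smul, shiftV_shiftV,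
    neg_add_cancel_left] at h4

/-- The same comparison, with a complex containing both `M` and its homology with acyclic cokernels.
-/
lemma typeLin_mul_left (M : Cplx A t) (h : ZMod t → A) :
    typeLin A t (HallAlgebra.of (IsoClass.mk M) * HallAlgebra.of (IsoClass.mk (zeroCplx h))) =
      (cotwist (imv M) (dimv (zeroCplx h))) • shiftV (imv M)
        (typeLin A t
          (HallAlgebra.of (Gc (hcls M)) * HallAlgebra.of (IsoClass.mk (zeroCplx h)))) := by
  obtain ⟨P, K, K', hK, hK', ⟨s⟩, ⟨s'⟩⟩ := exists_cozigzag M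
  have h1 := typeLin_mul_of_quot_acyclic h s hK
  have h2 := typeLin_mul_of_quot_acyclic h s' hK'
  have h3 : imv K' = imv K + imv M := by
    rw [add_comm, ← s.imv_of_acyclic_quot hK, s'.imv_of_acyclic_quot hK', imv_zeroCplx, zero_add]
  rw [h1, h3, cotwist_add_left, mul_smul, smul_right_injective _ (cotwist_ne_zero _ _) |>.eq_iff,
    ← Gc_hcls] at h2
  have h4 := congrArg (shiftV (-imv K)) h2
  rwa [shiftV_shiftV, neg_add_cancel, shiftV_zero, map_smul, shiftV_shiftV,
    neg_add_cancel_left] at h4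

lemma typeLin_mul_congr {M M' : Cplx A t} (hM : typ M = typ M') (h : ZMod t → IsoClass A) :
    typeLin A t (HallAlgebra.of (IsoClass.mk M) * HallAlgebra.of (Gc h)) =
      typeLin A t (HallAlgebra.of (IsoClass.mk M') * HallAlgebra.of (Gc h)) := by
  have h1 : hcls M = hcls M' := congrArg Prod.fst hM
  have h2 : imv M = imv M' := congrArg Prod.snd hM
  rw [Gc, typeLin_mul_left, typeLin_mul_left, h1, h2]

/-- The rescaling of the Hall algebra by the classes of the terms. -/
def rescale (γ : ZMod t → K0 A) : HallAlgebra (Cplx A t) →ₗ[ℚ] HallAlgebra (Cplx A t) :=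
  hallLin fun x => twist (cdim x) γ • HallAlgebra.of x

@[simp] lemma rescale_of (γ : ZMod t → K0 A) (x : IsoClass (Cplx A t)) :
    rescale γ (HallAlgebra.of x) = twist (cdim x) γ • HallAlgebra.of x := hallLin_of _ _

lemma hallAlgebra_induction {E : Type u} [Category.{v} E] [Abelian E] {p : HallAlgebra E → Prop}
    (a : HallAlgebra E) (h0 : p 0) (hadd : ∀ a b, p a → p b → p (a + b))
    (hof : ∀ (r : ℚ) (M : E), p (r • HallAlgebra.of (IsoClass.mk M))) : p a := by
  refine Finsupp.induction_linear (motive := p) a h0 hadd fun x r => ?_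
  have := hof r x.rep
  rw [IsoClass.mk_rep] at this
  have h : (r • HallAlgebra.of x : HallAlgebra E) = Finsupp.single x r :=
    (Finsupp.smul_single _ _ _).trans (by rw [smul_eq_mul, mul_one])
  rwa [h] at this

lemma hallAlgebra_hom_ext {E : Type u} [Category.{v} E] [Abelian E] {W : Type*} [AddCommGroup W]
    [Module ℚ W] {f g : HallAlgebra E →ₗ[ℚ] W}
    (h : ∀ M, f (HallAlgebra.of (IsoClass.mk M)) = g (HallAlgebra.of (IsoClass.mk M))) : f = g := by
  ext a
  induction a using hallAlgebra_induction with
  | h0 => rw [map_zero, map_zero]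
  | hadd a b ha hb => rw [map_add, map_add, ha, hb]
  | hof r M => rw [map_smul, map_smul, h]

/-- The classes of the terms are additive on extensions and `twist` is multiplicative in them, so
every middle term receives the product of the two scalars. -/
lemma rescale_mul (γ : ZMod t → K0 A) (a b : HallAlgebra (Cplx A t)) :
    rescale γ (a * b) = rescale γ a * rescale γ b := by
  have key : ∀ M N : Cplx A t,
      rescale γ (HallAlgebra.of (IsoClass.mk M) * HallAlgebra.of (IsoClass.mk N)) =
        rescale γ (HallAlgebra.of (IsoClass.mk M)) * rescale γ (HallAlgebra.of (IsoClass.mk N)) := by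
    intro M N
    have hid : hallLin (HallAlgebra.of (E := Cplx A t)) = LinearMap.id :=
      hallAlgebra_hom_ext fun M => hallLin_of _ _
    have h1 : HallAlgebra.of (IsoClass.mk M) * HallAlgebra.of (IsoClass.mk N) =
        hallLin HallAlgebra.of (HallAlgebra.of (IsoClass.mk M) * HallAlgebra.of (IsoClass.mk N)) := by
      rw [hid]; rfl
    rw [hallLin_mul] at h1
    refine (hallLin_mul (fun x => twist (cdim x) γ • HallAlgebra.of x) M N).trans ?_
    rw [rescale_of, rescale_of, smul_mul_smul_comm, h1, smul_comm _ (_⁻¹)]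
    congr 1
    rw [smul_finsum]
    refine finsum_congr fun e => ?_
    rw [cdim_mk, cdim_mk, cdim_mk, ← twist_add_left]
    congr 2
    funext i
    exact ((midSes e).dimv_eq i).trans (add_comm _ _)
  induction a using hallAlgebra_induction with
  | h0 => simp
  | hadd a a' ha ha' => rw [add_mul, map_add, ha, ha', map_add, add_mul]
  | hof r M =>
    induction b using hallAlgebra_induction with
    | h0 => simp
    | hadd a a' ha ha' => rw [mul_add, map_add, ha, ha', map_add, mul_add]
    | hof r' N => rw [smul_mul_smul_comm, map_smul, key, map_smul, map_smul, smul_mul_smul_comm]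

/-- The action of the Hall algebra on the space of types, on basis elements. -/
def actBasis (x : IsoClass (Cplx A t)) : (CplxType A t →₀ ℚ) →ₗ[ℚ] (CplxType A t →₀ ℚ) :=
  Finsupp.linearCombination ℚ fun τ => twist (cdim x) τ.2 •
    shiftV τ.2 (typeLin A t (HallAlgebra.of x * HallAlgebra.of (Gc τ.1)))

variable (A t) in
/-- The action of the Hall algebra on the space of types. -/
def actLin : HallAlgebra (Cplx A t) →ₗ[ℚ] Module.End ℚ (CplxType A t →₀ ℚ) := hallLin actBasis

lemma actLin_of (x : IsoClass (Cplx A t)) : actLin A t (HallAlgebra.of x) = actBasis x :=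
  hallLin_of _ _

/-- The formula of `typeLin_mul_right` is what `actBasis` takes as definition: the action turns left
multiplication into an operation on types. -/
lemma actLin_typeLin (a b : HallAlgebra (Cplx A t)) :
    actLin A t a (typeLin A t b) = typeLin A t (a * b) := by
  induction a using hallAlgebra_induction with
  | h0 => simp
  | hadd a a' ha ha' => rw [add_mul, map_add, LinearMap.add_apply, ha, ha', map_add]
  | hof r M =>
    induction b using hallAlgebra_induction with
    | h0 => simp
    | hadd a a' ha ha' => rw [mul_add, map_add, map_add, ha, ha', map_add]
    | hof r' N =>
      rw [map_smul, map_smul, LinearMap.smul_apply, map_smul, smul_mul_smul_comm, map_smul,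
        typeLin_mul_right, typeLin_of, actLin_of, actBasis, Finsupp.linearCombination_single,
        one_smul, cdim_mk, ctyp_mk, mul_smul]
      rfl

/-- The twist in the action is multiplicative in the image classes, so a shift passes the action at
the cost of `rescale`. -/
lemma actLin_shiftV (a : HallAlgebra (Cplx A t)) (γ : ZMod t → K0 A) (w : CplxType A t →₀ ℚ) :
    actLin A t a (shiftV γ w) = shiftV γ (actLin A t (rescale γ a) w) := by
  induction a using hallAlgebra_induction with
  | h0 => simp
  | hadd a a' ha ha' => simp only [map_add, LinearMap.add_apply, ha, ha']
  | hof r M =>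
    simp only [map_smul, LinearMap.smul_apply, rescale_of, actLin_of]
    congr 1
    induction w using Finsupp.induction_linear with
    | zero => simp
    | add w w' h h' => simp only [map_add, h, h', smul_add]
    | single τ r =>
      rw [shiftV_single, actBasis, Finsupp.linearCombination_single,
        Finsupp.linearCombination_single, map_smul, map_smul, shiftV_shiftV, twist_add_right,
        smul_comm _ r, mul_smul]

lemma rescale_one (γ : ZMod t → K0 A) : rescale γ (1 : HallAlgebra (Cplx A t)) = 1 := by
  have h1 : (1 : HallAlgebra (Cplx A t)) = HallAlgebra.of (IsoClass.mk 0) := rfl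
  have h0 : dimv (0 : Cplx A t) = 0 := by
    funext i
    have hz : IsZero ((0 : Cplx A t).X i) :=
      (HomologicalComplex.eval A _ i).map_isZero (isZero_zero _)
    exact (K0.cls_iso hz.isoZero).trans K0.cls_zero
  rw [h1, rescale_of, cdim_mk, h0, twist_zero_left, one_smul]

variable (A t) in
/-- The representation of the Hall algebra on the space of types. -/
def act : HallAlgebra (Cplx A t) →ₐ[ℚ] Module.End ℚ (CplxType A t →₀ ℚ) :=
  AlgHom.ofLinearMap (actLin A t)
    (typeEnd_ext fun γ b => by
      rw [actLin_shiftV, rescale_one, actLin_typeLin, one_mul]; rfl)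
    -- On vectors shifted by `γ` the action is rescaled left multiplication, so multiplicativity
    -- follows from associativity and `rescale_mul`.
    (fun a b => typeEnd_ext fun γ c => by
      rw [Module.End.mul_apply, actLin_shiftV, rescale_mul, actLin_typeLin, mul_assoc,
        ← actLin_typeLin, ← actLin_typeLin, ← actLin_shiftV, ← actLin_shiftV])

/-- The operator of `M` involves `M` only through the classes of its terms and products with
zero-differential complexes, and both depend only on its type. So the ideal acts by zero. -/
lemma act_of_congr {M M' : Cplx A t} (h : typ M = typ M') :
    act A t (HallAlgebra.of (IsoClass.mk M)) = act A t (HallAlgebra.of (IsoClass.mk M')) := by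
  change actLin A t _ = actLin A t _
  rw [actLin_of, actLin_of]
  refine Finsupp.lhom_ext fun τ r => ?_
  rw [actBasis, actBasis, Finsupp.linearCombination_single, Finsupp.linearCombination_single,
    typeLin_mul_congr h, cdim_mk, cdim_mk, dimv_eq_of_typ_eq h]

end Representation

/-! ### Fractions, and injectivity of the map to the space of types -/

section Injectivity

attribute [local instance] HasExt.standard

variable {A : Type u} [Category.{v} A] [Abelian A] {t : ℕ}

/-- The operator on the space of types shifting the classes of the images and rescaling the basis
elements. -/
def diagShift (c : CplxType A t → ℚ) (γ : ZMod t → K0 A) :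
    Module.End ℚ (CplxType A t →₀ ℚ) :=
  Finsupp.linearCombination ℚ fun x => Finsupp.single (x.1, γ + x.2) (c x)

@[simp] lemma diagShift_single (c : CplxType A t → ℚ) (γ : ZMod t → K0 A) (x : CplxType A t)
    (r : ℚ) : diagShift c γ (Finsupp.single x r) = Finsupp.single (x.1, γ + x.2) (r * c x) := by
  rw [diagShift, Finsupp.linearCombination_single, Finsupp.smul_single, smul_eq_mul]

lemma diagShift_mul (c c' : CplxType A t → ℚ) (γ γ' : ZMod t → K0 A) :
    diagShift c γ * diagShift c' γ' =
      diagShift (fun x => c' x * c (x.1, γ' + x.2)) (γ + γ') :=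
  Finsupp.lhom_ext fun x r => by
    rw [Module.End.mul_apply, diagShift_single, diagShift_single, diagShift_single, mul_assoc,
      add_assoc]

lemma diagShift_one : diagShift (A := A) (t := t) (fun _ => 1) 0 = 1 :=
  Finsupp.lhom_ext fun x r => by simp

/-- The inverse of `diagShift`. -/
def diagShiftInv (c : CplxType A t → ℚ) (γ : ZMod t → K0 A) :
    Module.End ℚ (CplxType A t →₀ ℚ) :=
  diagShift (fun x => (c (x.1, -γ + x.2))⁻¹) (-γ)

lemma diagShift_mul_inv (c : CplxType A t → ℚ) (γ : ZMod t → K0 A) (hc : ∀ x, c x ≠ 0) :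
    diagShift c γ * diagShiftInv c γ = 1 := by
  rw [diagShiftInv, diagShift_mul, ← diagShift_one, add_neg_cancel]
  congr 1
  funext x
  exact inv_mul_cancel₀ (hc _)

lemma diagShift_inv_mul (c : CplxType A t → ℚ) (γ : ZMod t → K0 A) (hc : ∀ x, c x ≠ 0) :
    diagShiftInv c γ * diagShift c γ = 1 := by
  rw [diagShiftInv, diagShift_mul, ← diagShift_one, neg_add_cancel]
  congr 1
  funext x
  rw [neg_add_cancel_left]
  exact mul_inv_cancel₀ (hc _)

lemma isUnit_diagShift (c : CplxType A t → ℚ) (γ : ZMod t → K0 A) (hc : ∀ x, c x ≠ 0) :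
    IsUnit (diagShift c γ) :=
  ⟨⟨_, _, diagShift_mul_inv c γ hc, diagShift_inv_mul c γ hc⟩, rfl⟩

lemma smul_diagShift (r : ℚ) (c : CplxType A t → ℚ) (γ : ZMod t → K0 A) :
    r • diagShift c γ = diagShift (fun x => r * c x) γ :=
  Finsupp.lhom_ext fun x s => by
    rw [LinearMap.smul_apply, diagShift_single, diagShift_single, Finsupp.smul_single, smul_eq_mul,
      mul_left_comm]

lemma acyclic_biprod {K K' : Cplx A t} (hK : K.Acyclic) (hK' : K'.Acyclic) :
    (K ⊞ K').Acyclic := fun i => by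
  rw [HomologicalComplex.exactAt_iff_isZero_homology]
  have h : hcls (K ⊞ K') i = hcls K i :=
    congrFun (congrArg Prod.fst ((Ses.biprod K K').typ_of_acyclic_sub hK')) i
  exact (Acyclic.isZero_homology hK i).of_iso (IsoClass.mk_eq_iff.1 h).some

variable [NeZero t] [FiniteHomExt A]

variable (A t) in
/-- The homomorphism from the Hall algebra to the semi-derived Ringel-Hall algebra. -/
def SDH.ofHall : HallAlgebra (Cplx A t) →ₐ[ℚ] SDH A t :=
  (Loc.incl (acyclicSet A t)).comp
    { (idealJ A t).ringCon.mk' with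
      commutes' := fun _ => rfl }

lemma SDH.of_congr {M M' : Cplx A t} (h : typ M = typ M') :
    SDH.of t (IsoClass.mk M) = SDH.of t (IsoClass.mk M') := by
  refine congrArg (Loc.incl (acyclicSet A t)) ?_
  refine (RingCon.eq _).2 ((TwoSidedIdeal.rel_iff _ _ _).2 ?_)
  exact TwoSidedIdeal.subset_span ⟨M, M', typ_eq_iff.1 h, rfl⟩

lemma SDH.hallLin_of : hallLin (SDH.of (A := A) t) = (SDH.ofHall A t).toLinearMap :=
  hallAlgebra_hom_ext fun _ => (SemiDerived.hallLin_of _ _).trans rfl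

lemma SDH.isUnit_acyclic {K : Cplx A t} (hK : K.Acyclic) : IsUnit (SDH.of t (IsoClass.mk K)) :=
  ⟨Loc.unit (acyclicSet A t) ⟨HallQuot.of (IsoClass.mk K), 1, K, one_ne_zero, hK,
    (one_smul ℚ _).symm⟩, rfl⟩

/-- The elements of the semi-derived Ringel-Hall algebra which are fractions with an acyclic complex
as denominator. -/
def SDH.IsFrac (x : SDH A t) : Prop :=
  ∃ (K : Cplx A t) (_ : K.Acyclic) (a : HallAlgebra (Cplx A t)),
    SDH.of t (IsoClass.mk K) * x = SDH.ofHall A t a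

lemma SDH.IsFrac.smul {x : SDH A t} (hx : SDH.IsFrac x) (r : ℚ) : SDH.IsFrac (r • x) := by
  obtain ⟨K, hK, a, h⟩ := hx
  exact ⟨K, hK, r • a, by rw [mul_smul_comm, h, map_smul]⟩

lemma SDH.of_mul_of_eq (M N : Cplx A t) (w : SDH A t)
    (h : ∀ L, Nonempty (Ses M N L) → SDH.of t (IsoClass.mk L) = w) :
    SDH.of t (IsoClass.mk M) * SDH.of t (IsoClass.mk N) = (euler M N)⁻¹ • w := by
  rw [← hallLin_mul_of_forall_eq (SDH.of t) M N w h, SDH.hallLin_of]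
  exact (map_mul (SDH.ofHall A t) _ _).symm

/-- A class in the localization depends only on the type of the complex, so the map from the Hall
algebra factors through `typeLin`. -/
lemma SDH.ofHall_eq_zero {a : HallAlgebra (Cplx A t)} (h : SemiDerived.typeLin A t a = 0) :
    SDH.ofHall A t a = 0 := by
  classical
  -- Pairs that are not the type of any complex are sent to 0; the value there is irrelevant.
  let σ : (CplxType A t →₀ ℚ) →ₗ[ℚ] SDH A t := Finsupp.linearCombination ℚ fun τ =>
    if h : ∃ M : Cplx A t, typ M = τ then SDH.of t (IsoClass.mk h.choose) else 0
  have hσ : σ ∘ₗ SemiDerived.typeLin A t = (SDH.ofHall A t).toLinearMap := by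
    refine hallAlgebra_hom_ext fun M => ?_
    have hM : ∃ M' : Cplx A t, typ M' = typ M := ⟨M, rfl⟩
    rw [LinearMap.comp_apply, SemiDerived.typeLin_of, ctyp_mk, Finsupp.linearCombination_single,
      one_smul, dif_pos hM]
    exact SDH.of_congr hM.choose_spec
  have := congrArg (fun f => f a) hσ
  exact this.symm.trans ((congrArg σ h).trans (map_zero σ))

/-- All extensions have the type of the direct sum. The same holds in the opposite order, which
yields the commutation rule used as the Ore condition. -/
lemma SDH.of_mul_acyclic (M : Cplx A t) {K : Cplx A t} (hK : K.Acyclic) :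
    SDH.of t (IsoClass.mk M) * SDH.of t (IsoClass.mk K) =
      (euler M K)⁻¹ • SDH.of t (IsoClass.mk (M ⊞ K)) :=
  SDH.of_mul_of_eq _ _ _ fun _ ⟨s⟩ => SDH.of_congr
    ((s.typ_of_acyclic_sub hK).trans ((Ses.biprod M K).typ_of_acyclic_sub hK).symm)

lemma SDH.acyclic_mul_of (M : Cplx A t) {K : Cplx A t} (hK : K.Acyclic) :
    SDH.of t (IsoClass.mk K) * SDH.of t (IsoClass.mk M) =
      (euler K M)⁻¹ • SDH.of t (IsoClass.mk (M ⊞ K)) :=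
  SDH.of_mul_of_eq _ _ _ fun _ ⟨s⟩ => SDH.of_congr
    ((s.typ_of_acyclic_quot hK).trans ((Ses.biprod M K).typ_of_acyclic_sub hK).symm)

lemma SDH.commute (M : Cplx A t) {K : Cplx A t} (hK : K.Acyclic) :
    SDH.of t (IsoClass.mk K) * SDH.of t (IsoClass.mk M) =
      (euler M K / euler K M) • (SDH.of t (IsoClass.mk M) * SDH.of t (IsoClass.mk K)) := by
  rw [SDH.of_mul_acyclic M hK, SDH.acyclic_mul_of M hK, smul_smul, div_eq_mul_inv, mul_right_comm,
    mul_inv_cancel₀ (euler_ne_zero _ _), one_mul]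

/-- The sum of the two denominators is a common denominator, being proportional to their product in
either order. -/
lemma SDH.IsFrac.add {x y : SDH A t} (hx : SDH.IsFrac x) (hy : SDH.IsFrac y) :
    SDH.IsFrac (x + y) := by
  obtain ⟨K, hK, a, h⟩ := hx
  obtain ⟨K', hK', b, h'⟩ := hy
  have h1 : ∀ z, SDH.of t (IsoClass.mk (K' ⊞ K)) * z =
      euler K' K • (SDH.of t (IsoClass.mk K') * (SDH.of t (IsoClass.mk K) * z)) := fun z => by
    rw [← mul_assoc, SDH.of_mul_acyclic K' hK, smul_mul_assoc, smul_smul,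
      mul_inv_cancel₀ (euler_ne_zero _ _), one_smul]
  have h2 : ∀ z, SDH.of t (IsoClass.mk (K' ⊞ K)) * z =
      euler K K' • (SDH.of t (IsoClass.mk K) * (SDH.of t (IsoClass.mk K') * z)) := fun z => by
    rw [← mul_assoc, SDH.acyclic_mul_of K' hK, smul_mul_assoc, smul_smul,
      mul_inv_cancel₀ (euler_ne_zero _ _), one_smul]
  refine ⟨K' ⊞ K, acyclic_biprod hK' hK,
    euler K' K • (HallAlgebra.of (IsoClass.mk K') * a) +
      euler K K' • (HallAlgebra.of (IsoClass.mk K) * b), ?_⟩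
  rw [mul_add, h1 x, h2 y, h, h', map_add, map_smul, map_smul, map_mul, map_mul]
  rfl

lemma SDH.IsFrac.of_mul {x : SDH A t} (hx : SDH.IsFrac x) (M : Cplx A t) :
    SDH.IsFrac (SDH.of t (IsoClass.mk M) * x) := by
  obtain ⟨K, hK, a, h⟩ := hx
  refine ⟨K, hK, (euler M K / euler K M) • (HallAlgebra.of (IsoClass.mk M) * a), ?_⟩
  rw [← mul_assoc, SDH.commute M hK, smul_mul_assoc, mul_assoc, h, map_smul, map_mul]
  rfl

lemma SDH.IsFrac.ofHall_mul {x : SDH A t} (hx : SDH.IsFrac x) (a : HallAlgebra (Cplx A t)) :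
    SDH.IsFrac (SDH.ofHall A t a * x) := by
  induction a using hallAlgebra_induction with
  | h0 =>
    rw [map_zero, zero_mul, ← zero_smul ℚ x]
    exact hx.smul 0
  | hadd a b ha hb =>
    rw [map_add, add_mul]
    exact ha.add hb
  | hof r M =>
    rw [map_smul, smul_mul_assoc]
    exact (hx.of_mul M).smul r

/-- The fractions contain 1 and are stable under left multiplication by every generator: Hall
elements commute with denominators up to scalars, and inverses enlarge the denominator. -/
lemma SDH.isFrac (x : SDH A t) : SDH.IsFrac x := by
  have h1 : SDH.IsFrac (1 : SDH A t) :=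
    ⟨elemAcyclic t 0 0, elemAcyclic_acyclic 0 0, HallAlgebra.of (IsoClass.mk (elemAcyclic t 0 0)),
      mul_one _⟩
  have key : ∀ z : FreeAlgebra ℚ (HallQuot A t ⊕ acyclicSet A t), ∀ y : SDH A t, SDH.IsFrac y →
      SDH.IsFrac (Loc.proj (acyclicSet A t) z * y) := by
    intro z
    induction z using FreeAlgebra.induction with
    | grade0 r =>
      intro y hy
      rw [AlgHom.commutes, ← Algebra.smul_def]
      exact hy.smul r
    | grade1 z =>
      intro y hy
      rcases z with a | ⟨_, r, K', hr, hK', rfl⟩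
      · obtain ⟨a, rfl⟩ := RingCon.mk'_surjective _ a
        exact hy.ofHall_mul a
      · obtain ⟨K, hK, a, h⟩ := hy
        let u : (SDH A t)ˣ := Loc.unit (acyclicSet A t) ⟨_, r, K', hr, hK', rfl⟩
        have hu : (u : SDH A t) = r • SDH.of t (IsoClass.mk K') := map_smul _ _ _
        have hu' : SDH.of t (IsoClass.mk K') * (u⁻¹ : (SDH A t)ˣ) = r⁻¹ • 1 := by
          rw [← u.mul_inv, hu, smul_mul_assoc, smul_smul, inv_mul_cancel₀ hr, one_smul]
        change SDH.IsFrac (((u⁻¹ : (SDH A t)ˣ) : SDH A t) * y)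
        have h2 : SDH.of t (IsoClass.mk (K ⊞ K')) = euler K K' •
            (SDH.of t (IsoClass.mk K) * SDH.of t (IsoClass.mk K')) := by
          rw [SDH.of_mul_acyclic K hK', smul_smul, mul_inv_cancel₀ (euler_ne_zero _ _), one_smul]
        -- The class of `K ⊞ K'` is a multiple of the product of those of `K` and `K'`, whose second
        -- factor cancels the inverse up to `r`.
        refine ⟨K ⊞ K', acyclic_biprod hK hK', (euler K K' * r⁻¹) • a, ?_⟩
        rw [h2, smul_mul_assoc, mul_assoc, ← mul_assoc (SDH.of t (IsoClass.mk K')), hu',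
          smul_mul_assoc, one_mul, mul_smul_comm, h, smul_smul, map_smul]
    | mul a b ha hb =>
      intro y hy
      rw [map_mul, mul_assoc]
      exact ha _ (hb _ hy)
    | add a b ha hb =>
      intro y hy
      rw [map_add, add_mul]
      exact (ha _ hy).add (hb _ hy)
  obtain ⟨z, rfl⟩ : ∃ z, Loc.proj (acyclicSet A t) z = x := RingQuot.mkAlgHom_surjective ℚ _ x
  rw [← mul_one (Loc.proj _ z)]
  exact key z 1 h1

variable [Hereditary A]

/-- The coefficients of the action of an acyclic complex on the space of types. -/
def acyclicCoeff (K : Cplx A t) (x : CplxType A t) : ℚ :=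
  twist (dimv K) x.2 * cotwist (imv K) (cdim (Gc x.1))

lemma acyclicCoeff_ne_zero (K : Cplx A t) (x : CplxType A t) : acyclicCoeff K x ≠ 0 :=
  mul_ne_zero (twist_ne_zero _ _) (cotwist_ne_zero _ _)

/-- All extensions of `K` by a complex with zero differential have the same type, so basis vectors
go to nonzero multiples of basis vectors. -/
lemma act_acyclic {K : Cplx A t} (hK : K.Acyclic) :
    act A t (HallAlgebra.of (IsoClass.mk K)) = diagShift (acyclicCoeff K) (imv K) := by
  refine Finsupp.lhom_ext fun x r => ?_
  have h1 : typeLin A t (HallAlgebra.of (IsoClass.mk K) * HallAlgebra.of (Gc x.1)) =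
      cotwist (imv K) (cdim (Gc x.1)) • Finsupp.single (x.1, imv K) 1 := by
    rw [Gc, cdim_mk, ← euler_acyclic_zeroCplx _ hK]
    refine hallLin_mul_of_forall_eq (fun x => Finsupp.single (ctyp x) (1 : ℚ)) _ _ _ ?_
    rintro L ⟨s⟩
    rw [ctyp_mk, s.typ_of_acyclic_quot hK, imv_zeroCplx, add_zero, hcls_zeroCplx]
    simp only [IsoClass.mk_rep]
  change actLin A t _ _ = _
  rw [actLin_of, actBasis, Finsupp.linearCombination_single, h1, cdim_mk, diagShift_single,
    map_smul, shiftV_single, smul_smul, Finsupp.smul_single, Finsupp.smul_single, acyclicCoeff,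
    smul_eq_mul, smul_eq_mul, mul_one, mul_assoc, add_comm x.2]

variable (A t) in
/-- The representation of the quotient algebra on the space of types. -/
def actQuot : HallQuot A t →ₐ[ℚ] Module.End ℚ (CplxType A t →₀ ℚ) :=
  (idealJ A t).ringCon.liftₐ (act A t) (by
    have h : idealJ A t ≤ TwoSidedIdeal.ker (act A t) := TwoSidedIdeal.span_le.2 (by
      rintro x ⟨M₁, M₂, h, rfl⟩
      refine (TwoSidedIdeal.mem_ker _).2 ?_
      rw [map_sub, act_of_congr (typ_eq_iff.2 h), sub_self])
    exact TwoSidedIdeal.ringCon_le_iff.1 h)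

/-- The acyclic denominators act by invertible operators, so the universal property of the
localization applies. -/
lemma exists_actLoc : ∃ g : SDH A t →ₐ[ℚ] Module.End ℚ (CplxType A t →₀ ℚ),
    g.comp (Loc.incl (acyclicSet A t)) = actQuot A t := by
  refine (Loc.existsUnique_lift (acyclicSet A t) (actQuot A t) ?_).exists
  rintro ⟨_, r, K, hr, hK, rfl⟩
  have h : actQuot A t (HallQuot.of (IsoClass.mk K)) = diagShift (acyclicCoeff K) (imv K) :=
    act_acyclic hK
  rw [map_smul, h, smul_diagShift]
  exact isUnit_diagShift _ _ fun x => mul_ne_zero hr (acyclicCoeff_ne_zero K x)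

variable (A t) in
/-- The representation of the semi-derived Ringel-Hall algebra on the space of types. -/
def actLoc : SDH A t →ₐ[ℚ] Module.End ℚ (CplxType A t →₀ ℚ) := exists_actLoc.choose

lemma actLoc_ofHall (a : HallAlgebra (Cplx A t)) :
    actLoc A t (SDH.ofHall A t a) = act A t a :=
  congrArg (fun f => f ((idealJ A t).ringCon.mk' a)) (exists_actLoc (A := A) (t := t)).choose_spec

lemma actLoc_acyclic {K : Cplx A t} (hK : K.Acyclic) :
    actLoc A t (SDH.of t (IsoClass.mk K)) = diagShift (acyclicCoeff K) (imv K) :=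
  (actLoc_ofHall _).trans (act_acyclic hK)

variable (A t) in
/-- The linear map recording the types of complexes. -/
def SDH.typeLin : SDH A t →ₗ[ℚ] (CplxType A t →₀ ℚ) :=
  (LinearMap.applyₗ (SemiDerived.typeLin A t 1)).comp (actLoc A t).toLinearMap

lemma SDH.typeLin_apply (x : SDH A t) :
    SDH.typeLin A t x = actLoc A t x (SemiDerived.typeLin A t 1) := rfl

lemma SDH.typeLin_mul (x y : SDH A t) :
    SDH.typeLin A t (x * y) = actLoc A t x (SDH.typeLin A t y) := by
  rw [SDH.typeLin_apply, map_mul]; rfl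

lemma SDH.typeLin_ofHall (a : HallAlgebra (Cplx A t)) :
    SDH.typeLin A t (SDH.ofHall A t a) = SemiDerived.typeLin A t a := by
  rw [SDH.typeLin_apply, actLoc_ofHall]
  exact (actLin_typeLin a 1).trans (by rw [mul_one])

/-- If `x` has zero image and `K` times `x` comes from a Hall element `a`, then the type vector of
`a` is the action of `K` on zero. So `a` dies in the localization, and `K` is invertible there. -/
lemma SDH.typeLin_injective : Function.Injective (SDH.typeLin A t) := by
  refine (injective_iff_map_eq_zero _).2 fun x hx => ?_
  obtain ⟨K, hK, a, h⟩ := SDH.isFrac x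
  have h1 : SemiDerived.typeLin A t a = 0 := by
    rw [← SDH.typeLin_ofHall, ← h, SDH.typeLin_mul, hx, map_zero]
  rw [SDH.ofHall_eq_zero h1] at h
  exact (SDH.isUnit_acyclic hK).mul_right_eq_zero.1 h

end Injectivity

/-! ### A measure decreasing under kernel and cokernel -/

section Measure

attribute [local instance] HasExt.standard

variable {A : Type u} [Category.{v} A] [Abelian A] [FiniteHomExt A]

lemma Ses.card_hom_le_covariant {X Y Z : A} (s : Ses Z X Y) (W : A) :
    Nat.card (W ⟶ X) ≤ Nat.card (W ⟶ Y) :=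
  have := FiniteHomExt.finite_hom W Y
  Nat.card_le_card_of_injective (fun f => f ≫ s.i) fun _ _ h => (cancel_mono s.i).1 h

lemma Ses.card_hom_le_contravariant {X Y Z : A} (s : Ses Z X Y) (W : A) :
    Nat.card (Z ⟶ W) ≤ Nat.card (Y ⟶ W) :=
  have := FiniteHomExt.finite_hom Y W
  Nat.card_le_card_of_injective (fun f => s.p ≫ f) fun _ _ h => (cancel_epi s.p).1 h

/-- Composition with `s.i` embeds the left set in the endomorphisms of `Y`. Were the cardinalities
equal, the identity would factor through `s.i`, forcing `s.p` to vanish. -/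
lemma Ses.card_hom_lt {X Y Z : A} (s : Ses Z X Y) (hZ : ¬ IsZero Z) :
    Nat.card (Y ⟶ X) < Nat.card (Y ⟶ Y) := by
  have := FiniteHomExt.finite_hom Y Y
  refine (s.card_hom_le_covariant Y).lt_of_ne fun h => hZ ?_
  have hinj : Function.Injective fun f : Y ⟶ X => f ≫ s.i := fun _ _ h => (cancel_mono s.i).1 h
  obtain ⟨y, hy⟩ := (hinj.bijective_of_nat_card_le h.ge).2 (𝟙 Y)
  have hp : s.p = 0 := by
    rw [← Category.id_comp s.p, ← hy]
    simp [s.w]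
  rw [IsZero.iff_id_eq_zero, ← cancel_epi s.p, hp, zero_comp, zero_comp]

variable [Hereditary A]

lemma Ses.card_ext_le_covariant {X Y Z : A} (s : Ses Z X Y) (W : A) :
    Nat.card (Abelian.Ext.{max u v} W Z 1) ≤ Nat.card (Abelian.Ext.{max u v} W Y 1) :=
  have := FiniteHomExt.finite_ext W Y
  Nat.card_le_card_of_surjective (fun e => e.comp (Ext.mk₀ s.p) (add_zero 1)) fun e =>
    Ext.covariant_sequence_exact₃ W s.exact e (rfl : 1 + 1 = 2)
      (Hereditary.ext_eq_zero _ _ _ le_rfl _)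

lemma Ses.card_ext_le_contravariant {X Y Z : A} (s : Ses Z X Y) (W : A) :
    Nat.card (Abelian.Ext.{max u v} X W 1) ≤ Nat.card (Abelian.Ext.{max u v} Y W 1) :=
  have := FiniteHomExt.finite_ext Y W
  Nat.card_le_card_of_surjective (fun e => (Ext.mk₀ s.i).comp e (zero_add 1)) fun e =>
    Ext.contravariant_sequence_exact₁ s.exact W e (rfl : 1 + 1 = 2)
      (Hereditary.ext_eq_zero _ _ _ le_rfl _)

/-- The six-term count, in which one factor is bounded using heredity: an epimorphism induces a
surjection on `Ext` of degree 1. The next three bounds likewise estimate one factor of a six-term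
count. -/
lemma Ses.card_hom_mul_hom_le_covariant {X Y Z : A} (s : Ses Z X Y) (W : A) :
    Nat.card (W ⟶ Z) * Nat.card (W ⟶ X) ≤
      Nat.card (W ⟶ Y) * Nat.card (Abelian.Ext.{max u v} W X 1) := by
  have h := s.card_covariant W (Hereditary.ext_eq_zero _ _ _ le_rfl)
  rw [← card_hom_eq, ← card_hom_eq, ← card_hom_eq] at h
  have := FiniteHomExt.finite_ext W Y
  refine le_of_mul_le_mul_right ?_ (Nat.card_pos (α := Abelian.Ext.{max u v} W Y 1))
  rw [mul_comm (Nat.card (W ⟶ Z)), h]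
  exact Nat.mul_le_mul_left _ (s.card_ext_le_covariant W)

lemma Ses.card_ext_mul_ext_le_covariant {X Y Z : A} (s : Ses Z X Y) (W : A) :
    Nat.card (Abelian.Ext.{max u v} W X 1) * Nat.card (Abelian.Ext.{max u v} W Z 1) ≤
      Nat.card (W ⟶ Z) * Nat.card (Abelian.Ext.{max u v} W Y 1) := by
  have h := s.card_covariant W (Hereditary.ext_eq_zero _ _ _ le_rfl)
  rw [← card_hom_eq, ← card_hom_eq, ← card_hom_eq] at h
  have := FiniteHomExt.finite_hom W Y
  refine le_of_mul_le_mul_left ?_ (Nat.card_pos (α := (W ⟶ Y)))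
  rw [← mul_assoc, ← h, mul_assoc]
  exact Nat.mul_le_mul_right _ (s.card_hom_le_covariant W)

lemma Ses.card_hom_mul_hom_le_contravariant {X Y Z : A} (s : Ses Z X Y) (W : A) :
    Nat.card (Z ⟶ W) * Nat.card (X ⟶ W) ≤
      Nat.card (Y ⟶ W) * Nat.card (Abelian.Ext.{max u v} Z W 1) := by
  have h := s.card_contravariant W (Hereditary.ext_eq_zero _ _ _ le_rfl)
  rw [← card_hom_eq, ← card_hom_eq, ← card_hom_eq] at h
  have := FiniteHomExt.finite_ext Y W
  refine le_of_mul_le_mul_right ?_ (Nat.card_pos (α := Abelian.Ext.{max u v} Y W 1))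
  rw [h]
  exact Nat.mul_le_mul_left _ (s.card_ext_le_contravariant W)

lemma Ses.card_ext_mul_ext_le_contravariant {X Y Z : A} (s : Ses Z X Y) (W : A) :
    Nat.card (Abelian.Ext.{max u v} Z W 1) * Nat.card (Abelian.Ext.{max u v} X W 1) ≤
      Nat.card (X ⟶ W) * Nat.card (Abelian.Ext.{max u v} Y W 1) := by
  have h := s.card_contravariant W (Hereditary.ext_eq_zero _ _ _ le_rfl)
  rw [← card_hom_eq, ← card_hom_eq, ← card_hom_eq] at h
  have := FiniteHomExt.finite_hom Y W
  refine le_of_mul_le_mul_left ?_ (Nat.card_pos (α := (Y ⟶ W)))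
  rw [← mul_assoc, ← h, mul_assoc]
  exact Nat.mul_le_mul_right _ (s.card_hom_le_contravariant W)

/-- A measure of the size of a pair of objects which decreases on passing to the kernel and the
cokernel of a nonzero morphism. -/
def extMeasure (X B : A) : ℕ :=
  Nat.card (X ⟶ X) * Nat.card (B ⟶ B) * Nat.card (Abelian.Ext.{max u v} B X 1)

/-- One passes from `X`, `B` to `K`, `Q` one variable at a time. In `h7` and `h8` two bounds are
multiplied so that the factors involving the image `I` cancel. Strictness comes from |Hom(X, K)| <
|End X|, valid as `I` is nonzero. -/
lemma extMeasure_lt {X B K I Q : A} (s₁ : Ses I K X) (s₂ : Ses Q I B) (hI : ¬ IsZero I) :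
    extMeasure K Q < extMeasure X B := by
  have hfin := FiniteHomExt.finite_hom (E := A)
  have hfin' := FiniteHomExt.finite_ext (E := A)
  have h1 := s₂.card_hom_mul_hom_le_covariant B
  have h2 := s₁.card_ext_mul_ext_le_covariant B
  have h3 := s₁.card_hom_mul_hom_le_contravariant K
  have h4 := s₂.card_ext_mul_ext_le_contravariant K
  have h5 := s₁.card_hom_lt hI
  have h6 := s₂.card_hom_le_contravariant Q
  have h7 : Nat.card (B ⟶ Q) * Nat.card (Abelian.Ext.{max u v} B K 1) ≤
      Nat.card (B ⟶ B) * Nat.card (Abelian.Ext.{max u v} B X 1) := by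
    refine le_of_mul_le_mul_right ?_ (Nat.mul_pos (Nat.card_pos (α := (B ⟶ I)))
      (Nat.card_pos (α := Abelian.Ext.{max u v} B I 1)))
    calc _ = (Nat.card (B ⟶ Q) * Nat.card (B ⟶ I)) *
          (Nat.card (Abelian.Ext.{max u v} B K 1) * Nat.card (Abelian.Ext.{max u v} B I 1)) := by
          ring
      _ ≤ _ := Nat.mul_le_mul h1 h2
      _ = _ := by ring
  have h8 : Nat.card (Abelian.Ext.{max u v} Q K 1) * Nat.card (K ⟶ K) ≤
      Nat.card (Abelian.Ext.{max u v} B K 1) * Nat.card (X ⟶ K) := by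
    refine le_of_mul_le_mul_right ?_ (Nat.mul_pos (Nat.card_pos (α := (I ⟶ K)))
      (Nat.card_pos (α := Abelian.Ext.{max u v} I K 1)))
    calc _ = (Nat.card (I ⟶ K) * Nat.card (K ⟶ K)) *
          (Nat.card (Abelian.Ext.{max u v} Q K 1) * Nat.card (Abelian.Ext.{max u v} I K 1)) := by
          ring
      _ ≤ _ := Nat.mul_le_mul h3 h4
      _ = _ := by ring
  calc extMeasure K Q = (Nat.card (Abelian.Ext.{max u v} Q K 1) * Nat.card (K ⟶ K)) *
        Nat.card (Q ⟶ Q) := by rw [extMeasure]; ring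
    _ ≤ (Nat.card (Abelian.Ext.{max u v} B K 1) * Nat.card (X ⟶ K)) * Nat.card (B ⟶ Q) :=
        Nat.mul_le_mul h8 h6
    _ = (Nat.card (B ⟶ Q) * Nat.card (Abelian.Ext.{max u v} B K 1)) * Nat.card (X ⟶ K) := by ring
    _ ≤ (Nat.card (B ⟶ B) * Nat.card (Abelian.Ext.{max u v} B X 1)) * Nat.card (X ⟶ K) :=
        Nat.mul_le_mul_right _ h7
    _ < (Nat.card (B ⟶ B) * Nat.card (Abelian.Ext.{max u v} B X 1)) * Nat.card (X ⟶ X) :=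
        Nat.mul_lt_mul_of_pos_left h5 (Nat.mul_pos Nat.card_pos Nat.card_pos)
    _ = extMeasure X B := by rw [extMeasure]; ring

end Measure

/-! ### Extensions of a stalk complex by a complex with zero differential -/

section StalkExtensions

open HomologicalComplex

variable {A : Type u} [Category.{v} A] [Abelian A] {t : ℕ}

lemma hcls_eq_of_d_to (L : Cplx A t) {i j : ZMod t} (hij : i + 1 = j) (h : L.d i j = 0) :
    hcls L j = IsoClass.mk (L.cycles j) := by
  have hp : IsIso (L.homologyπ j) :=
    L.isIso_homologyπ i j ((ComplexShape.up (ZMod t)).prev_eq' hij) h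
  exact IsoClass.mk_eq_iff.2 ⟨(asIso (L.homologyπ j)).symm⟩

lemma hcls_eq_of_d_from (L : Cplx A t) {i : ZMod t} (h : L.d i (i + 1) = 0) :
    hcls L i = IsoClass.mk (L.opcycles i) := by
  have hp : IsIso (L.homologyι i) :=
    L.isIso_homologyι i (i + 1) ((ComplexShape.up (ZMod t)).next_eq' rfl) h
  exact IsoClass.mk_eq_iff.2 ⟨asIso (L.homologyι i)⟩

lemma hcls_eq_of_d (L : Cplx A t) {i j : ZMod t} (hij : i + 1 = j) (h : L.d i j = 0)
    (h' : L.d j (j + 1) = 0) : hcls L j = IsoClass.mk (L.X j) := by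
  have hp : IsIso (L.iCycles j) :=
    L.isIso_iCycles j (j + 1) ((ComplexShape.up (ZMod t)).next_eq' rfl) h'
  rw [hcls_eq_of_d_to L hij h]
  exact IsoClass.mk_eq_iff.2 ⟨asIso (L.iCycles j)⟩

lemma isZero_bd_iff (L : Cplx A t) (i : ZMod t) : IsZero (bd L i) ↔ L.d i (i + 1) = 0 := by
  constructor
  · intro h
    rw [← Limits.image.fac (L.d i (i + 1)), h.eq_of_src (Limits.image.ι _) 0, comp_zero]
  · intro h
    rw [IsZero.iff_id_eq_zero, ← cancel_epi (factorThruImage _), ← cancel_mono (Limits.image.ι _)]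
    simpa using h

lemma typ_of_d_eq_zero {L : Cplx A t} (h : ∀ i, L.d i (i + 1) = 0) :
    typ L = (fun i => IsoClass.mk (L.X i), 0) := by
  refine Prod.ext (funext fun i => ?_) (funext fun i => ?_)
  · have h' := h (i - 1)
    rw [sub_add_cancel] at h'
    exact hcls_eq_of_d L (sub_add_cancel i 1) h' (h i)
  · exact (K0.cls_iso ((isZero_bd_iff L i).2 (h i)).isoZero).trans K0.cls_zero

/-- The boundaries and the opcycles. -/
def bdSes (L : Cplx A t) (i : ZMod t) : Ses (L.opcycles (i + 1)) (bd L i) (L.X (i + 1)) :=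
  Ses.ofDesc (Limits.image.ι (L.d i (i + 1))) (L.pOpcycles (i + 1))
    (by rw [← cancel_epi (factorThruImage (L.d i (i + 1))), ← Category.assoc, Limits.image.fac,
      L.d_pOpcycles, comp_zero])
    (fun T x hx => exists_desc_opcycles L x (by
      rw [← Limits.image.fac (L.d i (i + 1)), Category.assoc, hx, comp_zero]))

variable {X : A} {j : ZMod t} {g : ZMod t → A} {L : Cplx A t}

lemma Ses.isIso_i_f_of_ne (s : Ses (stalk t X j) (zeroCplx g) L) {i : ZMod t} (hi : i ≠ j) :
    IsIso (s.i.f i) :=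
  (s.eval i).exact.isIso_f_iff.2 (isZero_single_obj_X (ComplexShape.up (ZMod t)) j X i hi)

lemma Ses.isIso_p_f_of_isZero (s : Ses (stalk t X j) (zeroCplx g) L) (hg : IsZero (g j)) :
    IsIso (s.p.f j) :=
  (s.eval j).exact.isIso_g_iff.2 hg

/-- Outside degree `j` the term of `L` comes from the subcomplex, whose differential is zero. -/
lemma Ses.d_eq_zero_of_ne (s : Ses (stalk t X j) (zeroCplx g) L) {i : ZMod t} (hi : i ≠ j) :
    L.d i (i + 1) = 0 := by
  have := s.isIso_i_f_of_ne hi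
  rw [← cancel_epi (s.i.f i), comp_zero, s.i.comm]
  exact zero_comp

lemma Ses.mk_X_eq (s : Ses (stalk t X j) (zeroCplx g) L) (hg : IsZero (g j)) :
    (fun i => IsoClass.mk (L.X i)) =
      Function.update (fun i => IsoClass.mk (g i)) j (IsoClass.mk X) := by
  funext i
  by_cases hi : i = j
  · subst hi
    have := s.isIso_p_f_of_isZero hg
    rw [Function.update_self]
    exact IsoClass.mk_eq_iff.2 ⟨asIso (s.p.f i) ≪≫ singleObjXSelf _ i X⟩
  · have := s.isIso_i_f_of_ne hi
    rw [Function.update_of_ne hi]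
    exact IsoClass.mk_eq_iff.2 ⟨(asIso (s.i.f i)).symm⟩

lemma Ses.typ_of_d_eq_zero (s : Ses (stalk t X j) (zeroCplx g) L) (hg : IsZero (g j))
    (hd : L.d j (j + 1) = 0) :
    typ L = (Function.update (fun i => IsoClass.mk (g i)) j (IsoClass.mk X), 0) := by
  rw [SemiDerived.typ_of_d_eq_zero fun i => ?_, s.mk_X_eq hg]
  by_cases hi : i = j
  · rw [hi, hd]
  · exact s.d_eq_zero_of_ne hi

variable [FiniteHomExt A] [Hereditary A]

/-- A measure of the size of graded objects. -/
def typeMeasure (j : ZMod t) (h : ZMod t → IsoClass A) : ℕ :=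
  extMeasure (h j).rep (h (j + 1)).rep

/-- Only the differential out of degree `j` is nonzero, so the homology in degrees `j` and `j + 1`
consists of its kernel and its cokernel. -/
lemma Ses.typeMeasure_lt (s : Ses (stalk t X j) (zeroCplx g) L) (hj : j + 1 ≠ j)
    (hg : IsZero (g j)) (hd : L.d j (j + 1) ≠ 0) :
    typeMeasure j (hcls L) <
      typeMeasure j (Function.update (fun i => IsoClass.mk (g i)) j (IsoClass.mk X)) := by
  rw [← s.mk_X_eq hg]
  have h1 : hcls L j = IsoClass.mk (L.cycles j) :=
    hcls_eq_of_d_to L (sub_add_cancel j 1) (by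
      have h := s.d_eq_zero_of_ne (i := j - 1) (fun h => hj (by rw [← sub_eq_iff_eq_add.1 h]))
      rwa [sub_add_cancel] at h)
  have h2 : hcls L (j + 1) = IsoClass.mk (L.opcycles (j + 1)) :=
    hcls_eq_of_d_from L (s.d_eq_zero_of_ne hj)
  rw [typeMeasure, typeMeasure, h1, h2]
  have e := fun Y : A => (IsoClass.nonempty_iso Y).some.symm
  exact extMeasure_lt ((cyclesSes L j).map (Iso.refl _) (e _) (e _))
    ((bdSes L j).map (e _) (Iso.refl _) (e _)) fun h => hd ((isZero_bd_iff L j).1 h)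

end StalkExtensions

/-! ### Triangular families -/

section Triangular

/-- A family which is triangular, with nonzero diagonal entries, with respect to the standard basis is
linearly independent and spans. -/
lemma triangular_linearIndependent {κ : Type*} (μ : κ → ℕ) (w : κ → (κ →₀ ℚ)) (c : κ → ℚ)
    (hc : ∀ k, c k ≠ 0)
    (hw : ∀ k, w k - Finsupp.single k (c k) ∈ Finsupp.supported ℚ ℚ {l | μ l < μ k}) :
    LinearIndependent ℚ w := by
  have hcoord : ∀ k l, μ k ≤ μ l → w k l = Finsupp.single k (c k) l := fun k l hkl => by
    have h := (Finsupp.mem_supported' ℚ _).1 (hw k) l (by simpa using hkl)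
    rwa [Finsupp.sub_apply, sub_eq_zero] at h
  rw [linearIndependent_iff]
  intro a ha
  by_contra hne
  -- At an index of maximal measure in the support, only the diagonal entry contributes.
  obtain ⟨l, hl, hmax⟩ := a.support.exists_max_image μ (Finsupp.support_nonempty_iff.2 hne)
  have h := congrArg (fun f => f l) ha
  simp only [Finsupp.linearCombination_apply, Finsupp.sum, Finsupp.finsetSum_apply,
    Finsupp.smul_apply, Finsupp.zero_apply] at h
  rw [Finset.sum_eq_single l, hcoord l l le_rfl, Finsupp.single_eq_same, smul_eq_mul] at h
  · exact mul_ne_zero (Finsupp.mem_support_iff.1 hl) (hc l) h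
  · intro k hk hkl
    rw [hcoord k l (hmax k hk), Finsupp.single_eq_of_ne hkl.symm, smul_zero]
  · exact fun h => absurd hl h

/-- Induction on the measure: the error term lies in the span of basis vectors of smaller measure.
-/
lemma triangular_span {κ : Type*} (μ : κ → ℕ) (w : κ → (κ →₀ ℚ)) (c : κ → ℚ)
    (hc : ∀ k, c k ≠ 0)
    (hw : ∀ k, w k - Finsupp.single k (c k) ∈ Finsupp.supported ℚ ℚ {l | μ l < μ k}) :
    ⊤ ≤ Submodule.span ℚ (Set.range w) := by
  have key : ∀ n k, μ k < n → Finsupp.single k 1 ∈ Submodule.span ℚ (Set.range w) := by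
    intro n
    induction n with
    | zero => exact fun k hk => absurd hk (Nat.not_lt_zero _)
    | succ n ih =>
      intro k hk
      have h1 : w k - Finsupp.single k (c k) ∈ Submodule.span ℚ (Set.range w) := by
        have h := hw k
        rw [Finsupp.supported_eq_span_single] at h
        refine Submodule.span_le.2 ?_ h
        rintro _ ⟨l, hl, rfl⟩
        exact ih l (lt_of_lt_of_le hl (Nat.lt_succ_iff.1 hk))
      have h2 : Finsupp.single k (c k) ∈ Submodule.span ℚ (Set.range w) := by
        have := Submodule.sub_mem _ (Submodule.subset_span (Set.mem_range_self k)) h1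
        rwa [sub_sub_cancel] at this
      have := Submodule.smul_mem _ (c k)⁻¹ h2
      rwa [Finsupp.smul_single, smul_eq_mul, inv_mul_cancel₀ (hc k)] at this
  intro x _
  induction x using Finsupp.induction_linear with
  | zero => exact zero_mem _
  | add x y hx hy => exact add_mem (hx trivial) (hy trivial)
  | single k r =>
    have := Submodule.smul_mem _ r (key _ k (Nat.lt_succ_self _))
    rwa [Finsupp.smul_single, smul_eq_mul, mul_one] at this

end Triangular

/-! ### Ordered products of stalk complexes -/

section Products

open HomologicalComplex

attribute [local instance] HasExt.standard

variable {A : Type u} [Category.{v} A] [Abelian A] {t : ℕ}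

lemma typ_zero : typ (0 : Cplx A t) = (fun _ => IsoClass.mk 0, 0) := by
  have hX : ∀ i, IsZero ((0 : Cplx A t).X i) := fun i =>
    (HomologicalComplex.eval A _ i).map_isZero (isZero_zero _)
  rw [typ_of_d_eq_zero fun i => (hX i).eq_of_src _ _]
  congr 1
  funext i
  exact IsoClass.mk_eq_iff.2 ⟨(hX i).iso (isZero_zero _)⟩

lemma isZero_rep_mk_zero : IsZero (IsoClass.mk (0 : A)).rep :=
  (isZero_zero A).of_iso (IsoClass.nonempty_iso _).some

/-- The truncation of a graded object. -/
def trunc (h : ZMod t → IsoClass A) (m : ℕ) (i : ZMod t) : IsoClass A :=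
  if i.val < m then h i else IsoClass.mk 0

lemma trunc_natCast (h : ZMod t → IsoClass A) {m : ℕ} (hm : m < t) :
    trunc h m (m : ZMod t) = IsoClass.mk 0 := by
  rw [trunc, ZMod.val_natCast_of_lt hm, if_neg (lt_irrefl m)]

variable {X : A} {j : ZMod t} {g : ZMod t → A}

/-- The differential of the split extension. -/
lemma biprod_d_eq_zero (hg : IsZero (g j)) : (stalk t X j ⊞ zeroCplx g).d j (j + 1) = 0 := by
  let s := Ses.biprod (stalk t X j) (zeroCplx g)
  have := s.isIso_p_f_of_isZero hg
  let l : stalk t X j ⟶ stalk t X j ⊞ zeroCplx g := biprod.inl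
  have h1 : l.f j ≫ s.p.f j = 𝟙 _ := congrArg (fun φ : stalk t X j ⟶ stalk t X j => φ.f j)
    (biprod.inl_fst : l ≫ s.p = 𝟙 (stalk t X j))
  have h2 : IsIso (l.f j) := isIso_of_comp_hom_eq_id _ h1
  rw [← cancel_epi (l.f j), comp_zero, l.comm]
  exact (congrArg (· ≫ _) (single_obj_d _ _ _ _ _)).trans zero_comp

variable [NeZero t]

lemma update_trunc (h : ZMod t → IsoClass A) {m : ℕ} (hm : m < t) :
    Function.update (trunc h m) (m : ZMod t) (h m) = trunc h (m + 1) := by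
  funext i
  by_cases hi : i = m
  · rw [hi, Function.update_self, trunc, ZMod.val_natCast_of_lt hm, if_pos (Nat.lt_succ_self m)]
  · have hi' : i.val ≠ m := fun h => hi (by rw [← h, ZMod.natCast_zmod_val])
    rw [Function.update_of_ne hi, trunc, trunc]
    congr 1
    exact propext ⟨fun h => by omega, fun h => by omega⟩

lemma trunc_self (h : ZMod t → IsoClass A) : trunc h t = h := by
  funext i
  rw [trunc, if_pos (ZMod.val_lt i)]

variable [FiniteHomExt A]

lemma typeLin_one : typeLin A t 1 = Finsupp.single (fun _ => IsoClass.mk 0, 0) 1 := by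
  rw [← typ_zero, ← ctyp_mk]
  exact typeLin_of _

/-- The products of stalk complexes and complexes with zero differential are, up to terms of smaller
measure, the classes of direct sums. -/
lemma typeLin_stalk_mul [Hereditary A] (hj : j + 1 ≠ j) (hg : IsZero (g j)) :
    ∃ c : ℚ, c ≠ 0 ∧
      typeLin A t (HallAlgebra.of (IsoClass.mk (stalk t X j)) *
        HallAlgebra.of (IsoClass.mk (zeroCplx g))) - Finsupp.single
          (Function.update (fun i => IsoClass.mk (g i)) j (IsoClass.mk X), 0) c ∈
        Finsupp.supported ℚ ℚ {x | typeMeasure j x.1 <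
          typeMeasure j (Function.update (fun i => IsoClass.mk (g i)) j (IsoClass.mk X))} := by
  classical
  set τ : CplxType A t := (Function.update (fun i => IsoClass.mk (g i)) j (IsoClass.mk X), 0)
  have := Fintype.ofFinite (Abelian.Ext.{max u v} (stalk t X j) (zeroCplx g) 1)
  -- The extension classes whose middle term has the type of the direct sum; the split class is one
  -- of them, so the leading coefficient is nonzero.
  let S : Finset (Abelian.Ext.{max u v} (stalk t X j) (zeroCplx g) 1) :=
    Finset.univ.filter fun e => typ (mid e) = τ
  let n : ℚ := (Nat.card (stalk t X j ⟶ zeroCplx g) : ℚ)⁻¹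
  have hn : n ≠ 0 := by
    have := HallFinite.finite_hom (stalk t X j) (zeroCplx g)
    exact inv_ne_zero (by exact_mod_cast Nat.card_pos.ne')
  have hS : S.Nonempty := by
    let s := Ses.biprod (stalk t X j) (zeroCplx g)
    obtain ⟨φ, -⟩ := (midSes s.cls).exists_iso_of_cls_eq s (midSes_cls _)
    refine ⟨s.cls, Finset.mem_filter.2 ⟨Finset.mem_univ _, ?_⟩⟩
    rw [typ_eq_iff.2 (SameType.of_iso φ)]
    exact s.typ_of_d_eq_zero hg (biprod_d_eq_zero hg)
  refine ⟨n * S.card, mul_ne_zero hn (by exact_mod_cast hS.card_pos.ne'), ?_⟩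
  have h : typeLin A t (HallAlgebra.of (IsoClass.mk (stalk t X j)) *
      HallAlgebra.of (IsoClass.mk (zeroCplx g))) =
      n • ∑ e : Abelian.Ext.{max u v} (stalk t X j) (zeroCplx g) 1,
        Finsupp.single (typ (mid e)) 1 := by
    refine (hallLin_mul (fun x => Finsupp.single (ctyp x) (1 : ℚ)) _ _).trans ?_
    rw [finsum_eq_sum_of_fintype]
    simp only [ctyp_mk]
    rfl
  have h1 : ∑ e ∈ S, Finsupp.single (typ (mid e)) (1 : ℚ) = Finsupp.single τ (S.card : ℚ) := by
    rw [Finset.sum_congr rfl fun e he => by rw [(Finset.mem_filter.1 he).2], Finset.sum_const,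
      Finsupp.smul_single, nsmul_one]
  rw [h, ← Finset.sum_filter_add_sum_filter_not _ (fun e => typ (mid e) = τ), smul_add, h1,
    Finsupp.smul_single, smul_eq_mul, add_sub_cancel_left]
  refine Submodule.smul_mem _ _ (Submodule.sum_mem _ fun e he => ?_)
  -- Were the differential out of degree `j` zero, the type would be that of the direct sum and the
  -- class would belong to `S`.
  refine Finsupp.single_mem_supported ℚ _ ((midSes e).typeMeasure_lt hj hg fun hd => ?_)
  exact (Finset.mem_filter.1 he).2 ((midSes e).typ_of_d_eq_zero hg hd)

/-- There is no room for a differential out of degree `j`, so every extension has the type of the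
direct sum. -/
lemma typeLin_stalk_mul_of_isZero [Hereditary A] (hg : IsZero (g j)) (hg' : IsZero (g (j + 1)))
    (hj : j + 1 ≠ j) :
    ∃ c : ℚ, c ≠ 0 ∧
      typeLin A t (HallAlgebra.of (IsoClass.mk (stalk t X j)) *
        HallAlgebra.of (IsoClass.mk (zeroCplx g))) = Finsupp.single
          (Function.update (fun i => IsoClass.mk (g i)) j (IsoClass.mk X), 0) c := by
  refine ⟨(euler (stalk t X j) (zeroCplx g))⁻¹, inv_ne_zero (euler_ne_zero _ _), ?_⟩
  rw [← Finsupp.smul_single_one]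
  refine hallLin_mul_of_forall_eq (fun x => Finsupp.single (ctyp x) (1 : ℚ)) _ _ _ ?_
  rintro L ⟨s⟩
  have := s.isIso_i_f_of_ne hj
  rw [ctyp_mk, s.typ_of_d_eq_zero hg]
  exact (hg'.of_iso (asIso (s.i.f (j + 1))).symm).eq_of_tgt _ _

/-- The products of the stalk complexes with the given terms. -/
def stalkProd (h : ZMod t → IsoClass A) : ℕ → HallAlgebra (Cplx A t)
  | 0 => 1
  | m + 1 => HallAlgebra.of (IsoClass.mk (stalk t (h m).rep m)) * stalkProd h m

variable [Hereditary A]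

/-- With fewer than `t` factors, each new stalk sits in a degree whose successor is still empty, so
no correction terms arise. -/
lemma typeLin_stalkProd (h : ZMod t → IsoClass A) (m : ℕ) (hm : m + 1 ≤ t) :
    ∃ c : ℚ, c ≠ 0 ∧ typeLin A t (stalkProd h m) = Finsupp.single (trunc h m, 0) c := by
  induction m with
  | zero =>
    refine ⟨1, one_ne_zero, typeLin_one.trans ?_⟩
    congr 2
  | succ m ih =>
    obtain ⟨c, hc, h1⟩ := ih (by omega)
    have hj : (m : ZMod t) + 1 ≠ m := fun h0 => by
      have : ((m + 1 : ℕ) : ZMod t) = (m : ℕ) := by exact_mod_cast h0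
      rw [ZMod.natCast_eq_natCast_iff', Nat.mod_eq_of_lt hm, Nat.mod_eq_of_lt (by omega)] at this
      omega
    obtain ⟨c', hc', h2⟩ := typeLin_stalk_mul_of_isZero (X := (h m).rep) (j := (m : ZMod t))
      (g := fun i => (trunc h m i).rep)
      (by rw [trunc_natCast h (by omega)]; exact isZero_rep_mk_zero)
      (by
        rw [trunc, if_neg]
        · exact isZero_rep_mk_zero
        · rw [← Nat.cast_succ, ZMod.val_natCast_of_lt (by omega)]
          omega) hj
    simp only [IsoClass.mk_rep] at h2
    rw [update_trunc h (by omega)] at h2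
    refine ⟨c * c', mul_ne_zero hc hc', ?_⟩
    rw [stalkProd, ← actLin_typeLin, h1, ← Finsupp.smul_single_one, map_smul, ← ctyp_Gc,
      ← typeLin_of, actLin_typeLin, Gc, h2, Finsupp.smul_single, smul_eq_mul]

/-- Only the factor in degree `t - 1` can map to an occupied degree, namely 0, and the measure
attached to these two degrees controls the correction terms. -/
lemma exists_typeMeasure : ∃ μ : (ZMod t → IsoClass A) → ℕ, ∀ h : ZMod t → IsoClass A,
    ∃ c : ℚ, c ≠ 0 ∧ typeLin A t (stalkProd h t) - Finsupp.single (h, 0) c ∈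
      Finsupp.supported ℚ ℚ {x | μ x.1 < μ h} := by
  obtain ⟨n, rfl⟩ : ∃ n, t = n + 1 := Nat.exists_eq_succ_of_ne_zero (NeZero.ne t)
  obtain rfl | hn := Nat.eq_zero_or_pos n
  -- For `t = 1` the product is a single stalk complex and has no correction term, so a constant
  -- measure will do.
  · refine ⟨fun _ => 0, fun h => ⟨1, one_ne_zero, ?_⟩⟩
    have h1 : stalkProd h (0 + 1) =
        HallAlgebra.of (IsoClass.mk (stalk (0 + 1) (h (0 : ℕ)).rep ((0 : ℕ) : ZMod (0 + 1)))) :=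
      mul_one _
    have h2 : typ (stalk (0 + 1) (h (0 : ℕ)).rep ((0 : ℕ) : ZMod (0 + 1))) = (h, 0) := by
      refine (typ_of_d_eq_zero (L := stalk (0 + 1) (h (0 : ℕ)).rep ((0 : ℕ) : ZMod (0 + 1)))
        fun i => single_obj_d _ _ _ _ _).trans ?_
      congr 1
      funext i
      obtain rfl : i = ((0 : ℕ) : ZMod (0 + 1)) := Subsingleton.elim (α := Fin 1) _ _
      refine Eq.trans ?_ (IsoClass.mk_rep _)
      exact IsoClass.mk_eq_iff.2 ⟨singleObjXSelf _ _ _⟩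
    rw [h1, typeLin_of, ctyp_mk, h2, sub_self]
    exact zero_mem _
  · refine ⟨typeMeasure (n : ZMod (n + 1)), fun h => ?_⟩
    have hj : (n : ZMod (n + 1)) + 1 ≠ n := fun h0 => by
      have : ((n + 1 : ℕ) : ZMod (n + 1)) = (n : ℕ) := by exact_mod_cast h0
      rw [ZMod.natCast_eq_natCast_iff', Nat.mod_self, Nat.mod_eq_of_lt (by omega)] at this
      omega
    obtain ⟨c, hc, h1⟩ := typeLin_stalkProd h n le_rfl
    obtain ⟨c', hc', h2⟩ := typeLin_stalk_mul (X := (h n).rep) (j := (n : ZMod (n + 1)))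
      (g := fun i => (trunc h n i).rep) hj
      (by rw [trunc_natCast h (by omega)]; exact isZero_rep_mk_zero)
    simp only [IsoClass.mk_rep] at h2
    rw [update_trunc h (by omega), trunc_self] at h2
    refine ⟨c * c', mul_ne_zero hc hc', ?_⟩
    -- The partial product has a multiple of the type vector of the complex `Gc` of the truncation;
    -- the action depends only on this vector, so the product may be computed with that complex.
    have h3 := Submodule.smul_mem _ c h2
    rwa [smul_sub, Finsupp.smul_single, smul_eq_mul, ← map_smul, ← mul_smul_comm,
      ← actLin_typeLin, map_smul, ← Gc, typeLin_of, ctyp_Gc, Finsupp.smul_single_one, ← h1,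
      actLin_typeLin] at h3

end Products

/-! ### Elementary acyclic complexes as operators -/

section ElementaryAcyclic

variable {A : Type u} [Category.{v} A] [Abelian A] {t : ℕ}

lemma cls_gr (X : A) (i j : ZMod t) : K0.cls (gr t X i j) = (Pi.single i (K0.cls X) : ZMod t → K0 A) j := by
  rw [gr, Pi.single_apply]
  split_ifs
  · rfl
  · exact K0.cls_zero

lemma dimv_elemAcyclic (X : A) (i : ZMod t) :
    dimv (elemAcyclic t X i) = Pi.single (i - 1) (K0.cls X) + Pi.single i (K0.cls X) := by
  funext j
  exact (K0.cls_biprod _ _).trans (by rw [cls_gr, cls_gr, Pi.add_apply])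

lemma imv_elemAcyclic (X : A) (i : ZMod t) :
    imv (elemAcyclic t X i) = Pi.single (i - 1) (K0.cls X) := by
  funext j
  rw [← cls_gr]
  let f : gr t X (i - 1) j ⊞ gr t X i j ⟶ gr t X (i - 1) (j + 1) ⊞ gr t X i (j + 1) :=
    biprod.fst ≫ eqToHom (gr_succ t X i j (j + 1) rfl) ≫ biprod.inr
  have hd : (elemAcyclic t X i).d j (j + 1) = f := dif_pos rfl
  have : StrongEpi (biprod.fst : gr t X (i - 1) j ⊞ gr t X i j ⟶ gr t X (i - 1) j) :=
    strongEpi_of_epi _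
  have e : gr t X (i - 1) j ≅ Limits.image f := Limits.image.isoStrongEpiMono _ _ rfl
  exact (congrArg (fun φ : gr t X (i - 1) j ⊞ gr t X i j ⟶
    gr t X (i - 1) (j + 1) ⊞ gr t X i (j + 1) => K0.cls (Limits.image φ)) hd).trans
      (K0.cls_iso e).symm

/-- The operators shifting the classes of the images and rescaling the basis elements. -/
def IsDiagShift (T : Module.End ℚ (CplxType A t →₀ ℚ)) (γ : ZMod t → K0 A) : Prop :=
  ∃ c : CplxType A t → ℚ, (∀ x, c x ≠ 0) ∧ T = diagShift c γ

lemma isDiagShift_one : IsDiagShift (A := A) (t := t) 1 0 :=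
  ⟨fun _ => 1, fun _ => one_ne_zero, diagShift_one.symm⟩

lemma IsDiagShift.mul {T T' : Module.End ℚ (CplxType A t →₀ ℚ)} {γ γ' : ZMod t → K0 A}
    (h : IsDiagShift T γ) (h' : IsDiagShift T' γ') : IsDiagShift (T * T') (γ + γ') := by
  obtain ⟨c, hc, rfl⟩ := h
  obtain ⟨c', hc', rfl⟩ := h'
  exact ⟨_, fun x => mul_ne_zero (hc' _) (hc _), diagShift_mul _ _ _ _⟩

lemma IsDiagShift.smul {T : Module.End ℚ (CplxType A t →₀ ℚ)} {γ : ZMod t → K0 A}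
    (h : IsDiagShift T γ) {r : ℚ} (hr : r ≠ 0) : IsDiagShift (r • T) γ := by
  obtain ⟨c, hc, rfl⟩ := h
  exact ⟨_, fun x => mul_ne_zero hr (hc _), smul_diagShift _ _ _⟩

lemma IsDiagShift.prod_ofFn {n : ℕ} {T : Fin n → Module.End ℚ (CplxType A t →₀ ℚ)}
    {γ : Fin n → ZMod t → K0 A} (h : ∀ k, IsDiagShift (T k) (γ k)) :
    IsDiagShift (List.ofFn T).prod (∑ k, γ k) := by
  induction n with
  | zero => exact isDiagShift_one
  | succ n ih =>
    rw [List.ofFn_succ, List.prod_cons, Fin.sum_univ_succ]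
    exact (h 0).mul (ih fun k => h k.succ)

lemma cdim_Gc_zero : cdim (Gc fun _ : ZMod t => IsoClass.mk (0 : A)) = 0 := by
  rw [Gc, cdim_mk]
  funext i
  exact (K0.cls_iso (isZero_rep_mk_zero.iso (isZero_zero A))).trans K0.cls_zero

variable [NeZero t] [FiniteHomExt A] [Hereditary A]

lemma chi_neg_right (α β : K0 A) : chi α (-β) = (chi α β)⁻¹ := by
  refine eq_inv_of_mul_eq_one_left ?_
  rw [← chi_add_right, neg_add_cancel, chi_zero_right]

lemma cotwist_zero_right (β : ZMod t → K0 A) : cotwist β 0 = 1 := by simp [cotwist, chi_zero_right]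

lemma twist_neg_single (d : ZMod t → K0 A) (i : ZMod t) (β : K0 A) :
    twist d (-Pi.single (i - 1) β) = chi (d i) β := by
  rw [twist, Finset.prod_eq_single (i - 1)]
  · rw [sub_add_cancel, Pi.neg_apply, Pi.single_eq_same, chi_neg_right, inv_inv]
  · intro j _ hj
    rw [Pi.neg_apply, Pi.single_eq_of_ne hj, neg_zero, chi_zero_right, inv_one]
  · exact fun h => absurd (Finset.mem_univ _) h

/-- For `t = 1` both copies of `X` lie in the same degree, which explains the exponent 2. -/
lemma chi_dimv_elemAcyclic (X : A) (i : ZMod t) (β : K0 A) :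
    chi (dimv (elemAcyclic t X i) i) β = chi (K0.cls X) β ^ (if t = 1 then 2 else 1) := by
  rw [dimv_elemAcyclic, Pi.add_apply, Pi.single_eq_same]
  split_ifs with ht
  · subst ht
    have : i - 1 = i := Subsingleton.elim (α := Fin 1) _ _
    rw [this, Pi.single_eq_same, chi_add_left, sq]
  · rw [Pi.single_eq_of_ne, zero_add, pow_one]
    intro h
    have h1 : ((1 : ℕ) : ZMod t) = 0 := by
      rw [eq_comm, sub_eq_self] at h
      exact_mod_cast h
    exact ht (Nat.dvd_one.1 ((ZMod.natCast_eq_zero_iff 1 t).1 h1))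

lemma actLoc_K (X : A) (i : ZMod t) : actLoc A t (SDH.K t X i) =
    diagShift (acyclicCoeff (elemAcyclic t X i)) (Pi.single (i - 1) (K0.cls X)) := by
  rw [← imv_elemAcyclic]
  exact actLoc_acyclic (elemAcyclic_acyclic X i)

lemma actLoc_K_inv (X : A) (i : ZMod t) : actLoc A t ((SDH.K t X i)⁻¹ : (SDH A t)ˣ) =
    diagShiftInv (acyclicCoeff (elemAcyclic t X i)) (Pi.single (i - 1) (K0.cls X)) := by
  refine (left_inv_eq_right_inv (diagShift_inv_mul _ _ (acyclicCoeff_ne_zero _)) ?_).symm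
  rw [← actLoc_K, ← map_mul, Units.mul_inv, map_one]

lemma isDiagShift_KFrac (P N : A) (i : ZMod t) :
    IsDiagShift (actLoc A t (SDH.KFrac t P N i)) (Pi.single (i - 1) (K0.cls P - K0.cls N)) := by
  have h1 : IsDiagShift (actLoc A t (SDH.K t P i)) (Pi.single (i - 1) (K0.cls P)) :=
    ⟨_, acyclicCoeff_ne_zero (elemAcyclic t P i), actLoc_K P i⟩
  have h2 : IsDiagShift (actLoc A t ((SDH.K t N i)⁻¹ : (SDH A t)ˣ))
      (-Pi.single (i - 1) (K0.cls N)) :=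
    ⟨_, fun x => inv_ne_zero (acyclicCoeff_ne_zero (elemAcyclic t N i) _), actLoc_K_inv N i⟩
  rw [SDH.KFrac, map_smul, map_mul, Pi.single_sub, sub_eq_add_neg]
  refine (h1.mul h2).smul ?_
  exact pow_ne_zero _ (inv_ne_zero (div_ne_zero (euler_ne_zero _ _) (euler_ne_zero _ _)))

/-- On the type of the zero complex, the inverse for `N` contributes the Euler form of `N` and `N`
to the power `-m`; then `P` contributes that of `P` and `N` to the power `m`. The normalizing scalar
cancels both, so only the difference of the classes remains. -/
lemma typeLin_KFrac (P N : A) (i : ZMod t) : SDH.typeLin A t (SDH.KFrac t P N i) =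
    Finsupp.single (fun _ => IsoClass.mk 0, Pi.single (i - 1) (K0.cls P - K0.cls N)) 1 := by
  have hs : Pi.single (M := fun _ : ZMod t => K0 A) (i - 1) (K0.cls P - K0.cls N) =
      Pi.single (i - 1) (K0.cls P) + -Pi.single (i - 1) (K0.cls N) := by
    rw [Pi.single_sub, sub_eq_add_neg]
  have hn : chi (K0.cls N) (K0.cls N) ≠ 0 := chi_ne_zero _ _
  have hp : chi (K0.cls P) (K0.cls N) ≠ 0 := chi_ne_zero _ _
  rw [SDH.typeLin_apply, SDH.KFrac, map_smul, map_mul, actLoc_K, actLoc_K_inv, typeLin_one,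
    LinearMap.smul_apply, Module.End.mul_apply, diagShiftInv, diagShift_single, diagShift_single,
    Finsupp.smul_single, ← chi_cls, ← chi_cls, acyclicCoeff, acyclicCoeff, cdim_Gc_zero, add_zero,
    cotwist_zero_right, cotwist_zero_right, mul_one, mul_one, twist_neg_single,
    twist_neg_single, chi_dimv_elemAcyclic, chi_dimv_elemAcyclic, hs]
  refine congrArg _ ?_
  rw [smul_eq_mul, one_mul, inv_pow, div_pow]
  field_simp

/-- The elements `KFrac` only depend on the class in the Grothendieck group. -/
lemma KFrac_congr {P N P' N' : A} (h : K0.cls P - K0.cls N = K0.cls P' - K0.cls N') (i : ZMod t) :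
    SDH.KFrac t P N i = SDH.KFrac t P' N' i :=
  SDH.typeLin_injective (by rw [typeLin_KFrac, typeLin_KFrac, h])

lemma isDiagShift_Kα (α : K0 A) (i : ZMod t) :
    IsDiagShift (actLoc A t (SDH.Kα t α i)) (Pi.single (i - 1) α) := by
  have h := isDiagShift_KFrac (t := t) (K0.exists_sub α).choose.1 (K0.exists_sub α).choose.2 i
  rwa [← (K0.exists_sub α).choose_spec] at h

end ElementaryAcyclic

/-! ### The basis of ordered products -/

section Main

variable {A : Type u} [Category.{v} A] [Abelian A] {t : ℕ} [NeZero t]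

variable (t) in
/-- The degrees `0, …, t - 1`. -/
def degreeEquiv : Fin t ≃ ZMod t where
  toFun k := (k.val : ZMod t)
  invFun i := ⟨i.val, ZMod.val_lt i⟩
  left_inv k := Fin.ext (ZMod.val_natCast_of_lt k.2)
  right_inv i := ZMod.natCast_zmod_val i

/-- The indices of the basis elements as types of complexes. -/
def indexEquiv : (Fin t → K0 A) × (Fin t → IsoClass A) ≃ CplxType A t :=
  -- The subtraction of 1 reflects that the acyclic element of degree `k` changes the image class in
  -- degree `k - 1`.
  (Equiv.prodComm _ _).trans (((degreeEquiv t).arrowCongr (Equiv.refl _)).prodCongr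
    (((degreeEquiv t).trans (Equiv.subRight 1)).arrowCongr (Equiv.refl _)))

lemma sum_single_eq (α : Fin t → K0 A) (X : Fin t → IsoClass A) :
    ∑ k : Fin t, Pi.single ((k.val : ZMod t) - 1) (α k) = (indexEquiv (α, X)).2 := by
  rw [← ((degreeEquiv t).trans (Equiv.subRight 1)).symm.sum_comp]
  funext i
  rw [Finset.sum_apply, Finset.sum_eq_single i]
  · have h : (((((degreeEquiv t).trans (Equiv.subRight 1)).symm i).val : ZMod t) - 1) = i :=
      ((degreeEquiv t).trans (Equiv.subRight 1)).apply_symm_apply i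
    rw [h, Pi.single_eq_same]
    rfl
  · intro j _ hj
    have h : (((((degreeEquiv t).trans (Equiv.subRight 1)).symm j).val : ZMod t) - 1) = j :=
      ((degreeEquiv t).trans (Equiv.subRight 1)).apply_symm_apply j
    rw [h, Pi.single_eq_of_ne hj.symm]
  · exact fun h => absurd (Finset.mem_univ _) h

variable [FiniteHomExt A]

lemma ofHall_stalkProd (h : ZMod t → IsoClass A) (n : ℕ) :
    (List.ofFn fun k : Fin n => SDH.U t (h (k.val : ZMod t)) (k.val : ZMod t)).reverse.prod =
      SDH.ofHall A t (stalkProd h n) := by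
  induction n with
  | zero => exact (map_one _).symm
  | succ n ih =>
    rw [List.ofFn_succ', List.concat_eq_append, List.reverse_concat, List.prod_cons, stalkProd, map_mul, ← ih]
    rfl

lemma prod_U_eq (α : Fin t → K0 A) (X : Fin t → IsoClass A) :
    (List.ofFn fun k : Fin t => SDH.U t (X k) (k.val : ZMod t)).reverse.prod =
      SDH.ofHall A t (stalkProd (indexEquiv (α, X)).1 t) := by
  rw [← ofHall_stalkProd]
  congr 3
  funext k
  congr 1
  exact (congrArg X ((degreeEquiv t).symm_apply_apply k)).symm

variable [Hereditary A]

/-- The ordered products of the elements `K_{α,i}` and `U_{X,i}`. -/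
def orderedProd (x : (Fin t → K0 A) × (Fin t → IsoClass A)) : SDH A t :=
  (List.ofFn fun k : Fin t => SDH.Kα t (x.1 k) (k.val : ZMod t)).prod *
    (List.ofFn fun k : Fin t => SDH.U t (x.2 k) (k.val : ZMod t)).reverse.prod

/-- The acyclic part acts by a shift with nonzero scalars that leaves the homology component alone.
The measure depends only on this component, so triangularity of the stalk products is preserved. -/
lemma exists_typeLin_orderedProd : ∃ μ : CplxType A t → ℕ,
    ∀ x : (Fin t → K0 A) × (Fin t → IsoClass A), ∃ c : ℚ, c ≠ 0 ∧
      SDH.typeLin A t (orderedProd x) - Finsupp.single (indexEquiv x) c ∈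
        Finsupp.supported ℚ ℚ {y | μ y < μ (indexEquiv x)} := by
  obtain ⟨μ, hμ⟩ := exists_typeMeasure (A := A) (t := t)
  refine ⟨fun y => μ y.1, fun ⟨α, X⟩ => ?_⟩
  obtain ⟨c, hc, h⟩ := hμ (indexEquiv (α, X)).1
  obtain ⟨c', hc', hT⟩ : IsDiagShift (actLoc A t
      (List.ofFn fun k : Fin t => SDH.Kα t (α k) (k.val : ZMod t)).prod)
      (indexEquiv (α, X)).2 := by
    rw [map_list_prod, List.map_ofFn, ← sum_single_eq α X]
    exact .prod_ofFn fun k => isDiagShift_Kα (α k) (k.val : ZMod t)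
  refine ⟨c * c' ((indexEquiv (α, X)).1, 0), mul_ne_zero hc (hc' _), ?_⟩
  have h1 : Finsupp.single (indexEquiv (α, X)) (c * c' ((indexEquiv (α, X)).1, 0)) =
      diagShift c' (indexEquiv (α, X)).2 (Finsupp.single ((indexEquiv (α, X)).1, 0) c) := by
    rw [diagShift_single, add_zero]
  rw [orderedProd, SDH.typeLin_mul, prod_U_eq α X, SDH.typeLin_ofHall, hT, h1, ← map_sub]
  rw [Finsupp.supported_eq_span_single] at h
  refine (Submodule.span_le.2 ?_ : _ ≤ (Finsupp.supported ℚ ℚ _).comap _) h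
  rintro _ ⟨y, hy, rfl⟩
  refine (Submodule.mem_comap).2 ?_
  rw [diagShift_single]
  exact Finsupp.single_mem_supported ℚ _ hy

-- The images of the ordered products under `SDH.typeLin` form a triangular family. Linear
-- independence pulls back along any linear map; spanning pulls back because this one is injective.
variable (A t) in
lemma exists_basis_orderedProd :
    ∃ b : Module.Basis ((Fin t → K0 A) × (Fin t → IsoClass A)) ℚ (SDH A t),
      ∀ x, b x = orderedProd x := by
  obtain ⟨μ, hμ⟩ := exists_typeLin_orderedProd (A := A) (t := t)
  choose c hc hw using hμ
  let w : CplxType A t → (CplxType A t →₀ ℚ) := fun τ =>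
    SDH.typeLin A t (orderedProd (indexEquiv.symm τ))
  have hw' : ∀ τ, w τ - Finsupp.single τ (c (indexEquiv.symm τ)) ∈
      Finsupp.supported ℚ ℚ {y | μ y < μ τ} := fun τ => by
    have h := hw (indexEquiv.symm τ)
    rwa [Equiv.apply_symm_apply] at h
  have hli := triangular_linearIndependent μ w _ (fun τ => hc _) hw'
  have hsp := triangular_span μ w _ (fun τ => hc _) hw'
  have hwe : w ∘ indexEquiv = SDH.typeLin A t ∘ orderedProd := by
    funext x
    exact congrArg (fun y => SDH.typeLin A t (orderedProd y)) (indexEquiv.symm_apply_apply x)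
  have hli' : LinearIndependent ℚ (orderedProd (A := A) (t := t)) := by
    refine LinearIndependent.of_comp (SDH.typeLin A t) ?_
    rw [← hwe]
    exact hli.comp _ indexEquiv.injective
  refine ⟨Module.Basis.mk hli' fun x _ => ?_, fun x => Module.Basis.mk_apply _ _ _⟩
  have h : SDH.typeLin A t x ∈
      (Submodule.span ℚ (Set.range (orderedProd (A := A) (t := t)))).map (SDH.typeLin A t) := by
    rw [Submodule.map_span, ← Set.range_comp, ← hwe, Set.range_comp, Equiv.range_eq_univ,
      Set.image_univ]
    exact hsp trivial
  obtain ⟨y, hy, hyx⟩ := h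
  rwa [← SDH.typeLin_injective hyx]

end Main

end SemiDerived

end

theorem theorem3p14 {k : Type*} [Field k] [Finite k] {A : Type u} [Category.{v} A] [Abelian A]
    [Linear k A] [SemiDerived.FiniteHomExt A] [SemiDerived.Hereditary A] (t : ℕ) [NeZero t] :
    -- the elements `K_{α,i}` do not depend on the expression of `α` as a difference
    (∀ (P N : A) (i : ZMod t),
      SemiDerived.SDH.Kα t (SemiDerived.K0.cls P - SemiDerived.K0.cls N) i =
        SemiDerived.SDH.KFrac t P N i) ∧
    -- the ordered products form a basis
    ∃ b : Module.Basis ((Fin t → SemiDerived.K0 A) × (Fin t → SemiDerived.IsoClass A)) ℚ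
        (SemiDerived.SDH A t),
      ∀ (α : Fin t → SemiDerived.K0 A) (X : Fin t → SemiDerived.IsoClass A),
        b (α, X) =
          (List.ofFn fun j : Fin t => SemiDerived.SDH.Kα t (α j) (j.val : ZMod t)).prod *
          (List.ofFn fun j : Fin t => SemiDerived.SDH.U t (X j) (j.val : ZMod t)).reverse.prod := by
  refine ⟨fun P N i => ?_, ?_⟩
  · exact SemiDerived.KFrac_congr
      (SemiDerived.K0.exists_sub (SemiDerived.K0.cls P - SemiDerived.K0.cls N)).choose_spec.symm i
  · obtain ⟨b, hb⟩ := SemiDerived.exists_basis_orderedProd A t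
    exact ⟨b, fun α X => hb (α, X)⟩
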